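/- Let $n\ge1$, $V=\mathbb C^n$, $\tau\in\mathbb C\setminus\{0\}$, $q=e^{2\pi i\tau}$, $q^c:=e^{2\pi i\tau c}$, $\gamma=q^{1/n}$ and $i_q=\frac{q^i-q^{-i}}{q-q^{-1}}=\sum_{j=0}^{i-1}q^{i-1-2j}$. **R-matrix.** $R\in\operatorname{Aut}(V\otimes V)$ is of $SL(n)$ type: $R_1R_2R_1=R_2R_1R_2$ (where $R_i$ acts in the tensor factors $i,i+1$); $(R-q)(R+q^{-1})=0$; $i_q\ne0$ for $2\le i\le n$; there is $\Psi$ with $\mathrm{Tr}_{(2)}R_{12}\Psi_{23}=\mathrm{Tr}_{(2)}\Psi_{12}R_{23}=P_{13}$ ($P$ the flip); and, with $A^{(1)}=I$, $A^{(i)}=\frac{(i-1)_q}{i_q}A^{(i-1)}\bigl(\frac{q^{i-1}}{(i-1)_q}-R_{i-1}\bigr)A^{(i-1)}$, one has $A^{(n)}\bigl(\frac{q^n}{n_q}-R_n\bigr)A^{(n)}=0$, $\operatorname{rk}A^{(n)}=1$ and $\mathrm{Tr}_{(2,\dots,n+1)}(P_1\cdots P_nA^{(n)})\propto I_1$. Put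 $D=\mathrm{Tr}_{(2)}\Psi_{12}$, $\mathrm{Tr}_RX=\mathrm{Tr}(DX)$; $\mathrm{Tr}_{R_{op}}$ is the same for $R_{op}=PRP$ and $P\Psi P$. **Calculus.** $\mathcal C$ is the associative unital $\mathbb C$-algebra generated by the entries of $n\times n$ matrices $T,\Omega,L,K$, with $T,L,K$ and their quantum determinants $\det_RT=\mathrm{Tr}_{(1..n)}(A^{(n)}T_1\cdots T_n)$, $\det_RL=a_n$, $\det_RK=b_n$ (below) invertible, subject to $$RT_1T_2=T_1T_2R,\quad R\Omega_1R^{-1}T_1=T_1\Omega_2,\quad RL_1RL_1=L_1RL_1R,\quad RL_1RT_1=\gamma^2T_1L_2,\quad RL_1R\Omega_1=\Omega_1RL_1R,$$ $$RK_2RK_2=K_2RK_2R,\quad T_2RK_2R=\gamma^2K_1T_2,\quad K_1\Omega_2=\Omega_2K_1,\quad K_1L_2=L_2K_1,$$ and, for the $GL_q(n)$ calculus, $R\Omega_1R\Omega_1=-\Omega_1R\Omega_1R^{-1}$; for the $SL_q(n)$ calculus instead (assuming $n_q+q^n(q-q^{-1})\neq0$) $R\Omega_1R\Omega_1+\Omega_1R\Omega_1R^{-1}=\kappa_q(\Omega_1^2+R\Omega_1^2R)$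 with $\kappa_q=\frac{q^n(q-q^{-1})}{n_q+q^n(q-q^{-1})}$, together with $\det_RT=1$, $\mathrm{Tr}_R\Omega=0$, $\det_RL=\det_RK=q^{-1}$. Put $F=LTKT^{-1}$, $\Theta=T^{-1}\Omega T$, $G=T^{-1}FT$. **Spectral extension.** Let $a_i=\mathrm{Tr}_{R(1..i)}(A^{(i)}L_{\bar1}\cdots L_{\bar i})$, $L_{\bar1}=L_1$, $L_{\overline{j+1}}=R_jL_{\bar j}R_j^{-1}$; $c_i$ is the same for $F$; $b_i=\mathrm{Tr}_{R_{op}(1..i)}(A^{(i)}K_{\underline i}\cdots K_{\underline1})$ with $K_{\underline i}=K_i$, $K_{\underline j}=R_jK_{\underline{j+1}}R_j^{-1}$ $(j<i)$. Adjoin to $\mathcal C$ commuting variables $\mu_\alpha,\nu_\alpha,\rho_\alpha$ $(1\le\alpha\le n)$, invertible together with the differences $\mu_\alpha-\mu_\beta$, $\nu_\alpha-\nu_\beta$, $\rho_\alpha-\rho_\beta$ $(\alpha\ne\beta)$, with $\prod\mu_\alpha=\prod\nu_\alpha=q^{-1}$, $\prod\rho_\alpha=q^{-n^2}$ and $a_i=e_i(\mu)$,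 $b_i=e_i(\nu)$, $c_i=e_i(\rho)$ for $i\le n$ ($e_i$ the elementary symmetric functions). Put $P^\alpha=\prod_{\beta\ne\alpha}\frac{L-q\mu_\beta}{q(\mu_\alpha-\mu_\beta)}$, and define $Q^\alpha$ from $(K,\nu)$, $S^\alpha$ from $(F,\rho)$ in the same way. Impose: $\mu_\alpha$ commutes with $L,K,\Theta,G$; $\nu_\alpha$ with $L,K,\Omega,F$; $\rho_\alpha$ with $T,L,K,F,G$ and with $\mathrm{Tr}_RX$ for every monomial $X$ in the matrices $\Omega,F$; and $$\gamma^2(P^\beta T)\mu_\alpha=q^{2\delta_{\alpha\beta}}\mu_\alpha(P^\beta T),\qquad \gamma^2\nu_\alpha(TQ^\beta)=q^{2\delta_{\alpha\beta}}(TQ^\beta)\nu_\alpha,$$ $$q^{2\delta_{\alpha\sigma}}(P^\beta XP^\sigma)\mu_\alpha=q^{2\delta_{\alpha\beta}}\mu_\alpha(P^\beta XP^\sigma)\ (X=\Omega,F),\quad q^{2\delta_{\alpha\sigma}}(Q^\beta YQ^\sigma)\nu_\alpha=q^{2\delta_{\alpha\beta}}\nu_\alpha(Q^\beta YQ^\sigma)\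 (Y=\Theta,G),$$ $$q^{2\delta_{\alpha\sigma}}(S^\beta\Omega S^\sigma)\rho_\alpha=q^{2\delta_{\alpha\beta}}\rho_\alpha(S^\beta\Omega S^\sigma).$$ **Logarithmic variables.** The algebra $\widehat{\mathcal C}$ is obtained by adjoining further commuting variables $x_\alpha,y_\alpha,z_\alpha$ with all everywhere convergent power series $f(x)$, $f(y)$, $f(z)$ in them (added and multiplied as functions), where $\sum x_\alpha=\sum y_\alpha=\sum z_\alpha=0$, $\mu_\alpha=q^{-1/n}e^{2\pi ix_\alpha}$, $\nu_\alpha=q^{-1/n}e^{2\pi iy_\alpha}$, $\rho_\alpha=q^{-n}e^{2\pi iz_\alpha}$. The series in $x$, $y$, $z$ satisfy the same commutation relations as $\mu,\nu,\rho$ do, and the other permutation relations take the additive form: with $e_\beta$ the standard basis and $\mathbf 1=(1,\dots,1)$, $$(P^\beta T)f(x)=f\bigl(x+2\tau(e_\beta-\tfrac1n\mathbf 1)\bigr)(P^\beta T),\qquad f(y)(TQ^\beta)=(TQ^\beta)f\bigl(y+2\tau(e_\beta-\tfrac1n\mathbf 1)\bigr),$$ $$(P^\beta XP^\sigma)f(x)=f(x+2\tau(e_\beta-e_\sigma))(P^\beta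 XP^\sigma)\ (X=\Omega,F),\quad (Q^\beta YQ^\sigma)f(y)=f(y+2\tau(e_\beta-e_\sigma))(Q^\beta YQ^\sigma)\ (Y=\Theta,G),$$ $$(S^\beta\Omega S^\sigma)f(z)=f(z+2\tau(e_\beta-e_\sigma))(S^\beta\Omega S^\sigma).$$ **Theorem.** For $(t_1,t_2,t_3)\in\mathbb C^3$ the element $\varphi_{(t_1,t_2,t_3)}=\exp\bigl\{-\frac{i\pi}{2\tau}\sum_{\alpha=1}^n(t_1x_\alpha^2-t_2y_\alpha^2+t_3z_\alpha^2)\bigr\}$ of $\widehat{\mathcal C}$ (the product of the three commuting exponential series in $x$, $y$, $z$) is invertible, and $\phi_{(t_1,t_2,t_3)}:u\mapsto\varphi_{(t_1,t_2,t_3)}\,u\,\varphi_{(t_1,t_2,t_3)}^{-1}$ is a three-parameter family of inner automorphisms of $\widehat{\mathcal C}$. Consider the maps given on generators by $$\phi_L:\ T\mapsto LT,\ \Omega\mapsto L\Omega L^{-1},\ F\mapsto LFL^{-1},\ X\mapsto X\ (X=L,K,\Theta);$$ $$\phi_K:\ T\mapsto TK,\ \Theta\mapsto K^{-1}\Theta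 K,\ Y\mapsto Y\ (Y=L,K,\Omega,F);$$ $$\phi_F:\ T\mapsto T,\ \Omega\mapsto F\Omega F^{-1},\ Z\mapsto Z\ (Z=L,K,F),$$ and fixing the spectral variables, the logarithmic variables and all the series in them. Then $\phi_L=\phi_{(1,0,0)}$, $\phi_K=\phi_{(0,1,0)}$ and $\phi_F=\phi_{(0,0,1)}$: each of these members of the family is the unique algebra endomorphism of $\widehat{\mathcal C}$ that acts on the generators as stated. Moreover, if $\psi$ is an endomorphism of $\mathcal C$ that acts on the generators as $\phi_L$ (resp. $\phi_K$, $\phi_F$), then $\phi_{(1,0,0)}$ (resp. $\phi_{(0,1,0)}$, $\phi_{(0,0,1)}$) composed with the canonical map $\mathcal C\to\widehat{\mathcal C}$ equals this canonical map composed with $\psi$. -/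

import Mathlib

namespace QCalc

/-! ## Matrices over tensor powers of `V = ℂⁿ`

Operators on `V ⊗ V` are matrices indexed by `Fin n × Fin n`, operators on `V^{⊗ m}` are matrices
indexed by `Fin m → Fin n`.  Tensor factors are numbered from `0`.  Entries are taken in an
arbitrary (noncommutative) ring. -/

section Sites

variable {n : ℕ} {A : Type*}

/-- `X₁ = X ⊗ I` on `V ⊗ V`. -/
def leg1 [Zero A] (X : Matrix (Fin n) (Fin n) A) :
    Matrix (Fin n × Fin n) (Fin n × Fin n) A :=
  Matrix.of fun u v => if u.2 = v.2 then X u.1 v.1 else 0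

/-- `X₂ = I ⊗ X` on `V ⊗ V`. -/
def leg2 [Zero A] (X : Matrix (Fin n) (Fin n) A) :
    Matrix (Fin n × Fin n) (Fin n × Fin n) A :=
  Matrix.of fun u v => if u.1 = v.1 then X u.2 v.2 else 0

/-- The matrix `X` acting in the tensor factor number `i < m` of `V^{⊗ m}`. -/
def site [Zero A] (m i : ℕ) (X : Matrix (Fin n) (Fin n) A) :
    Matrix (Fin m → Fin n) (Fin m → Fin n) A :=
  Matrix.of fun u v =>
    if h : i < m then
      if ∀ j : Fin m, (j : ℕ) ≠ i → u j = v j then X (u ⟨i, h⟩) (v ⟨i, h⟩) else 0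
    else 0

/-- The matrix `X` on `V ⊗ V` acting in the neighbouring tensor factors number `i`, `i + 1 < m`
of `V^{⊗ m}`. -/
def bond [Zero A] (m i : ℕ) (X : Matrix (Fin n × Fin n) (Fin n × Fin n) A) :
    Matrix (Fin m → Fin n) (Fin m → Fin n) A :=
  Matrix.of fun u v =>
    if h : i + 1 < m then
      if ∀ j : Fin m, (j : ℕ) ≠ i → (j : ℕ) ≠ i + 1 → u j = v j then
        X (u ⟨i, by omega⟩, u ⟨i + 1, h⟩) (v ⟨i, by omega⟩, v ⟨i + 1, h⟩)
      else 0
    else 0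

/-- A complex matrix viewed as a matrix over a `ℂ`-algebra. -/
def scal {ι κ : Type*} (A : Type*) [Ring A] [Algebra ℂ A] (X : Matrix ι κ ℂ) : Matrix ι κ A :=
  X.map (algebraMap ℂ A)

/-- The permutation operator `P (u ⊗ v) = v ⊗ u` on `V ⊗ V`. -/
def flipMat (n : ℕ) : Matrix (Fin n × Fin n) (Fin n × Fin n) ℂ :=
  Matrix.of fun u v => if u = v.swap then 1 else 0

/-- `X_op = P X P`. -/
def opMat (X : Matrix (Fin n × Fin n) (Fin n × Fin n) ℂ) :
    Matrix (Fin n × Fin n) (Fin n × Fin n) ℂ :=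
  Matrix.of fun u v => X u.swap v.swap

/-- The partial trace over the second factor of `V ⊗ V`. -/
def ptr2 (X : Matrix (Fin n × Fin n) (Fin n × Fin n) ℂ) : Matrix (Fin n) (Fin n) ℂ :=
  Matrix.of fun a c => ∑ b, X (a, b) (c, b)

/-- `Tr (D X)`. -/
def tr1 [Ring A] [Algebra ℂ A] (D : Matrix (Fin n) (Fin n) ℂ) (X : Matrix (Fin n) (Fin n) A) : A :=
  ∑ i, ∑ j, D i j • X j i

/-- `Tr_{(1,…,m)} (D₁ ⋯ D_m X)`. -/
def trM [Ring A] [Algebra ℂ A] {m : ℕ} (D : Matrix (Fin n) (Fin n) ℂ)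
    (X : Matrix (Fin m → Fin n) (Fin m → Fin n) A) : A :=
  ∑ u, ∑ v, (∏ j, D (u j) (v j)) • X v u

end Sites

/-! ## R-matrices of `SL(n)` type -/

/-- The `q`-number `(qⁱ - q⁻ⁱ)/(q - q⁻¹) = q^{i-1} + q^{i-3} + ⋯ + q^{1-i}`. -/
noncomputable def qnum (q : ℂ) (i : ℕ) : ℂ :=
  ∑ j ∈ Finset.range i, q ^ ((i : ℤ) - 1 - 2 * (j : ℤ))

/-- The `q`-antisymmetrizer `A^{(i)}` of `R`, acting in the first `i` factors of `V^{⊗ m}`. -/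
noncomputable def antisymIn {n : ℕ} (q : ℂ) (R : Matrix (Fin n × Fin n) (Fin n × Fin n) ℂ)
    (m : ℕ) : ℕ → Matrix (Fin m → Fin n) (Fin m → Fin n) ℂ
  | 0 => 1
  | 1 => 1
  | i + 2 =>
    (qnum q (i + 1) / qnum q (i + 2)) •
      (antisymIn q R m (i + 1) *
        ((q ^ (i + 1) / qnum q (i + 1)) • (1 : Matrix (Fin m → Fin n) (Fin m → Fin n) ℂ)
          - bond m i R) *
        antisymIn q R m (i + 1))

/-- `R` is an R-matrix of `SL(n)` type with eigenvalue `q`, and `Ψ` is its skew inverse. -/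
structure IsSLType (n : ℕ) (q : ℂ) (R Ψ : Matrix (Fin n × Fin n) (Fin n × Fin n) ℂ) : Prop where
  braid : bond 3 0 R * bond 3 1 R * bond 3 0 R = bond 3 1 R * bond 3 0 R * bond 3 1 R
  /-- `Tr₂ R₁₂ Ψ₂₃ = P₁₃` -/
  skew_left : ∀ a d c e : Fin n,
    ∑ b, ∑ b', R (a, b) (c, b') * Ψ (b', d) (b, e) = flipMat n (a, d) (c, e)
  /-- `Tr₂ Ψ₁₂ R₂₃ = P₁₃` -/
  skew_right : ∀ a d c e : Fin n,
    ∑ b, ∑ b', Ψ (a, b) (c, b') * R (b', d) (b, e) = flipMat n (a, d) (c, e)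
  hecke : (R - q • (1 : Matrix (Fin n × Fin n) (Fin n × Fin n) ℂ)) *
    (R + q⁻¹ • (1 : Matrix (Fin n × Fin n) (Fin n × Fin n) ℂ)) = 0
  qnum_ne_zero : ∀ i : ℕ, 2 ≤ i → i ≤ n → qnum q i ≠ 0
  gl_cond : antisymIn q R (n + 1) n *
    ((q ^ n / qnum q n) • (1 : Matrix (Fin (n + 1) → Fin n) (Fin (n + 1) → Fin n) ℂ)
      - bond (n + 1) (n - 1) R) * antisymIn q R (n + 1) n = 0
  rank_one : (antisymIn q R n n).rank = 1
  /-- `Tr_{(2,…,n+1)} (P₁ P₂ ⋯ P_n A^{(n)})` is a multiple of the identity on the first factor. -/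
  sl_cond : ∃ c : ℂ, ∀ a b : Fin n,
    ∑ w : Fin n → Fin n,
      (((List.range n).map fun i => bond (n + 1) i (flipMat n)).prod * antisymIn q R (n + 1) n)
        (Fin.cons a w) (Fin.cons b w) = if a = b then c else 0

/-- Which of the two calculi, over `GL_q(n)` or over `SL_q(n)`, is considered. -/
inductive Kind
  | gl
  | sl

/-- The input data: a logarithm `2πiτ` of `q`, a matrix `R` and its skew inverse `Ψ`. -/
structure RData (n : ℕ) where
  tau : ℂ
  R : Matrix (Fin n × Fin n) (Fin n × Fin n) ℂ
  Psi : Matrix (Fin n × Fin n) (Fin n × Fin n) ℂ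

namespace RData

variable {n : ℕ} (S : RData n)

/-- `q^c = exp (2πiτ c)`. -/
noncomputable def qpow (c : ℂ) : ℂ := Complex.exp (2 * Real.pi * Complex.I * S.tau * c)

/-- `q = exp (2πiτ)`. -/
noncomputable def q : ℂ := S.qpow 1

/-- `γ = q^{1/n}`. -/
noncomputable def gamma : ℂ := S.qpow (1 / (n : ℂ))

/-- `n_q + qⁿ (q - q⁻¹)`, the denominator of `κ_q`. -/
noncomputable def kappaDen : ℂ := qnum S.q n + S.q ^ n * (S.q - S.q⁻¹)

noncomputable def kappa : ℂ := S.q ^ n * (S.q - S.q⁻¹) / S.kappaDen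

/-- The matrix `D_R = Tr₂ Ψ₁₂` of the R-trace. -/
noncomputable def D : Matrix (Fin n) (Fin n) ℂ := ptr2 S.Psi

/-- The matrix `D_{R_op}` of the `R_op`-trace; the skew inverse of `R_op = P R P` is `P Ψ P`. -/
noncomputable def Dop : Matrix (Fin n) (Fin n) ℂ := ptr2 (opMat S.Psi)

section Dets

variable {A : Type*} [Ring A] [Algebra ℂ A]

/-- `Det_R T = Tr (A^{(n)} T₁ ⋯ T_n)` -/
noncomputable def detT (T : Matrix (Fin n) (Fin n) A) : A :=
  Matrix.trace (scal A (antisymIn S.q S.R n n) *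
    ((List.range n).map fun i => site n i T).prod)

/-- The copies `L_{\bar 1} = L₁`, `L_{\bar i} = R_{i-1} L_{\overline{i-1}} R_{i-1}⁻¹` on
`V^{⊗ m}`, numbered from `0`. -/
noncomputable def overCopy (m : ℕ) (L : Matrix (Fin n) (Fin n) A) :
    ℕ → Matrix (Fin m → Fin n) (Fin m → Fin n) A
  | 0 => site m 0 L
  | i + 1 => scal A (bond m i S.R) * overCopy m L i * scal A (bond m i S.R⁻¹)

/-- The copies `K_{\underline m} = K_m`, `K_{\underline i} = R_i K_{\underline{i+1}} R_i⁻¹` on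
`V^{⊗ m}`; the value at `j` is `K_{\underline{m-j}}`. -/
noncomputable def underCopy (m : ℕ) (K : Matrix (Fin n) (Fin n) A) :
    ℕ → Matrix (Fin m → Fin n) (Fin m → Fin n) A
  | 0 => site m (m - 1) K
  | j + 1 => scal A (bond m (m - 2 - j) S.R) * underCopy m K j * scal A (bond m (m - 2 - j) S.R⁻¹)

/-- `Tr_R (A^{(i)} L_{\bar 1} ⋯ L_{\bar i})`: the elements `a_i` for `L`, `c_i` for `F`. -/
noncomputable def charCoeff (L : Matrix (Fin n) (Fin n) A) (i : ℕ) : A :=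
  trM S.D (scal A (antisymIn S.q S.R i i) * ((List.range i).map (S.overCopy i L)).prod)

/-- `Tr_{R_op} (A^{(i)} K_{\underline i} ⋯ K_{\underline 1})`: the elements `b_i`. -/
noncomputable def charCoeffOp (K : Matrix (Fin n) (Fin n) A) (i : ℕ) : A :=
  trM S.Dop (scal A (antisymIn S.q S.R i i) * ((List.range i).map (S.underCopy i K)).prod)

end Dets

end RData

/-! ## The differential calculus -/

/-- The generators of the calculus in a `ℂ`-algebra: the matrices `T`, `Ω`, `L`, `K`, the inverses
of `T`, `L`, `K`, and the inverses of the quantum determinants of `T`, `L`, `K`. -/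
structure CalcData (n : ℕ) (A : Type*) where
  T : Matrix (Fin n) (Fin n) A
  Tinv : Matrix (Fin n) (Fin n) A
  Omega : Matrix (Fin n) (Fin n) A
  L : Matrix (Fin n) (Fin n) A
  Linv : Matrix (Fin n) (Fin n) A
  K : Matrix (Fin n) (Fin n) A
  Kinv : Matrix (Fin n) (Fin n) A
  detTinv : A
  detLinv : A
  detKinv : A

namespace CalcData

variable {n : ℕ} {A B : Type*}

def map (d : CalcData n A) (f : A → B) : CalcData n B where
  T := d.T.map f
  Tinv := d.Tinv.map f
  Omega := d.Omega.map f
  L := d.L.map f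
  Linv := d.Linv.map f
  K := d.K.map f
  Kinv := d.Kinv.map f
  detTinv := f d.detTinv
  detLinv := f d.detLinv
  detKinv := f d.detKinv

variable [Ring A] (d : CalcData n A)

/-- `F = L T K T⁻¹` -/
def F : Matrix (Fin n) (Fin n) A := d.L * d.T * d.K * d.Tinv

/-- `F⁻¹ = T K⁻¹ T⁻¹ L⁻¹` -/
def Finv : Matrix (Fin n) (Fin n) A := d.T * d.Kinv * d.Tinv * d.Linv

/-- The left-invariant forms `Θ = T⁻¹ Ω T`. -/
def Theta : Matrix (Fin n) (Fin n) A := d.Tinv * d.Omega * d.T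

/-- `G = T⁻¹ F T` -/
def G : Matrix (Fin n) (Fin n) A := d.Tinv * d.F * d.T

end CalcData

section CalcRel

variable {n : ℕ} (S : RData n) (k : Kind) {A : Type*} [Ring A] [Algebra ℂ A]

/-- The permutation relations, as equations between matrices on `V ⊗ V`. -/
inductive CalcRel2 (d : CalcData n A) :
    Matrix (Fin n × Fin n) (Fin n × Fin n) A → Matrix (Fin n × Fin n) (Fin n × Fin n) A → Prop
  | RTT : CalcRel2 d
      (scal A S.R * leg1 d.T * leg2 d.T)
      (leg1 d.T * leg2 d.T * scal A S.R)
  | OmegaOmega_gl (hk : k = Kind.gl) : CalcRel2 d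
      (scal A S.R * leg1 d.Omega * scal A S.R * leg1 d.Omega)
      (-(leg1 d.Omega * scal A S.R * leg1 d.Omega * scal A S.R⁻¹))
  | OmegaOmega_sl (hk : k = Kind.sl) : CalcRel2 d
      (scal A S.R * leg1 d.Omega * scal A S.R * leg1 d.Omega
        + leg1 d.Omega * scal A S.R * leg1 d.Omega * scal A S.R⁻¹)
      (S.kappa • (leg1 d.Omega * leg1 d.Omega
        + scal A S.R * (leg1 d.Omega * leg1 d.Omega) * scal A S.R))
  | OmegaT : CalcRel2 d
      (scal A S.R * leg1 d.Omega * scal A S.R⁻¹ * leg1 d.T)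
      (leg1 d.T * leg2 d.Omega)
  | LL : CalcRel2 d
      (scal A S.R * leg1 d.L * scal A S.R * leg1 d.L)
      (leg1 d.L * scal A S.R * leg1 d.L * scal A S.R)
  | LT : CalcRel2 d
      (scal A S.R * leg1 d.L * scal A S.R * leg1 d.T)
      (S.gamma ^ 2 • (leg1 d.T * leg2 d.L))
  | LOmega : CalcRel2 d
      (scal A S.R * leg1 d.L * scal A S.R * leg1 d.Omega)
      (leg1 d.Omega * scal A S.R * leg1 d.L * scal A S.R)
  | KK : CalcRel2 d
      (scal A S.R * leg2 d.K * scal A S.R * leg2 d.K)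
      (leg2 d.K * scal A S.R * leg2 d.K * scal A S.R)
  | KT : CalcRel2 d
      (leg2 d.T * scal A S.R * leg2 d.K * scal A S.R)
      (S.gamma ^ 2 • (leg1 d.K * leg2 d.T))
  | KOmega : CalcRel2 d (leg1 d.K * leg2 d.Omega) (leg2 d.Omega * leg1 d.K)
  | KL : CalcRel2 d (leg1 d.K * leg2 d.L) (leg2 d.L * leg1 d.K)

/-- The invertibility conditions on the matrices of generators. -/
inductive CalcRel1 (d : CalcData n A) :
    Matrix (Fin n) (Fin n) A → Matrix (Fin n) (Fin n) A → Prop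
  | T_Tinv : CalcRel1 d (d.T * d.Tinv) 1
  | Tinv_T : CalcRel1 d (d.Tinv * d.T) 1
  | L_Linv : CalcRel1 d (d.L * d.Linv) 1
  | Linv_L : CalcRel1 d (d.Linv * d.L) 1
  | K_Kinv : CalcRel1 d (d.K * d.Kinv) 1
  | Kinv_K : CalcRel1 d (d.Kinv * d.K) 1

/-- The defining relations of the differential calculus over `GL_q(n)` or `SL_q(n)`: permutation
relations, invertibility conditions and, for `SL_q(n)`, the reduction conditions. -/
inductive CalcRel (d : CalcData n A) : A → A → Prop
  | perm {M N : Matrix (Fin n × Fin n) (Fin n × Fin n) A} (h : CalcRel2 S k d M N)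
      (u v : Fin n × Fin n) : CalcRel d (M u v) (N u v)
  | inv {M N : Matrix (Fin n) (Fin n) A} (h : CalcRel1 d M N) (i j : Fin n) :
      CalcRel d (M i j) (N i j)
  | detT_inv : CalcRel d (S.detT d.T * d.detTinv) 1
  | inv_detT : CalcRel d (d.detTinv * S.detT d.T) 1
  | detL_inv : CalcRel d (S.charCoeff d.L n * d.detLinv) 1
  | inv_detL : CalcRel d (d.detLinv * S.charCoeff d.L n) 1
  | detK_inv : CalcRel d (S.charCoeffOp d.K n * d.detKinv) 1
  | inv_detK : CalcRel d (d.detKinv * S.charCoeffOp d.K n) 1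
  | sl_T (hk : k = Kind.sl) : CalcRel d (S.detT d.T) 1
  | sl_Omega (hk : k = Kind.sl) : CalcRel d (tr1 S.D d.Omega) 0
  | sl_L (hk : k = Kind.sl) : CalcRel d (S.charCoeff d.L n) (algebraMap ℂ A S.q⁻¹)
  | sl_K (hk : k = Kind.sl) : CalcRel d (S.charCoeffOp d.K n) (algebraMap ℂ A S.q⁻¹)

end CalcRel

inductive CalcGen (n : ℕ)
  | T (i j : Fin n)
  | Tinv (i j : Fin n)
  | Omega (i j : Fin n)
  | L (i j : Fin n)
  | Linv (i j : Fin n)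
  | K (i j : Fin n)
  | Kinv (i j : Fin n)
  | detTinv
  | detLinv
  | detKinv

/-- The generators of the calculus as a family of elements `g`. -/
def CalcData.ofGen {n : ℕ} {A : Type*} (g : CalcGen n → A) : CalcData n A where
  T := Matrix.of fun i j => g (.T i j)
  Tinv := Matrix.of fun i j => g (.Tinv i j)
  Omega := Matrix.of fun i j => g (.Omega i j)
  L := Matrix.of fun i j => g (.L i j)
  Linv := Matrix.of fun i j => g (.Linv i j)
  K := Matrix.of fun i j => g (.K i j)
  Kinv := Matrix.of fun i j => g (.Kinv i j)
  detTinv := g .detTinv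
  detLinv := g .detLinv
  detKinv := g .detKinv

/-- The algebra of the differential calculus over `GL_q(n)` or `SL_q(n)`. -/
abbrev Calculus {n : ℕ} (S : RData n) (k : Kind) : Type :=
  RingQuot (CalcRel S k (CalcData.ofGen (FreeAlgebra.ι ℂ (X := CalcGen n))))

noncomputable def Calculus.mk {n : ℕ} (S : RData n) (k : Kind) :
    FreeAlgebra ℂ (CalcGen n) →ₐ[ℂ] Calculus S k :=
  RingQuot.mkAlgHom ℂ _

/-- The generators of the calculus algebra. -/
noncomputable def Calculus.data {n : ℕ} (S : RData n) (k : Kind) : CalcData n (Calculus S k) :=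
  (CalcData.ofGen (FreeAlgebra.ι ℂ (X := CalcGen n))).map (Calculus.mk S k)

/-! ## The spectral extension -/

/-- Elementary symmetric function `e_i` of a commuting family (written as ordered monomials). -/
def esymm {n : ℕ} {A : Type*} [Ring A] (ξ : Fin n → A) (i : ℕ) : A :=
  ((List.sublistsLen i (List.finRange n)).map fun l => (l.map ξ).prod).sum

/-- The matrix idempotent `∏_{β ≠ α} (X - q ξ_β) / (q (ξ_α - ξ_β))`, where `δ α β` stands for
`(ξ_α - ξ_β)⁻¹`. -/
noncomputable def specProj {n : ℕ} {A : Type*} [Ring A] [Algebra ℂ A] (q : ℂ)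
    (X : Matrix (Fin n) (Fin n) A) (ξ : Fin n → A) (δ : (α β : Fin n) → α ≠ β → A) (α : Fin n) :
    Matrix (Fin n) (Fin n) A :=
  ((List.finRange n).map fun β =>
    if h : α = β then 1
    else (q⁻¹ • δ α β h) • (X - (q • ξ β) • (1 : Matrix (Fin n) (Fin n) A))).prod

/-- Generators of the spectral extension.  The index `s : Fin 3` selects the family of spectral
variables: `ξ 0 = μ` (eigenvalues of `L`), `ξ 1 = ν` (of `K`), `ξ 2 = ρ` (of `F`).
`xiInv` and `xiDiffInv` are the inverses of the variables and of their differences. -/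
structure SpecData (n : ℕ) (A : Type*) extends CalcData n A where
  xi : Fin 3 → Fin n → A
  xiInv : Fin 3 → Fin n → A
  xiDiffInv : (s : Fin 3) → (α β : Fin n) → α ≠ β → A

namespace SpecData

variable {n : ℕ} {A : Type*} [Ring A] [Algebra ℂ A] (q : ℂ) (d : SpecData n A)

/-- The idempotents `P^α` of the matrix `L`. -/
noncomputable def P (α : Fin n) : Matrix (Fin n) (Fin n) A :=
  specProj q d.L (d.xi 0) (d.xiDiffInv 0) α

/-- The idempotents `Q^α` of the matrix `K`. -/
noncomputable def Q (α : Fin n) : Matrix (Fin n) (Fin n) A :=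
  specProj q d.K (d.xi 1) (d.xiDiffInv 1) α

/-- The idempotents `S^α` of the matrix `F`. -/
noncomputable def S (α : Fin n) : Matrix (Fin n) (Fin n) A :=
  specProj q d.F (d.xi 2) (d.xiDiffInv 2) α

end SpecData

/-- `δ_{αβ}` as a natural number. -/
def kron {n : ℕ} (α β : Fin n) : ℕ := if α = β then 1 else 0

/-- A monomial in the matrices `Ω` (letter `true`) and `F` (letter `false`). -/
def monomialOF {n : ℕ} {A : Type*} [Ring A] (d : CalcData n A) (w : List Bool) :
    Matrix (Fin n) (Fin n) A :=
  (w.map fun b => if b then d.Omega else d.F).prod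

/-- The defining relations of the spectral extension: the spectral variables are commuting and
invertible with invertible differences, they parameterize the coefficients of the characteristic
identities of `L`, `K`, `F`, and they satisfy the permutation relations with the generators. -/
inductive SpecRel {n : ℕ} (S : RData n) {A : Type*} [Ring A] [Algebra ℂ A] (d : SpecData n A) :
    A → A → Prop
  | comm (s t : Fin 3) (α β : Fin n) :
      SpecRel S d (d.xi s α * d.xi t β) (d.xi t β * d.xi s α)
  | mul_inv (s : Fin 3) (α : Fin n) : SpecRel S d (d.xi s α * d.xiInv s α) 1
  | inv_mul (s : Fin 3) (α : Fin n) : SpecRel S d (d.xiInv s α * d.xi s α) 1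
  | mul_diffInv (s : Fin 3) (α β : Fin n) (h : α ≠ β) :
      SpecRel S d ((d.xi s α - d.xi s β) * d.xiDiffInv s α β h) 1
  | diffInv_mul (s : Fin 3) (α β : Fin n) (h : α ≠ β) :
      SpecRel S d (d.xiDiffInv s α β h * (d.xi s α - d.xi s β)) 1
  | prod_mu : SpecRel S d ((List.finRange n).map (d.xi 0)).prod (algebraMap ℂ A S.q⁻¹)
  | prod_nu : SpecRel S d ((List.finRange n).map (d.xi 1)).prod (algebraMap ℂ A S.q⁻¹)
  | prod_rho : SpecRel S d ((List.finRange n).map (d.xi 2)).prod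
      (algebraMap ℂ A (S.q ^ (n ^ 2))⁻¹)
  | param_L (i : ℕ) (hi : i ≤ n) : SpecRel S d (S.charCoeff d.L i) (esymm (d.xi 0) i)
  | param_K (i : ℕ) (hi : i ≤ n) : SpecRel S d (S.charCoeffOp d.K i) (esymm (d.xi 1) i)
  | param_F (i : ℕ) (hi : i ≤ n) : SpecRel S d (S.charCoeff d.F i) (esymm (d.xi 2) i)
  | mu_comm (X : Matrix (Fin n) (Fin n) A) (hX : X ∈ [d.L, d.K, d.Theta, d.G])
      (α i j : Fin n) : SpecRel S d (d.xi 0 α * X i j) (X i j * d.xi 0 α)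
  | nu_comm (X : Matrix (Fin n) (Fin n) A) (hX : X ∈ [d.L, d.K, d.Omega, d.F])
      (α i j : Fin n) : SpecRel S d (d.xi 1 α * X i j) (X i j * d.xi 1 α)
  | rho_comm (X : Matrix (Fin n) (Fin n) A) (hX : X ∈ [d.T, d.L, d.K, d.F, d.G])
      (α i j : Fin n) : SpecRel S d (d.xi 2 α * X i j) (X i j * d.xi 2 α)
  | T_mu (α β i j : Fin n) :
      SpecRel S d (S.gamma ^ 2 • ((d.P S.q β * d.T) i j * d.xi 0 α))
        (S.q ^ (2 * kron α β) • (d.xi 0 α * (d.P S.q β * d.T) i j))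
  | T_nu (α β i j : Fin n) :
      SpecRel S d (S.gamma ^ 2 • (d.xi 1 α * (d.T * d.Q S.q β) i j))
        (S.q ^ (2 * kron α β) • ((d.T * d.Q S.q β) i j * d.xi 1 α))
  | X_mu (X : Matrix (Fin n) (Fin n) A) (hX : X ∈ [d.Omega, d.F]) (α β σ i j : Fin n) :
      SpecRel S d (S.q ^ (2 * kron α σ) • ((d.P S.q β * X * d.P S.q σ) i j * d.xi 0 α))
        (S.q ^ (2 * kron α β) • (d.xi 0 α * (d.P S.q β * X * d.P S.q σ) i j))
  | Y_nu (Y : Matrix (Fin n) (Fin n) A) (hY : Y ∈ [d.Theta, d.G]) (α β σ i j : Fin n) :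
      SpecRel S d (S.q ^ (2 * kron α σ) • ((d.Q S.q β * Y * d.Q S.q σ) i j * d.xi 1 α))
        (S.q ^ (2 * kron α β) • (d.xi 1 α * (d.Q S.q β * Y * d.Q S.q σ) i j))
  | Omega_rho (α β σ i j : Fin n) :
      SpecRel S d (S.q ^ (2 * kron α σ) • ((d.S S.q β * d.Omega * d.S S.q σ) i j * d.xi 2 α))
        (S.q ^ (2 * kron α β) • (d.xi 2 α * (d.S S.q β * d.Omega * d.S S.q σ) i j))
  | rho_trace (w : List Bool) (α : Fin n) :
      SpecRel S d (d.xi 2 α * tr1 S.D (monomialOF d.toCalcData w))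
        (tr1 S.D (monomialOF d.toCalcData w) * d.xi 2 α)

/-! ## The logarithmic variables -/

/-- Everywhere convergent complex power series in `n` variables, i.e. entire functions on `ℂⁿ`. -/
def Entire (n : ℕ) : Subalgebra ℂ ((Fin n → ℂ) → ℂ) where
  carrier := {f | Differentiable ℂ f}
  mul_mem' := fun {f g} (hf : Differentiable ℂ f) (hg : Differentiable ℂ g) => hf.mul hg
  add_mem' := fun {f g} (hf : Differentiable ℂ f) (hg : Differentiable ℂ g) => hf.add hg
  algebraMap_mem' := fun c => differentiable_const c

namespace Entire

variable {n : ℕ}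

/-- The coordinate function `x_α`. -/
def coord (α : Fin n) : Entire n :=
  ⟨fun x => x α, differentiable_apply (𝕜 := ℂ) α⟩

/-- `x ↦ c exp (2πi x_α)` -/
noncomputable def expCoord (c : ℂ) (α : Fin n) : Entire n :=
  ⟨fun x => c * Complex.exp (2 * Real.pi * Complex.I * x α), by
    have h : Differentiable ℂ fun x : Fin n → ℂ => x α := differentiable_apply (𝕜 := ℂ) α
    exact ((h.const_mul _).cexp).const_mul c⟩

/-- `x ↦ exp (c ∑_α x_α²)` -/
noncomputable def gauss (c : ℂ) : Entire n :=
  ⟨fun x => Complex.exp (c * ∑ α, x α ^ 2), by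
    have h : ∀ α : Fin n, Differentiable ℂ fun x : Fin n → ℂ => x α :=
      fun α => differentiable_apply (𝕜 := ℂ) α
    have h2 : Differentiable ℂ fun x : Fin n → ℂ => ∑ α, x α ^ 2 :=
      Differentiable.fun_sum fun α _ => (h α).pow 2
    exact (h2.const_mul c).cexp⟩

/-- `x ↦ f (x + v)` -/
def shift (v : Fin n → ℂ) (f : Entire n) : Entire n :=
  ⟨fun x => (f : (Fin n → ℂ) → ℂ) (x + v), by
    have hf : Differentiable ℂ (f : (Fin n → ℂ) → ℂ) := f.2
    exact hf.comp (differentiable_id.add_const v)⟩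

theorem gauss_mul_gauss_neg (c : ℂ) : (gauss c : Entire n) * gauss (-c) = 1 := by
  apply Subtype.ext
  funext x
  change Complex.exp (c * ∑ α, x α ^ 2) * Complex.exp (-c * ∑ α, x α ^ 2) = 1
  rw [← Complex.exp_add]
  simp

end Entire

/-- Generators of the spectrally extended calculus in the logarithmic variables.  `fn s f` is the
power series `f` in the variables of the family `s`: `f(x)` for `s = 0`, `f(y)` for `s = 1`,
`f(z)` for `s = 2`. -/
structure LogData (n : ℕ) (A : Type*) extends SpecData n A where
  fn : Fin 3 → Entire n → A

namespace RData

variable {n : ℕ} (S : RData n)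

/-- The shift `2τ (e_β - n⁻¹ (1,…,1))`. -/
noncomputable def shiftT (β : Fin n) : Fin n → ℂ :=
  fun α => 2 * S.tau * ((if α = β then 1 else 0) - 1 / (n : ℂ))

/-- The shift `2τ (e_β - e_σ)`. -/
noncomputable def shiftX (β σ : Fin n) : Fin n → ℂ :=
  fun α => 2 * S.tau * (if α = β then 1 else 0) - 2 * S.tau * (if α = σ then 1 else 0)

/-- Normalizations of `μ_α`, `ν_α = q^{-1/n} exp (2πi ·)` and `ρ_α = q^{-n} exp (2πi ·)`. -/
noncomputable def logNorm : Fin 3 → ℂ := ![S.qpow (-(1 / (n : ℂ))), S.qpow (-(1 / (n : ℂ))), S.qpow (-(n : ℂ))]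

end RData

/-- The relations of the logarithmic variables `x_α`, `y_α`, `z_α` and of the power series in them:
series are added and multiplied as functions, all of them commute, the variables of each family sum
up to zero, the spectral variables are exponentials, and the permutation relations with the
generators take the additive form. -/
inductive LogRel {n : ℕ} (S : RData n) {A : Type*} [Ring A] [Algebra ℂ A] (d : LogData n A) :
    A → A → Prop
  | const (s : Fin 3) (c : ℂ) : LogRel S d (d.fn s (algebraMap ℂ (Entire n) c)) (algebraMap ℂ A c)
  | add (s : Fin 3) (f g : Entire n) : LogRel S d (d.fn s (f + g)) (d.fn s f + d.fn s g)
  | mul (s : Fin 3) (f g : Entire n) : LogRel S d (d.fn s (f * g)) (d.fn s f * d.fn s g)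
  | comm (s t : Fin 3) (f g : Entire n) :
      LogRel S d (d.fn s f * d.fn t g) (d.fn t g * d.fn s f)
  | sum_coord (s : Fin 3) : LogRel S d (∑ α, d.fn s (Entire.coord α)) 0
  | xi_eq (s : Fin 3) (α : Fin n) :
      LogRel S d (d.xi s α) (d.fn s (Entire.expCoord (S.logNorm s) α))
  | x_comm (X : Matrix (Fin n) (Fin n) A) (hX : X ∈ [d.L, d.K, d.Theta, d.G])
      (f : Entire n) (i j : Fin n) : LogRel S d (d.fn 0 f * X i j) (X i j * d.fn 0 f)
  | y_comm (X : Matrix (Fin n) (Fin n) A) (hX : X ∈ [d.L, d.K, d.Omega, d.F])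
      (f : Entire n) (i j : Fin n) : LogRel S d (d.fn 1 f * X i j) (X i j * d.fn 1 f)
  | z_comm (X : Matrix (Fin n) (Fin n) A) (hX : X ∈ [d.T, d.L, d.K, d.F, d.G])
      (f : Entire n) (i j : Fin n) : LogRel S d (d.fn 2 f * X i j) (X i j * d.fn 2 f)
  | T_x (f : Entire n) (β i j : Fin n) :
      LogRel S d ((d.P S.q β * d.T) i j * d.fn 0 f)
        (d.fn 0 (Entire.shift (S.shiftT β) f) * (d.P S.q β * d.T) i j)
  | T_y (f : Entire n) (β i j : Fin n) :
      LogRel S d (d.fn 1 f * (d.T * d.Q S.q β) i j)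
        ((d.T * d.Q S.q β) i j * d.fn 1 (Entire.shift (S.shiftT β) f))
  | X_x (X : Matrix (Fin n) (Fin n) A) (hX : X ∈ [d.Omega, d.F]) (f : Entire n)
      (β σ i j : Fin n) :
      LogRel S d ((d.P S.q β * X * d.P S.q σ) i j * d.fn 0 f)
        (d.fn 0 (Entire.shift (S.shiftX β σ) f) * (d.P S.q β * X * d.P S.q σ) i j)
  | Y_y (Y : Matrix (Fin n) (Fin n) A) (hY : Y ∈ [d.Theta, d.G]) (f : Entire n)
      (β σ i j : Fin n) :
      LogRel S d ((d.Q S.q β * Y * d.Q S.q σ) i j * d.fn 1 f)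
        (d.fn 1 (Entire.shift (S.shiftX β σ) f) * (d.Q S.q β * Y * d.Q S.q σ) i j)
  | Omega_z (f : Entire n) (β σ i j : Fin n) :
      LogRel S d ((d.S S.q β * d.Omega * d.S S.q σ) i j * d.fn 2 f)
        (d.fn 2 (Entire.shift (S.shiftX β σ) f) * (d.S S.q β * d.Omega * d.S S.q σ) i j)
  | z_trace (w : List Bool) (f : Entire n) :
      LogRel S d (d.fn 2 f * tr1 S.D (monomialOF d.toCalcData w))
        (tr1 S.D (monomialOF d.toCalcData w) * d.fn 2 f)

inductive LogGen (n : ℕ)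
  | calc (g : CalcGen n)
  | xi (s : Fin 3) (α : Fin n)
  | xiInv (s : Fin 3) (α : Fin n)
  | xiDiffInv (s : Fin 3) (α β : Fin n) (h : α ≠ β)
  | fn (s : Fin 3) (f : Entire n)

def LogData.ofGen {n : ℕ} {A : Type*} (g : LogGen n → A) : LogData n A where
  toCalcData := CalcData.ofGen fun c => g (.calc c)
  xi s α := g (.xi s α)
  xiInv s α := g (.xiInv s α)
  xiDiffInv s α β h := g (.xiDiffInv s α β h)
  fn s f := g (.fn s f)

def LogData.map {n : ℕ} {A B : Type*} (d : LogData n A) (φ : A → B) : LogData n B where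
  toCalcData := d.toCalcData.map φ
  xi s α := φ (d.xi s α)
  xiInv s α := φ (d.xiInv s α)
  xiDiffInv s α β h := φ (d.xiDiffInv s α β h)
  fn s f := φ (d.fn s f)

/-- All defining relations of the spectrally extended calculus in the logarithmic variables. -/
inductive ExtRel {n : ℕ} (S : RData n) (k : Kind) {A : Type*} [Ring A] [Algebra ℂ A]
    (d : LogData n A) : A → A → Prop
  | calc {a b : A} (h : CalcRel S k d.toCalcData a b) : ExtRel S k d a b
  | spec {a b : A} (h : SpecRel S d.toSpecData a b) : ExtRel S k d a b
  | log {a b : A} (h : LogRel S d a b) : ExtRel S k d a b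

/-- The spectrally extended differential calculus over `GL_q(n)` or `SL_q(n)`, in the logarithmic
variables. -/
abbrev ExtCalculus {n : ℕ} (S : RData n) (k : Kind) : Type :=
  RingQuot (ExtRel S k (LogData.ofGen (FreeAlgebra.ι ℂ (X := LogGen n))))

namespace ExtCalculus

variable {n : ℕ} (S : RData n) (k : Kind)

noncomputable def mk : FreeAlgebra ℂ (LogGen n) →ₐ[ℂ] ExtCalculus S k :=
  RingQuot.mkAlgHom ℂ _

/-- The generators of the extended calculus. -/
noncomputable def data : LogData n (ExtCalculus S k) :=
  (LogData.ofGen (FreeAlgebra.ι ℂ (X := LogGen n))).map (mk S k)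

end ExtCalculus

/-! ## The canonical homomorphism of the calculus to its spectral extension -/

section Map

variable {n : ℕ} {A B : Type*} [Ring A] [Algebra ℂ A] [Ring B] [Algebra ℂ B] (f : A →ₐ[ℂ] B)

theorem scal_map {ι κ : Type*} (X : Matrix ι κ ℂ) : (scal A X).map f = scal B X := by
  ext i j
  simp [scal]

theorem leg1_map (X : Matrix (Fin n) (Fin n) A) : (leg1 X).map f = leg1 (X.map f) := by
  ext u v
  simp [leg1, apply_ite f]

theorem leg2_map (X : Matrix (Fin n) (Fin n) A) : (leg2 X).map f = leg2 (X.map f) := by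
  ext u v
  simp [leg2, apply_ite f]

theorem site_map (m i : ℕ) (X : Matrix (Fin n) (Fin n) A) :
    (site m i X).map f = site m i (X.map f) := by
  ext u v
  simp only [site, Matrix.map_apply, Matrix.of_apply]
  split_ifs <;> simp

theorem list_prod_map {ι : Type*} [Fintype ι] [DecidableEq ι] (l : List (Matrix ι ι A)) :
    l.prod.map f = (l.map fun M => M.map f).prod :=
  map_list_prod f.mapMatrix l

theorem matrix_mul_map {ι : Type*} [Fintype ι] (M N : Matrix ι ι A) :
    (M * N).map f = M.map f * N.map f :=
  Matrix.map_mul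

theorem detT_map (S : RData n) (T : Matrix (Fin n) (Fin n) A) :
    f (S.detT T) = S.detT (T.map f) := by
  unfold RData.detT
  rw [AddMonoidHom.map_trace f, matrix_mul_map, scal_map, list_prod_map, List.map_map]
  congr 3
  refine List.map_congr_left fun i _ => ?_
  exact site_map f n i T

theorem overCopy_map (S : RData n) (m : ℕ) (L : Matrix (Fin n) (Fin n) A) (i : ℕ) :
    (S.overCopy m L i).map f = S.overCopy m (L.map f) i := by
  induction i with
  | zero => exact site_map f m 0 L
  | succ i ih => simp only [RData.overCopy, matrix_mul_map, scal_map, ih]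

theorem underCopy_map (S : RData n) (m : ℕ) (L : Matrix (Fin n) (Fin n) A) (i : ℕ) :
    (S.underCopy m L i).map f = S.underCopy m (L.map f) i := by
  induction i with
  | zero => exact site_map f m (m - 1) L
  | succ i ih => simp only [RData.underCopy, matrix_mul_map, scal_map, ih]

theorem trM_map {m : ℕ} (D : Matrix (Fin n) (Fin n) ℂ)
    (X : Matrix (Fin m → Fin n) (Fin m → Fin n) A) : f (trM D X) = trM D (X.map f) := by
  simp [trM, map_sum]

theorem tr1_map (D : Matrix (Fin n) (Fin n) ℂ) (X : Matrix (Fin n) (Fin n) A) :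
    f (tr1 D X) = tr1 D (X.map f) := by
  simp [tr1, map_sum]

theorem charCoeff_map (S : RData n) (L : Matrix (Fin n) (Fin n) A) (i : ℕ) :
    f (S.charCoeff L i) = S.charCoeff (L.map f) i := by
  unfold RData.charCoeff
  rw [trM_map, matrix_mul_map, scal_map, list_prod_map, List.map_map]
  congr 3
  refine List.map_congr_left fun j _ => ?_
  exact overCopy_map f S i L j

theorem charCoeffOp_map (S : RData n) (L : Matrix (Fin n) (Fin n) A) (i : ℕ) :
    f (S.charCoeffOp L i) = S.charCoeffOp (L.map f) i := by
  unfold RData.charCoeffOp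
  rw [trM_map, matrix_mul_map, scal_map, list_prod_map, List.map_map]
  congr 3
  refine List.map_congr_left fun j _ => ?_
  exact underCopy_map f S i L j

theorem CalcRel2.map {S : RData n} {k : Kind} {d : CalcData n A}
    {M N : Matrix (Fin n × Fin n) (Fin n × Fin n) A} (h : CalcRel2 S k d M N) :
    CalcRel2 S k (d.map f) (M.map f) (N.map f) := by
  have hneg : ∀ M : Matrix (Fin n × Fin n) (Fin n × Fin n) A, (-M).map f = -(M.map f) := by
    intro M; ext; simp
  have hadd : ∀ M N : Matrix (Fin n × Fin n) (Fin n × Fin n) A,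
      (M + N).map f = M.map f + N.map f := by
    intro M N; ext; simp
  have hsmul : ∀ (c : ℂ) (M : Matrix (Fin n × Fin n) (Fin n × Fin n) A),
      (c • M).map f = c • M.map f := by
    intro c M; ext; simp
  cases h <;> simp only [matrix_mul_map, hneg, hadd, hsmul, scal_map, leg1_map, leg2_map]
  · exact CalcRel2.RTT
  · exact CalcRel2.OmegaOmega_gl ‹_›
  · exact CalcRel2.OmegaOmega_sl ‹_›
  · exact CalcRel2.OmegaT
  · exact CalcRel2.LL
  · exact CalcRel2.LT
  · exact CalcRel2.LOmega
  · exact CalcRel2.KK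
  · exact CalcRel2.KT
  · exact CalcRel2.KOmega
  · exact CalcRel2.KL

theorem CalcRel1.map {d : CalcData n A} {M N : Matrix (Fin n) (Fin n) A}
    (h : CalcRel1 d M N) : CalcRel1 (d.map f) (M.map f) (N.map f) := by
  have h1 : (1 : Matrix (Fin n) (Fin n) A).map f = 1 :=
    Matrix.map_one f (map_zero f) (map_one f)
  cases h <;> simp only [matrix_mul_map, h1]
  · exact CalcRel1.T_Tinv
  · exact CalcRel1.Tinv_T
  · exact CalcRel1.L_Linv
  · exact CalcRel1.Linv_L
  · exact CalcRel1.K_Kinv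
  · exact CalcRel1.Kinv_K

theorem CalcRel.map {S : RData n} {k : Kind} {d : CalcData n A} {a b : A}
    (h : CalcRel S k d a b) : CalcRel S k (d.map f) (f a) (f b) := by
  cases h with
  | perm h u v => exact CalcRel.perm (h.map f) u v
  | inv h i j => exact CalcRel.inv (h.map f) i j
  | detT_inv => rw [map_mul, map_one, detT_map]; exact CalcRel.detT_inv
  | inv_detT => rw [map_mul, map_one, detT_map]; exact CalcRel.inv_detT
  | detL_inv => rw [map_mul, map_one, charCoeff_map]; exact CalcRel.detL_inv
  | inv_detL => rw [map_mul, map_one, charCoeff_map]; exact CalcRel.inv_detL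
  | detK_inv => rw [map_mul, map_one, charCoeffOp_map]; exact CalcRel.detK_inv
  | inv_detK => rw [map_mul, map_one, charCoeffOp_map]; exact CalcRel.inv_detK
  | sl_T hk => rw [map_one, detT_map]; exact CalcRel.sl_T hk
  | sl_Omega hk => rw [map_zero, tr1_map]; exact CalcRel.sl_Omega hk
  | sl_L hk => rw [AlgHom.commutes, charCoeff_map]; exact CalcRel.sl_L hk
  | sl_K hk => rw [AlgHom.commutes, charCoeffOp_map]; exact CalcRel.sl_K hk

end Map

/-- The canonical homomorphism of the calculus to its spectral extension: each generator goes to the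
generator of the same name. -/
noncomputable def Calculus.toExt {n : ℕ} (S : RData n) (k : Kind) :
    Calculus S k →ₐ[ℂ] ExtCalculus S k :=
  RingQuot.liftAlgHom ℂ
    ⟨(ExtCalculus.mk S k).comp
        (FreeAlgebra.lift ℂ fun g : CalcGen n => FreeAlgebra.ι ℂ (LogGen.calc g)), by
      intro a b h
      have h1 := h.map (FreeAlgebra.lift ℂ fun g : CalcGen n => FreeAlgebra.ι ℂ (LogGen.calc g))
      have h2 : (CalcData.ofGen (FreeAlgebra.ι ℂ (X := CalcGen n))).map
          (FreeAlgebra.lift ℂ fun g : CalcGen n => FreeAlgebra.ι ℂ (LogGen.calc g)) =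
          (LogData.ofGen (FreeAlgebra.ι ℂ (X := LogGen n))).toCalcData := by
        simp only [CalcData.map, CalcData.ofGen, LogData.ofGen, CalcData.mk.injEq]
        refine ⟨?_, ?_, ?_, ?_, ?_, ?_, ?_, ?_, ?_, ?_⟩ <;> (try ext) <;> simp
      rw [h2] at h1
      exact RingQuot.mkAlgHom_rel ℂ (ExtRel.calc h1)⟩

/-! ## The automorphisms -/

/-- `ψ` acts on the generators of the calculus as the map `φ_L`. -/
structure IsPhiL {n : ℕ} {A : Type*} [Ring A] [Algebra ℂ A] (d : CalcData n A)
    (ψ : A →ₐ[ℂ] A) : Prop where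
  T : d.T.map ψ = d.L * d.T
  Omega : d.Omega.map ψ = d.L * d.Omega * d.Linv
  F : d.F.map ψ = d.L * d.F * d.Linv
  L : d.L.map ψ = d.L
  K : d.K.map ψ = d.K
  Theta : d.Theta.map ψ = d.Theta

/-- `ψ` acts on the generators of the calculus as the map `φ_K`. -/
structure IsPhiK {n : ℕ} {A : Type*} [Ring A] [Algebra ℂ A] (d : CalcData n A)
    (ψ : A →ₐ[ℂ] A) : Prop where
  T : d.T.map ψ = d.T * d.K
  Theta : d.Theta.map ψ = d.Kinv * d.Theta * d.K
  L : d.L.map ψ = d.L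
  K : d.K.map ψ = d.K
  Omega : d.Omega.map ψ = d.Omega
  F : d.F.map ψ = d.F

/-- `ψ` acts on the generators of the calculus as the map `φ_F`. -/
structure IsPhiF {n : ℕ} {A : Type*} [Ring A] [Algebra ℂ A] (d : CalcData n A)
    (ψ : A →ₐ[ℂ] A) : Prop where
  T : d.T.map ψ = d.T
  Omega : d.Omega.map ψ = d.F * d.Omega * d.Finv
  L : d.L.map ψ = d.L
  K : d.K.map ψ = d.K
  F : d.F.map ψ = d.F

/-- `ψ` fixes the spectral variables, the logarithmic variables and all power series in them. -/
structure FixesSpectrum {n : ℕ} {A : Type*} [Ring A] [Algebra ℂ A] (d : LogData n A)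
    (ψ : A →ₐ[ℂ] A) : Prop where
  xi : ∀ s α, ψ (d.xi s α) = d.xi s α
  fn : ∀ s f, ψ (d.fn s f) = d.fn s f

/-- Conjugation `u ↦ g u g⁻¹`. -/
def innerAut {A : Type*} [Ring A] [Algebra ℂ A] (g : Aˣ) : A ≃ₐ[ℂ] A where
  toFun u := g * u * (g⁻¹ : Aˣ)
  invFun u := (g⁻¹ : Aˣ) * u * g
  left_inv u := by simp [mul_assoc]
  right_inv u := by simp [mul_assoc]
  map_mul' u v := by simp [mul_assoc]
  map_add' u v := by simp [mul_add, add_mul]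
  commutes' c := by
    rw [← Algebra.commutes c (g : A), mul_assoc, Units.mul_inv, mul_one]

namespace ExtCalculus

variable {n : ℕ} (S : RData n) (k : Kind)

/-- `exp (c₀ ∑ x_α² + c₁ ∑ y_α² + c₂ ∑ z_α²)`, the product of the three commuting exponentials. -/
noncomputable def gauss3 (c₀ c₁ c₂ : ℂ) : ExtCalculus S k :=
  (data S k).fn 0 (Entire.gauss c₀) * (data S k).fn 1 (Entire.gauss c₁) *
    (data S k).fn 2 (Entire.gauss c₂)

theorem rel_log {a b : FreeAlgebra ℂ (LogGen n)}
    (h : LogRel S (LogData.ofGen (FreeAlgebra.ι ℂ (X := LogGen n))) a b) :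
    mk S k a = mk S k b :=
  RingQuot.mkAlgHom_rel ℂ (ExtRel.log h)

theorem gauss3_mul_neg (c₀ c₁ c₂ : ℂ) : gauss3 S k c₀ c₁ c₂ * gauss3 S k (-c₀) (-c₁) (-c₂) = 1 := by
  have hc : ∀ s t f g, Commute ((data S k).fn s f) ((data S k).fn t g) := by
    intro s t f g
    have h := rel_log S k (LogRel.comm s t f g)
    rw [map_mul, map_mul] at h
    exact h
  have h1 : ∀ s (c : ℂ),
      (data S k).fn s (Entire.gauss c) * (data S k).fn s (Entire.gauss (-c)) = 1 := by
    intro s c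
    have h := rel_log S k (LogRel.mul s (Entire.gauss c) (Entire.gauss (-c)))
    have h' := rel_log S k (LogRel.const s 1)
    rw [Entire.gauss_mul_gauss_neg, map_mul] at h
    rw [map_one, map_one, map_one] at h'
    exact h.symm.trans h'
  unfold gauss3
  generalize hA0 : (data S k).fn 0 (Entire.gauss c₀) = a0
  generalize hB0 : (data S k).fn 0 (Entire.gauss (-c₀)) = b0
  generalize hA1 : (data S k).fn 1 (Entire.gauss c₁) = a1
  generalize hB1 : (data S k).fn 1 (Entire.gauss (-c₁)) = b1
  generalize hA2 : (data S k).fn 2 (Entire.gauss c₂) = a2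
  generalize hB2 : (data S k).fn 2 (Entire.gauss (-c₂)) = b2
  have e0 : a0 * b0 = 1 := by rw [← hA0, ← hB0]; exact h1 0 c₀
  have e1 : a1 * b1 = 1 := by rw [← hA1, ← hB1]; exact h1 1 c₁
  have e2 : a2 * b2 = 1 := by rw [← hA2, ← hB2]; exact h1 2 c₂
  have k1 : a2 * (b0 * b1) = b0 * b1 * a2 := by
    rw [← hA2, ← hB0, ← hB1]; exact (hc _ _ _ _).mul_right (hc _ _ _ _)
  have k2 : a1 * b0 = b0 * a1 := by
    rw [← hA1, ← hB0]; exact hc _ _ _ _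
  calc a0 * a1 * a2 * (b0 * b1 * b2) = a0 * a1 * (a2 * (b0 * b1)) * b2 := by
        simp only [mul_assoc]
    _ = a0 * (a1 * b0) * b1 * (a2 * b2) := by rw [k1]; simp only [mul_assoc]
    _ = (a0 * b0) * (a1 * b1) * (a2 * b2) := by rw [k2]; simp only [mul_assoc]
    _ = 1 := by rw [e0, e1, e2]; simp

/-- The invertible element
`φ_{(t₁,t₂,t₃)} = exp {-(iπ/2τ) ∑_α (t₁ x_α² - t₂ y_α² + t₃ z_α²)}`. -/
noncomputable def varphi (t₁ t₂ t₃ : ℂ) : (ExtCalculus S k)ˣ where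
  val := gauss3 S k (-(Complex.I * Real.pi / (2 * S.tau)) * t₁)
    (-(Complex.I * Real.pi / (2 * S.tau)) * -t₂) (-(Complex.I * Real.pi / (2 * S.tau)) * t₃)
  inv := gauss3 S k (-(-(Complex.I * Real.pi / (2 * S.tau)) * t₁))
    (-(-(Complex.I * Real.pi / (2 * S.tau)) * -t₂)) (-(-(Complex.I * Real.pi / (2 * S.tau)) * t₃))
  val_inv := gauss3_mul_neg S k _ _ _
  inv_val := by
    have h := gauss3_mul_neg S k (-(-(Complex.I * Real.pi / (2 * S.tau)) * t₁))
      (-(-(Complex.I * Real.pi / (2 * S.tau)) * -t₂)) (-(-(Complex.I * Real.pi / (2 * S.tau)) * t₃))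
    simpa only [neg_neg] using h

/-- The automorphism `φ_{(t₁,t₂,t₃)} : u ↦ φ u φ⁻¹`. -/
noncomputable def phi (t₁ t₂ t₃ : ℂ) : ExtCalculus S k ≃ₐ[ℂ] ExtCalculus S k :=
  innerAut (varphi S k t₁ t₂ t₃)

end ExtCalculus

end QCalc

/-!
Conjugation by a Gaussian exponential in the logarithmic variables turns an additive shift of the
variables into multiplication by an exponential: `∑ (x_α + v_α)² - ∑ x_α²` is affine in `x`. For the
shifts `2τ (e_β - n⁻¹ (1,…,1))` and `2τ (e_β - e_σ)` of the permutation relations these exponentials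
are the eigenvalue `q μ_β` of `L` (up to a function of `∑ x_α = 0`, which is `1`) and the ratio of
the eigenvalues `q μ_β` and `q μ_σ` (`gauss_mul_shiftT`, `gauss_mul_shiftX`). So conjugation by
`φ_{(1,0,0)}` multiplies the component `P^β T` of `T` by `q μ_β`, and the component `P^β Ω P^σ` of
`Ω` by a ratio of eigenvalues. As soon as the `P^β` are known to sum up to `1` and to satisfy
`L P^β = q μ_β P^β = P^β L`, adding the components gives `T ↦ L T` and `Ω ↦ L Ω L⁻¹`. The cases of
`K` and of `F` are the same. Uniqueness is immediate, because the remaining generators are inverses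
of those on which the endomorphism is prescribed.

The substance is the spectral decomposition of `L`, `K`, `F`, i.e. the characteristic identity
`∏ (X - q ξ_α) = 0`; from it the properties of the `P^β` follow by Lagrange interpolation inside the
commutative double centralizer of `X` and its eigenvalues (`spectral_decomposition`). The identity
is the Cayley–Hamilton theorem `∑ (-q)^i X^{n-i} a_i = 0` for a matrix `X` with
`R X₁ R X₁ = X₁ R X₁ R` (`IsCharData.cayleyHamilton`). Its proof takes quantum traces over all
factors but the first: the recursion for the antisymmetrizers on the left yields the recursion
`(k+1)_q M_{k+1} = q^k X a_k - k_q X M_k` for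
`M_k = Tr_{R(2..k)} (A^{(k)} X_{\bar 1} ⋯ X_{\bar k})` (`IsCharData.trTo1_wedge_succ`), which
terminates after `n` steps because the antisymmetrizer on `n + 1` strands vanishes. This needs the
vanishing condition for the antisymmetrizer on the *last* `n` of `n + 1` factors; it follows from the
one on the first `n` factors, since an idempotent matrix of trace zero is zero
(`gl_left_of_isSLType`).

For `L` the reflection equation is a defining relation. For `K` it holds with `R` replaced by
`R_op = P R P`, which satisfies the same assumptions, and the coefficients `b_i` are those defined by
`R_op` after the order of the tensor factors is reversed (`charCoeffOp_eq_trM_wedge`). For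
`F = L T K T⁻¹` it follows from the permutation relations (`reflection_of_relations`).
-/

namespace QCalc

/-! ### Antisymmetrizers in the Hecke algebra -/

section Hecke

variable {H : Type*} [Ring H] [Algebra ℂ H]

/-- The elements `g 0, …, g (N - 1)` satisfy the relations of the generators of the Hecke algebra of
type `A_N` with parameter `q`. Nothing is required of `g i` for `N ≤ i`. -/
structure IsHeckeFamily (q : ℂ) (g : ℕ → H) (N : ℕ) : Prop where
  hecke : ∀ i, i < N → g i * g i = 1 + (q - q⁻¹) • g i
  braid : ∀ i, i + 1 < N → g i * g (i + 1) * g i = g (i + 1) * g i * g (i + 1)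
  far : ∀ i j, i + 1 < j → j < N → Commute (g i) (g j)

/-- The antisymmetrizer on `k` strands, built from `g 0, …, g (k - 2)` by the recursion that
`antisymIn` uses. -/
noncomputable def asym (q : ℂ) (g : ℕ → H) : ℕ → H
  | 0 => 1
  | 1 => 1
  | k + 2 =>
    (qnum q (k + 1) / qnum q (k + 2)) •
      (asym q g (k + 1) * ((q ^ (k + 1) / qnum q (k + 1)) • (1 : H) - g k) * asym q g (k + 1))

theorem antisymIn_eq_asym {n : ℕ} (q : ℂ) (R : Matrix (Fin n × Fin n) (Fin n × Fin n) ℂ)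
    (m k : ℕ) : antisymIn q R m k = asym q (fun i => bond m i R) k := by
  induction k with
  | zero => rfl
  | succ k ih =>
    cases k with
    | zero => rfl
    | succ k => simp only [antisymIn, asym, ih]

theorem qnum_one (q : ℂ) : qnum q 1 = 1 := by simp [qnum]

theorem qnum_succ {q : ℂ} (hq : q ≠ 0) (k : ℕ) : qnum q (k + 1) = q ^ k + q⁻¹ * qnum q k := by
  unfold qnum
  rw [Finset.sum_range_succ', Finset.mul_sum, add_comm]
  congr 1
  · simp
  · refine Finset.sum_congr rfl fun j _ => ?_
    rw [← zpow_neg_one, ← zpow_add₀ hq]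
    congr 1
    push_cast
    ring

theorem qnum_succ' {q : ℂ} (hq : q ≠ 0) (k : ℕ) : qnum q (k + 1) = q * qnum q k + (q ^ k)⁻¹ := by
  unfold qnum
  rw [Finset.sum_range_succ, Finset.mul_sum]
  congr 1
  · refine Finset.sum_congr rfl fun j _ => ?_
    rw [← zpow_one_add₀ hq]
    congr 1
    push_cast
    ring
  · rw [← zpow_natCast, ← zpow_neg]
    congr 1
    push_cast
    ring

theorem qnum_ne_zero_of_le {q : ℂ} {K : ℕ} (hne : ∀ i, 2 ≤ i → i ≤ K → qnum q i ≠ 0) {i : ℕ}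
    (hi : 1 ≤ i) (hiK : i ≤ K) : qnum q i ≠ 0 := by
  rcases eq_or_lt_of_le hi with rfl | h
  · simp [qnum_one]
  · exact hne i h hiK

theorem IsHeckeFamily.mono {q : ℂ} {g : ℕ → H} {M N : ℕ} (h : IsHeckeFamily q g N) (hM : M ≤ N) :
    IsHeckeFamily q g M :=
  ⟨fun i hi => h.hecke i (by omega), fun i hi => h.braid i (by omega),
    fun i j hi hj => h.far i j hi (by omega)⟩

theorem IsHeckeFamily.shift {q : ℂ} {g : ℕ → H} {N : ℕ} (h : IsHeckeFamily q g (N + 1)) :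
    IsHeckeFamily q (fun i => g (i + 1)) N :=
  ⟨fun i hi => h.hecke _ (by omega), fun i hi => h.braid _ (by omega),
    fun i j hi hj => h.far _ _ (by omega) (by omega)⟩

theorem IsHeckeFamily.reverse {q : ℂ} {g : ℕ → H} {N : ℕ} (h : IsHeckeFamily q g N) :
    IsHeckeFamily q (fun i => g (N - 1 - i)) N := by
  refine ⟨fun i hi => h.hecke _ (by omega), fun i hi => ?_, fun i j hi hj => ?_⟩
  · have e : N - 1 - i = N - 1 - (i + 1) + 1 := by omega
    simp only [e]
    exact (h.braid _ (by omega)).symm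
  · exact (h.far _ _ (by omega) (by omega)).symm

theorem asym_congr {q : ℂ} {g g' : ℕ → H} {k : ℕ} (h : ∀ i, i + 1 < k → g i = g' i) :
    asym q g k = asym q g' k := by
  induction k with
  | zero => rfl
  | succ k ih =>
    cases k with
    | zero => rfl
    | succ k =>
      simp only [asym, ih fun i hi => h i (by omega), h k (by omega)]

theorem map_asym {H' : Type*} [Ring H'] [Algebra ℂ H'] (f : H →ₐ[ℂ] H') (q : ℂ) (g : ℕ → H)
    (k : ℕ) : f (asym q g k) = asym q (fun i => f (g i)) k := by
  induction k with
  | zero => exact map_one f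
  | succ k ih =>
    cases k with
    | zero => exact map_one f
    | succ k => simp only [asym, map_smul, map_mul, map_sub, map_one, ih]

theorem Commute.asym_right {q : ℂ} {g : ℕ → H} {k : ℕ} {x : H}
    (h : ∀ i, i + 1 < k → Commute x (g i)) : Commute x (asym q g k) := by
  induction k with
  | zero => exact Commute.one_right x
  | succ k ih =>
    cases k with
    | zero => exact Commute.one_right x
    | succ k =>
      have h1 := ih fun i hi => h i (by omega)
      exact ((h1.mul_right (((Commute.one_right x).smul_right _).sub_right
        (h k (by omega)))).mul_right h1).smul_right _

/-- `Z A^{(k)} = Z` as soon as each generator involved in `A^{(k)}` acts on `Z` from the right as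
`-q⁻¹`. -/
theorem mul_asym_of_absorb {q : ℂ} (hq : q ≠ 0) {g : ℕ → H} {k : ℕ}
    (hne : ∀ i, 2 ≤ i → i ≤ k → qnum q i ≠ 0) {Z : H}
    (h : ∀ i, i + 1 < k → Z * g i = -q⁻¹ • Z) : Z * asym q g k = Z := by
  induction k with
  | zero => exact mul_one Z
  | succ k ih =>
    cases k with
    | zero => exact mul_one Z
    | succ k =>
      have h1 := ih (fun i h2 hi => hne i h2 (by omega)) fun i hi => h i (by omega)
      have n1 : qnum q (k + 1) ≠ 0 := qnum_ne_zero_of_le hne (by omega) (by omega)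
      have n2 : qnum q (k + 2) ≠ 0 := hne _ (by omega) (by omega)
      rw [asym, mul_smul_comm, ← mul_assoc, ← mul_assoc, h1, mul_sub, h k (by omega),
        mul_smul_comm, mul_one, ← sub_smul, smul_mul_assoc, h1, smul_smul]
      convert one_smul ℂ Z using 2
      rw [div_mul_eq_mul_div, div_eq_one_iff_eq n2, qnum_succ hq (k + 1)]
      field_simp
      ring

theorem asym_mul_of_absorb {q : ℂ} (hq : q ≠ 0) {g : ℕ → H} {k : ℕ}
    (hne : ∀ i, 2 ≤ i → i ≤ k → qnum q i ≠ 0) {Z : H}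
    (h : ∀ i, i + 1 < k → g i * Z = -q⁻¹ • Z) : asym q g k * Z = Z := by
  induction k with
  | zero => exact one_mul Z
  | succ k ih =>
    cases k with
    | zero => exact one_mul Z
    | succ k =>
      have h1 := ih (fun i h2 hi => hne i h2 (by omega)) fun i hi => h i (by omega)
      have n1 : qnum q (k + 1) ≠ 0 := qnum_ne_zero_of_le hne (by omega) (by omega)
      have n2 : qnum q (k + 2) ≠ 0 := hne _ (by omega) (by omega)
      rw [asym, smul_mul_assoc, mul_assoc, h1, mul_assoc, sub_mul, h k (by omega),
        smul_mul_assoc, one_mul, ← sub_smul, mul_smul_comm, h1, smul_smul]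
      convert one_smul ℂ Z using 2
      rw [div_mul_eq_mul_div, div_eq_one_iff_eq n2, qnum_succ hq (k + 1)]
      field_simp
      ring

/-- The inductive step of the absorption property: with `A = A^{(k+1)}`, `E = A^{(k)}` and `g`, `h`
the last two generators, `(q x A - c A g A) g = -q⁻¹ (q x A - c A g A)`. -/
theorem absorb_step_right {q : ℂ} (hq : q ≠ 0) {A E g h : H} {b c x : ℂ}
    (hA : c • A = x • E - b • (E * h * E)) (hAE : A * E = A) (hEg : E * g = g * E)
    (hAh : A * h = -q⁻¹ • A) (hg : g * g = 1 + (q - q⁻¹) • g) (hbr : h * g * h = g * h * g) :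
    ((q * x) • A - c • (A * g * A)) * g = -q⁻¹ • ((q * x) • A - c • (A * g * A)) := by
  have e1 : A * g * E = A * g := by rw [mul_assoc, ← hEg, ← mul_assoc, hAE]
  have e2 : c • (A * g * A) = x • (A * g) - b • (A * g * h * E) := by
    rw [← mul_smul_comm, hA, mul_sub, mul_smul_comm, mul_smul_comm, e1, ← mul_assoc, ← mul_assoc,
      e1]
  have e3 : A * g * h * E * g = -q⁻¹ • (A * g * h * E) := by
    calc A * g * h * E * g = A * (g * h * g) * E := by rw [mul_assoc _ E, hEg]; noncomm_ring
      _ = (A * h) * g * h * E := by rw [← hbr]; noncomm_ring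
      _ = _ := by rw [hAh]; simp only [smul_mul_assoc]
  have e4 : A * g * g = A + (q - q⁻¹) • (A * g) := by
    rw [mul_assoc, hg, mul_add, mul_one, mul_smul_comm]
  rw [e2, sub_mul, sub_mul, smul_mul_assoc, smul_mul_assoc, smul_mul_assoc, e3, e4]
  match_scalars <;> field_simp <;> ring

theorem absorb_step_left {q : ℂ} (hq : q ≠ 0) {A E g h : H} {b c x : ℂ}
    (hA : c • A = x • E - b • (E * h * E)) (hAE : E * A = A) (hEg : E * g = g * E)
    (hAh : h * A = -q⁻¹ • A) (hg : g * g = 1 + (q - q⁻¹) • g) (hbr : h * g * h = g * h * g) :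
    g * ((q * x) • A - c • (A * g * A)) = -q⁻¹ • ((q * x) • A - c • (A * g * A)) := by
  have e1 : E * g * A = g * A := by rw [hEg, mul_assoc, hAE]
  have e2 : c • (A * g * A) = x • (g * A) - b • (E * h * g * A) := by
    rw [mul_assoc, ← smul_mul_assoc, hA, sub_mul, smul_mul_assoc, smul_mul_assoc, ← mul_assoc, e1,
      mul_assoc (E * h), ← mul_assoc E g, e1, ← mul_assoc]
  have e3 : g * (E * h * g * A) = -q⁻¹ • (E * h * g * A) := by
    calc g * (E * h * g * A) = E * (g * h * g) * A := by
          rw [← mul_assoc, ← mul_assoc, ← mul_assoc, ← hEg]; noncomm_ring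
      _ = E * h * g * (h * A) := by rw [← hbr]; noncomm_ring
      _ = _ := by rw [hAh]; simp only [mul_smul_comm]
  have e4 : g * (g * A) = A + (q - q⁻¹) • (g * A) := by
    rw [← mul_assoc, hg, add_mul, one_mul, smul_mul_assoc]
  rw [e2, mul_sub, mul_sub, mul_smul_comm, mul_smul_comm, mul_smul_comm, e3, e4]
  match_scalars <;> field_simp <;> ring

theorem asym_succ_of_idem {q : ℂ} {g : ℕ → H} {k : ℕ} (n1 : qnum q (k + 1) ≠ 0)
    (n2 : qnum q (k + 2) ≠ 0) (h : asym q g (k + 1) * asym q g (k + 1) = asym q g (k + 1)) :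
    qnum q (k + 2) • asym q g (k + 2) =
      q ^ (k + 1) • asym q g (k + 1) -
        qnum q (k + 1) • (asym q g (k + 1) * g k * asym q g (k + 1)) := by
  rw [asym, mul_sub, sub_mul, mul_smul_comm, mul_one, smul_mul_assoc, h, smul_smul,
    mul_div_cancel₀ _ n2, smul_sub, smul_smul, mul_div_cancel₀ _ n1]

/-- Multiplication of the antisymmetrizer by a generator, on either side, is multiplication by
`-q⁻¹`. -/
theorem asym_absorb {q : ℂ} (hq : q ≠ 0) {g : ℕ → H} {k : ℕ} (hg : IsHeckeFamily q g (k - 1))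
    (hne : ∀ i, 2 ≤ i → i ≤ k → qnum q i ≠ 0) :
    ∀ i, i + 1 < k → asym q g k * g i = -q⁻¹ • asym q g k ∧ g i * asym q g k = -q⁻¹ • asym q g k := by
  induction k using Nat.strong_induction_on with
  | _ k IH =>
    match k with
    | 0 => intro i hi; omega
    | 1 => intro i hi; omega
    | k + 2 =>
      have hne' : ∀ i, 2 ≤ i → i ≤ k + 1 → qnum q i ≠ 0 := fun i h2 hi => hne i h2 (by omega)
      have ih := IH (k + 1) (by omega) (hg.mono (by omega)) hne'
      have n1 : qnum q (k + 1) ≠ 0 := qnum_ne_zero_of_le hne (by omega) (by omega)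
      have n2 : qnum q (k + 2) ≠ 0 := hne _ (by omega) (by omega)
      have hid := mul_asym_of_absorb hq hne' fun i hi => (ih i hi).1
      have hB := asym_succ_of_idem n1 n2 hid
      have key : qnum q (k + 2) • asym q g (k + 2) * g k =
            -q⁻¹ • (qnum q (k + 2) • asym q g (k + 2)) ∧
          g k * qnum q (k + 2) • asym q g (k + 2) =
            -q⁻¹ • (qnum q (k + 2) • asym q g (k + 2)) := by
        cases k with
        | zero =>
          have h0 := hg.hecke 0 (by omega)
          rw [hB]
          simp only [asym, qnum_one, zero_add, pow_one, one_smul, one_mul, mul_one, sub_mul, mul_sub,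
            h0, smul_mul_assoc, mul_smul_comm]
          constructor <;> match_scalars <;> field_simp <;> ring
        | succ k =>
          have n0 : qnum q (k + 1) ≠ 0 := qnum_ne_zero_of_le hne (by omega) (by omega)
          have hidE : asym q g (k + 1) * asym q g (k + 1) = asym q g (k + 1) := by
            refine mul_asym_of_absorb hq (fun i h2 hi => hne i h2 (by omega)) fun i hi => ?_
            exact (IH (k + 1) (by omega) (hg.mono (by omega))
              (fun i h2 hi => hne i h2 (by omega)) i hi).1
          have hA := asym_succ_of_idem n0 n1 hidE
          have hcomm : asym q g (k + 1) * g (k + 1) = g (k + 1) * asym q g (k + 1) :=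
            (Commute.asym_right fun i hi => (hg.far i (k + 1) (by omega) (by omega)).symm).eq.symm
          rw [hB, pow_succ' q (k + 1)]
          exact ⟨absorb_step_right hq hA
              (mul_asym_of_absorb hq (fun i h2 hi => hne i h2 (by omega))
                fun i hi => (ih i (by omega)).1)
              hcomm (ih k (by omega)).1 (hg.hecke _ (by omega)) (hg.braid _ (by omega)),
            absorb_step_left hq hA
              (asym_mul_of_absorb hq (fun i h2 hi => hne i h2 (by omega))
                fun i hi => (ih i (by omega)).2)
              hcomm (ih k (by omega)).2 (hg.hecke _ (by omega)) (hg.braid _ (by omega))⟩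
      intro i hi
      rcases Nat.lt_or_ge i k with h | h
      · have := ih i (by omega)
        constructor
        · rw [asym, smul_mul_assoc, mul_assoc, this.1, mul_smul_comm, smul_comm]
        · rw [asym, mul_smul_comm, mul_assoc, ← mul_assoc (g i), this.2, smul_mul_assoc, smul_comm]
      · obtain rfl : i = k := by omega
        rw [smul_mul_assoc, mul_smul_comm, smul_comm (-q⁻¹)] at key
        exact ⟨smul_right_injective H n2 key.1, smul_right_injective H n2 key.2⟩

theorem asym_mul_self {q : ℂ} (hq : q ≠ 0) {g : ℕ → H} {k : ℕ} (hg : IsHeckeFamily q g (k - 1))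
    (hne : ∀ i, 2 ≤ i → i ≤ k → qnum q i ≠ 0) : asym q g k * asym q g k = asym q g k :=
  mul_asym_of_absorb hq hne fun i hi => (asym_absorb hq hg hne i hi).1

theorem asym_succ {q : ℂ} (hq : q ≠ 0) {g : ℕ → H} {k : ℕ} (hg : IsHeckeFamily q g (k + 1))
    (hne : ∀ i, 2 ≤ i → i ≤ k + 2 → qnum q i ≠ 0) :
    qnum q (k + 2) • asym q g (k + 2) =
      q ^ (k + 1) • asym q g (k + 1) -
        qnum q (k + 1) • (asym q g (k + 1) * g k * asym q g (k + 1)) :=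
  asym_succ_of_idem (qnum_ne_zero_of_le hne (by omega) (by omega)) (hne _ (by omega) le_rfl)
    (asym_mul_self hq (hg.mono (by omega)) fun i h2 hi => hne i h2 (by omega))

/-- The antisymmetrizer does not change when its generators are taken in the reverse order: both
versions absorb all generators, hence each other. -/
theorem asym_reverse {q : ℂ} (hq : q ≠ 0) {g : ℕ → H} {k : ℕ} (hg : IsHeckeFamily q g (k - 1))
    (hne : ∀ i, 2 ≤ i → i ≤ k → qnum q i ≠ 0) :
    asym q (fun i => g (k - 2 - i)) k = asym q g k := by
  have hrev : IsHeckeFamily q (fun i => g (k - 2 - i)) (k - 1) := by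
    have := hg.reverse
    rwa [show k - 1 - 1 = k - 2 by omega] at this
  have h1 : asym q (fun i => g (k - 2 - i)) k * asym q g k = asym q (fun i => g (k - 2 - i)) k := by
    refine mul_asym_of_absorb hq hne fun i hi => ?_
    have := (asym_absorb hq hrev hne (k - 2 - i) (by omega)).1
    simpa only [show k - 2 - (k - 2 - i) = i by omega] using this
  have h2 : asym q (fun i => g (k - 2 - i)) k * asym q g k = asym q g k :=
    asym_mul_of_absorb hq hne fun i hi => (asym_absorb hq hg hne (k - 2 - i) (by omega)).2
  exact h1.symm.trans h2

/-- The recursion for the antisymmetrizer that adds a strand on the left. -/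
theorem asym_succ_left {q : ℂ} (hq : q ≠ 0) {g : ℕ → H} {k : ℕ} (hg : IsHeckeFamily q g (k + 1))
    (hne : ∀ i, 2 ≤ i → i ≤ k + 2 → qnum q i ≠ 0) :
    qnum q (k + 2) • asym q g (k + 2) =
      q ^ (k + 1) • asym q (fun i => g (i + 1)) (k + 1) -
        qnum q (k + 1) •
          (asym q (fun i => g (i + 1)) (k + 1) * g 0 * asym q (fun i => g (i + 1)) (k + 1)) := by
  have hrev : IsHeckeFamily q (fun i => g (k - i)) (k + 1) := hg.reverse
  have e1 : asym q (fun i => g (k - i)) (k + 2) = asym q g (k + 2) := by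
    rw [← asym_reverse hq (k := k + 2) hg hne]
    rfl
  have e2 : asym q (fun i => g (k - i)) (k + 1) = asym q (fun i => g (i + 1)) (k + 1) := by
    rw [← asym_reverse hq (k := k + 1) hg.shift fun i h2 hi => hne i h2 (by omega)]
    refine asym_congr fun i hi => ?_
    show g (k - i) = g (k + 1 - 2 - i + 1)
    congr 1
    omega
  have := asym_succ hq hrev hne
  rwa [e1, e2, Nat.sub_self] at this

/-- With `A` and `A'` the antisymmetrizers on the first and on the last `n` of `n + 1` strands:
`(n-1)_q (qⁿ A' - n_q A' g₀ A') = n_q² A' A A' - A'`. -/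
theorem asym_gl_left {q : ℂ} (hq : q ≠ 0) {g : ℕ → H} {k : ℕ} (hg : IsHeckeFamily q g (k + 2))
    (hne : ∀ i, 2 ≤ i → i ≤ k + 2 → qnum q i ≠ 0) :
    qnum q (k + 1) • (q ^ (k + 2) • asym q (fun i => g (i + 1)) (k + 2) - qnum q (k + 2) •
        (asym q (fun i => g (i + 1)) (k + 2) * g 0 * asym q (fun i => g (i + 1)) (k + 2))) =
      qnum q (k + 2) ^ 2 • (asym q (fun i => g (i + 1)) (k + 2) * asym q g (k + 2) *
        asym q (fun i => g (i + 1)) (k + 2)) - asym q (fun i => g (i + 1)) (k + 2) := by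
  have hne' : ∀ i, 2 ≤ i → i ≤ k + 1 → qnum q i ≠ 0 := fun i h2 hi => hne i h2 (by omega)
  have hA := asym_succ_left hq (hg.mono (by omega)) hne
  have habs := asym_absorb hq (k := k + 2) hg.shift hne
  have hid := asym_mul_self hq (k := k + 2) hg.shift hne
  have hr := mul_asym_of_absorb hq hne' fun i hi => (habs i (by omega)).1
  have hl := asym_mul_of_absorb hq hne' fun i hi => (habs i (by omega)).2
  set A' := asym q (fun i => g (i + 1)) (k + 2)
  set E := asym q (fun i => g (i + 1)) (k + 1)
  have e : qnum q (k + 2) • (A' * asym q g (k + 2) * A') =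
      q ^ (k + 1) • A' - qnum q (k + 1) • (A' * g 0 * A') := by
    rw [← smul_mul_assoc, ← mul_smul_comm, hA, mul_sub, mul_smul_comm, mul_smul_comm, hr,
      ← mul_assoc, ← mul_assoc, hr, sub_mul, smul_mul_assoc, smul_mul_assoc, hid, mul_assoc _ E, hl]
  rw [sq, mul_smul, e]
  have h2 : qnum q (k + 2) = q * qnum q (k + 1) + (q ^ (k + 1))⁻¹ := qnum_succ' hq (k + 1)
  match_scalars
  · rw [h2]; field_simp; ring
  · ring

theorem asym_gl_right {q : ℂ} (hq : q ≠ 0) {g : ℕ → H} {k : ℕ} (hg : IsHeckeFamily q g (k + 2))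
    (hne : ∀ i, 2 ≤ i → i ≤ k + 2 → qnum q i ≠ 0) :
    qnum q (k + 1) • (q ^ (k + 2) • asym q g (k + 2) - qnum q (k + 2) •
        (asym q g (k + 2) * g (k + 1) * asym q g (k + 2))) =
      qnum q (k + 2) ^ 2 • (asym q g (k + 2) * asym q (fun i => g (i + 1)) (k + 2) *
        asym q g (k + 2)) - asym q g (k + 2) := by
  have hrev : IsHeckeFamily q (fun i => g (k + 1 - i)) (k + 2) := hg.reverse
  have h := asym_gl_left hq hrev hne
  have e1 : asym q (fun i => g (k + 1 - i)) (k + 2) = asym q (fun i => g (i + 1)) (k + 2) := by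
    rw [← asym_reverse hq (k := k + 2) hg.shift hne]
    refine asym_congr fun i hi => ?_
    show g (k + 1 - i) = g (k + 2 - 2 - i + 1)
    congr 1
    omega
  have e2 : asym q (fun i => g (k + 1 - (i + 1))) (k + 2) = asym q g (k + 2) := by
    rw [← asym_reverse hq (k := k + 2) (hg.mono (by omega)) hne]
    refine asym_congr fun i hi => ?_
    show g _ = g _
    congr 1
    omega
  simpa only [e1, e2, Nat.sub_zero] using h

end Hecke

/-! ### The tower of matrix algebras on tensor powers -/

section Tower

variable {n : ℕ} {A : Type*}

theorem sum_snoc {M : Type*} [AddCommMonoid M] {m : ℕ} (f : (Fin (m + 1) → Fin n) → M) :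
    ∑ w, f w = ∑ u : Fin m → Fin n, ∑ a, f (Fin.snoc (α := fun _ => Fin n) u a) := by
  rw [← (Fin.snocEquiv fun _ : Fin (m + 1) => Fin n).sum_comp, Fintype.sum_prod_type,
    Finset.sum_comm]
  rfl

theorem sum_cons {M : Type*} [AddCommMonoid M] {m : ℕ} (f : (Fin (m + 1) → Fin n) → M) :
    ∑ w, f w = ∑ a, ∑ u : Fin m → Fin n, f (Fin.cons (α := fun _ => Fin n) a u) := by
  rw [← (Fin.consEquiv fun _ : Fin (m + 1) => Fin n).sum_comp, Fintype.sum_prod_type]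
  rfl

theorem matrix_ext_snoc {m : ℕ} {X Y : Matrix (Fin (m + 1) → Fin n) (Fin (m + 1) → Fin n) A}
    (h : ∀ (u v : Fin m → Fin n) (a b : Fin n),
      X (Fin.snoc (α := fun _ => Fin n) u a) (Fin.snoc (α := fun _ => Fin n) v b) =
        Y (Fin.snoc (α := fun _ => Fin n) u a) (Fin.snoc (α := fun _ => Fin n) v b)) : X = Y := by
  ext u v
  have := h (Fin.init u) (Fin.init v) (u (Fin.last m)) (v (Fin.last m))
  rwa [Fin.snoc_init_self, Fin.snoc_init_self] at this

theorem matrix_ext_cons {m : ℕ} {X Y : Matrix (Fin (m + 1) → Fin n) (Fin (m + 1) → Fin n) A}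
    (h : ∀ (u v : Fin m → Fin n) (a b : Fin n),
      X (Fin.cons (α := fun _ => Fin n) a u) (Fin.cons (α := fun _ => Fin n) b v) =
        Y (Fin.cons (α := fun _ => Fin n) a u) (Fin.cons (α := fun _ => Fin n) b v)) : X = Y := by
  ext u v
  have := h (Fin.tail u) (Fin.tail v) (u 0) (v 0)
  rwa [Fin.cons_self_tail, Fin.cons_self_tail] at this

theorem snoc_inj_iff {m : ℕ} {u v : Fin m → Fin n} {a b : Fin n} :
    (Fin.snoc (α := fun _ => Fin n) u a : Fin (m + 1) → Fin n) =
      Fin.snoc (α := fun _ => Fin n) v b ↔ u = v ∧ a = b :=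
  Fin.snoc_inj

/-- `X ⊗ 1`: a matrix on `V^{⊗ m}` acting in the first `m` factors of `V^{⊗ (m+1)}`. -/
def up [Zero A] {m : ℕ} (X : Matrix (Fin m → Fin n) (Fin m → Fin n) A) :
    Matrix (Fin (m + 1) → Fin n) (Fin (m + 1) → Fin n) A :=
  Matrix.of fun u v => if u (Fin.last m) = v (Fin.last m) then X (Fin.init u) (Fin.init v) else 0

/-- `1 ⊗ X`: a matrix on `V^{⊗ m}` acting in the last `m` factors of `V^{⊗ (m+1)}`. -/
def shiftUp [Zero A] {m : ℕ} (X : Matrix (Fin m → Fin n) (Fin m → Fin n) A) :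
    Matrix (Fin (m + 1) → Fin n) (Fin (m + 1) → Fin n) A :=
  Matrix.of fun u v => if u 0 = v 0 then X (Fin.tail u) (Fin.tail v) else 0

theorem up_snoc [Zero A] {m : ℕ} (X : Matrix (Fin m → Fin n) (Fin m → Fin n) A)
    (u v : Fin m → Fin n) (a b : Fin n) :
    up X (Fin.snoc (α := fun _ => Fin n) u a) (Fin.snoc (α := fun _ => Fin n) v b) =
      if a = b then X u v else 0 := by
  simp [up]

theorem shiftUp_cons [Zero A] {m : ℕ} (X : Matrix (Fin m → Fin n) (Fin m → Fin n) A)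
    (u v : Fin m → Fin n) (a b : Fin n) :
    shiftUp X (Fin.cons (α := fun _ => Fin n) a u) (Fin.cons (α := fun _ => Fin n) b v) =
      if a = b then X u v else 0 := by
  simp [shiftUp]

theorem up_bond [Zero A] {m i : ℕ} (hi : i + 1 < m) (X : Matrix (Fin n × Fin n) (Fin n × Fin n) A) :
    up (bond m i X) = bond (m + 1) i X := by
  refine matrix_ext_snoc fun u v a b => ?_
  rw [up_snoc]
  have key : (∀ j : Fin (m + 1), (j : ℕ) ≠ i → (j : ℕ) ≠ i + 1 →
      Fin.snoc (α := fun _ => Fin n) u a j = Fin.snoc (α := fun _ => Fin n) v b j) ↔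
      a = b ∧ ∀ j : Fin m, (j : ℕ) ≠ i → (j : ℕ) ≠ i + 1 → u j = v j := by
    constructor
    · intro h
      refine ⟨by simpa using h (Fin.last m) (by simp; omega) (by simp; omega), fun j h1 h2 => ?_⟩
      simpa using h j.castSucc (by simpa using h1) (by simpa using h2)
    · rintro ⟨h, h'⟩ j
      refine Fin.lastCases ?_ (fun j => ?_) j
      · intros; simpa using h
      · intro h1 h2; simpa using h' j (by simpa using h1) (by simpa using h2)
  have e : ∀ (w : Fin m → Fin n) (c : Fin n) (j : ℕ) (hj : j < m) (hj' : j < m + 1),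
      Fin.snoc (α := fun _ => Fin n) w c ⟨j, hj'⟩ = w ⟨j, hj⟩ := by
    intro w c j hj hj'
    exact Fin.snoc_castSucc (α := fun _ => Fin n) c w ⟨j, hj⟩
  simp only [bond, Matrix.of_apply, dif_pos hi, dif_pos (show i + 1 < m + 1 by omega), key]
  rw [e u a i (by omega), e u a (i + 1) hi, e v b i (by omega), e v b (i + 1) hi]
  by_cases h : a = b <;> simp [h]

theorem shiftUp_bond [Zero A] (m i : ℕ) (X : Matrix (Fin n × Fin n) (Fin n × Fin n) A) :
    shiftUp (bond m i X) = bond (m + 1) (i + 1) X := by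
  refine matrix_ext_cons fun u v a b => ?_
  rw [shiftUp_cons]
  have key : (∀ j : Fin (m + 1), (j : ℕ) ≠ i + 1 → (j : ℕ) ≠ i + 1 + 1 →
      Fin.cons (α := fun _ => Fin n) a u j = Fin.cons (α := fun _ => Fin n) b v j) ↔
      a = b ∧ ∀ j : Fin m, (j : ℕ) ≠ i → (j : ℕ) ≠ i + 1 → u j = v j := by
    constructor
    · intro h
      refine ⟨by simpa using h 0 (by simp) (by simp), fun j h1 h2 => ?_⟩
      simpa using h j.succ (by simpa using h1) (by simpa using h2)
    · rintro ⟨h, h'⟩ j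
      refine Fin.cases ?_ (fun j => ?_) j
      · intros; simpa using h
      · intro h1 h2; simpa using h' j (by simpa using h1) (by simpa using h2)
  have e : ∀ (w : Fin m → Fin n) (c : Fin n) (j : ℕ) (hj : j < m) (hj' : j + 1 < m + 1),
      Fin.cons (α := fun _ => Fin n) c w ⟨j + 1, hj'⟩ = w ⟨j, hj⟩ := by
    intro w c j hj hj'
    exact Fin.cons_succ (α := fun _ => Fin n) c w ⟨j, hj⟩
  simp only [bond, Matrix.of_apply, key]
  by_cases hi : i + 1 < m
  · rw [dif_pos hi, dif_pos (show i + 1 + 1 < m + 1 by omega)]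
    rw [e u a i (by omega), e u a (i + 1) hi, e v b i (by omega), e v b (i + 1) hi]
    by_cases h : a = b <;> simp [h]
  · rw [dif_neg hi, dif_neg (by omega), ite_self]

theorem bond_last [Zero A] (m : ℕ) (X : Matrix (Fin n × Fin n) (Fin n × Fin n) A)
    (u v : Fin m → Fin n) (a b c d : Fin n) :
    bond (m + 2) m X
      (Fin.snoc (α := fun _ => Fin n) (Fin.snoc (α := fun _ => Fin n) u a : Fin (m + 1) → Fin n) b)
      (Fin.snoc (α := fun _ => Fin n) (Fin.snoc (α := fun _ => Fin n) v c : Fin (m + 1) → Fin n) d)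
      = if u = v then X (a, b) (c, d) else 0 := by
  have key : (∀ j : Fin (m + 2), (j : ℕ) ≠ m → (j : ℕ) ≠ m + 1 →
      Fin.snoc (α := fun _ => Fin n)
        (Fin.snoc (α := fun _ => Fin n) u a : Fin (m + 1) → Fin n) b j =
      Fin.snoc (α := fun _ => Fin n)
        (Fin.snoc (α := fun _ => Fin n) v c : Fin (m + 1) → Fin n) d j) ↔ u = v := by
    constructor
    · intro h
      funext j
      simpa using h j.castSucc.castSucc (by simp; omega) (by simp; omega)
    · rintro rfl j
      refine Fin.lastCases (by simp) (fun j => ?_) j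
      refine Fin.lastCases (by simp) (fun j => ?_) j
      simp
  have e1 : ∀ (w : Fin m → Fin n) (c d : Fin n) (h : m + 1 < m + 2),
      Fin.snoc (α := fun _ => Fin n)
        (Fin.snoc (α := fun _ => Fin n) w c : Fin (m + 1) → Fin n) d ⟨m + 1, h⟩ = d :=
    fun w c d h => Fin.snoc_last (α := fun _ => Fin n) _ _
  have e2 : ∀ (w : Fin m → Fin n) (c d : Fin n) (h : m < m + 2),
      Fin.snoc (α := fun _ => Fin n)
        (Fin.snoc (α := fun _ => Fin n) w c : Fin (m + 1) → Fin n) d ⟨m, h⟩ = c :=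
    fun w c d h => (Fin.snoc_castSucc (α := fun _ => Fin n) d _ (Fin.last m)).trans
      (Fin.snoc_last (α := fun _ => Fin n) _ _)
  simp only [bond, Matrix.of_apply, dif_pos (show m + 1 < m + 2 by omega), key, e1, e2]

section Ring

variable [Ring A]

theorem up_one {m : ℕ} : up (1 : Matrix (Fin m → Fin n) (Fin m → Fin n) A) = 1 := by
  refine matrix_ext_snoc fun u v a b => ?_
  rw [up_snoc, Matrix.one_apply, Matrix.one_apply]
  simp only [snoc_inj_iff]
  by_cases h : a = b <;> simp [h]

theorem up_mul {m : ℕ} (X Y : Matrix (Fin m → Fin n) (Fin m → Fin n) A) :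
    up (X * Y) = up X * up Y := by
  refine matrix_ext_snoc fun u v a b => ?_
  rw [up_snoc, Matrix.mul_apply, Matrix.mul_apply, sum_snoc]
  simp only [up_snoc]
  by_cases h : a = b <;> simp [h]

theorem up_add {m : ℕ} (X Y : Matrix (Fin m → Fin n) (Fin m → Fin n) A) :
    up (X + Y) = up X + up Y := by
  refine matrix_ext_snoc fun u v a b => ?_
  simp only [up_snoc, Matrix.add_apply]
  split_ifs <;> simp

theorem up_zero {m : ℕ} : up (0 : Matrix (Fin m → Fin n) (Fin m → Fin n) A) = 0 := by
  refine matrix_ext_snoc fun u v a b => ?_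
  simp [up_snoc]

theorem shiftUp_mul {m : ℕ} (X Y : Matrix (Fin m → Fin n) (Fin m → Fin n) A) :
    shiftUp (X * Y) = shiftUp X * shiftUp Y := by
  refine matrix_ext_cons fun u v a b => ?_
  rw [shiftUp_cons, Matrix.mul_apply, Matrix.mul_apply, sum_cons]
  simp only [shiftUp_cons]
  by_cases h : a = b <;> simp [h]

theorem bond_one {m i : ℕ} (hi : i + 1 < m) :
    bond m i (1 : Matrix (Fin n × Fin n) (Fin n × Fin n) A) = 1 := by
  induction m with
  | zero => omega
  | succ m ih =>
    rcases Nat.lt_or_ge (i + 1) m with h | h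
    · rw [← up_bond h, ih h, up_one]
    · obtain rfl : m = i + 1 := by omega
      refine matrix_ext_snoc fun u v b d => ?_
      rw [← Fin.snoc_init_self u, ← Fin.snoc_init_self v, bond_last, Matrix.one_apply,
        Matrix.one_apply]
      simp only [snoc_inj_iff, Prod.mk.injEq, and_assoc]
      split_ifs <;> first | rfl | tauto

theorem bond_mul {m i : ℕ} (hi : i + 1 < m) (X Y : Matrix (Fin n × Fin n) (Fin n × Fin n) A) :
    bond m i (X * Y) = bond m i X * bond m i Y := by
  induction m with
  | zero => omega
  | succ m ih =>
    rcases Nat.lt_or_ge (i + 1) m with h | h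
    · rw [← up_bond h, ih h, up_mul, up_bond h, up_bond h]
    · obtain rfl : m = i + 1 := by omega
      refine matrix_ext_snoc fun u v b d => ?_
      rw [← Fin.snoc_init_self u, ← Fin.snoc_init_self v, bond_last, Matrix.mul_apply,
        Matrix.mul_apply, sum_snoc, sum_snoc]
      simp only [bond_last, Fintype.sum_prod_type]
      by_cases h : Fin.init u = Fin.init v
      · simp [h, Finset.sum_ite_irrel, ite_mul]
      · simp [h]

theorem bond_add (m i : ℕ) (X Y : Matrix (Fin n × Fin n) (Fin n × Fin n) A) :
    bond m i (X + Y) = bond m i X + bond m i Y := by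
  ext u v
  simp only [bond, Matrix.of_apply, Matrix.add_apply]
  split_ifs <;> simp

variable [Algebra ℂ A]

/-- `up` as a homomorphism of algebras. -/
def upHom (m : ℕ) : Matrix (Fin m → Fin n) (Fin m → Fin n) A →ₐ[ℂ]
    Matrix (Fin (m + 1) → Fin n) (Fin (m + 1) → Fin n) A where
  toFun := up
  map_one' := up_one
  map_mul' := up_mul
  map_zero' := up_zero
  map_add' := up_add
  commutes' c := by
    refine matrix_ext_snoc fun u v a b => ?_
    simp only [up_snoc, Matrix.algebraMap_matrix_apply, snoc_inj_iff]
    by_cases h : a = b <;> simp [h]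

theorem upHom_apply {m : ℕ} (X : Matrix (Fin m → Fin n) (Fin m → Fin n) A) :
    upHom m X = up X := rfl

theorem bond_smul (m i : ℕ) (c : ℂ) (X : Matrix (Fin n × Fin n) (Fin n × Fin n) A) :
    bond m i (c • X) = c • bond m i X := by
  ext u v
  simp only [bond, Matrix.of_apply, Matrix.smul_apply]
  split_ifs <;> simp

theorem scal_bond (m i : ℕ) (X : Matrix (Fin n × Fin n) (Fin n × Fin n) ℂ) :
    scal A (bond m i X) = bond m i (scal A X) := by
  ext u v
  simp only [bond, scal, Matrix.map_apply, Matrix.of_apply]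
  split_ifs <;> simp

/-- `scal` as a homomorphism of algebras. -/
noncomputable def scalHom (ι A : Type*) [Fintype ι] [DecidableEq ι] [Ring A] [Algebra ℂ A] :
    Matrix ι ι ℂ →ₐ[ℂ] Matrix ι ι A :=
  (Algebra.ofId ℂ A).mapMatrix

theorem scalHom_apply {ι : Type*} [Fintype ι] [DecidableEq ι] (X : Matrix ι ι ℂ) :
    scalHom ι A X = scal A X := rfl

/-- Matrices acting in disjoint factors commute when the entries of one of them are scalars. -/
theorem commute_up_up_bond_last {m : ℕ} (Z : Matrix (Fin m → Fin n) (Fin m → Fin n) A)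
    (X : Matrix (Fin n × Fin n) (Fin n × Fin n) ℂ) :
    Commute (up (up Z)) (bond (m + 2) m (scal A X)) := by
  refine matrix_ext_snoc fun u v b d => ?_
  rw [← Fin.snoc_init_self u, ← Fin.snoc_init_self v, Matrix.mul_apply, Matrix.mul_apply, sum_snoc,
    sum_snoc, sum_snoc, sum_snoc]
  simp only [bond_last, up_snoc]
  simp [scal, Algebra.commutes]

/-! ### Braid generators on tensor powers -/

theorem bond_braid {R : Matrix (Fin n × Fin n) (Fin n × Fin n) ℂ}
    (h : bond 3 0 R * bond 3 1 R * bond 3 0 R = bond 3 1 R * bond 3 0 R * bond 3 1 R) {m i : ℕ}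
    (hi : i + 2 < m) :
    bond m i R * bond m (i + 1) R * bond m i R =
      bond m (i + 1) R * bond m i R * bond m (i + 1) R := by
  induction m generalizing i with
  | zero => omega
  | succ m ih =>
    cases i with
    | succ i =>
      have := congrArg shiftUp (ih (i := i) (by omega))
      simpa only [shiftUp_mul, shiftUp_bond] using this
    | zero =>
      rcases Nat.lt_or_ge 2 m with hm | hm
      · have := congrArg up (ih (i := 0) hm)
        simpa only [up_mul, up_bond (show 0 + 1 < m by omega), up_bond (show 0 + 1 + 1 < m by omega)]
          using this
      · obtain rfl : m = 2 := by omega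
        exact h

theorem bond_far (X Y : Matrix (Fin n × Fin n) (Fin n × Fin n) ℂ) {m i j : ℕ} (hij : i + 1 < j)
    (hj : j + 1 < m) : Commute (bond m i X) (bond m j Y) := by
  induction m with
  | zero => omega
  | succ m ih =>
    rcases Nat.lt_or_ge (j + 1) m with h | h
    · have := congrArg up (ih h).eq
      rwa [up_mul, up_mul, up_bond h, up_bond (show i + 1 < m by omega)] at this
    · obtain rfl : m = j + 1 := by omega
      have := commute_up_up_bond_last (bond j i X) Y
      rwa [up_bond hij, up_bond (show i + 1 < j + 1 by omega)] at this

/-- Both `q` and `-q⁻¹` being nonzero, the Hecke relation makes `R` invertible. -/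
theorem isUnit_det_of_hecke {q : ℂ} (hq : q ≠ 0) {R : Matrix (Fin n × Fin n) (Fin n × Fin n) ℂ}
    (h : (R - q • (1 : Matrix (Fin n × Fin n) (Fin n × Fin n) ℂ)) *
      (R + q⁻¹ • (1 : Matrix (Fin n × Fin n) (Fin n × Fin n) ℂ)) = 0) : IsUnit R.det := by
  have h1 : R * (R - (q - q⁻¹) • (1 : Matrix (Fin n × Fin n) (Fin n × Fin n) ℂ)) = 1 := by
    have : R * (R - (q - q⁻¹) • (1 : Matrix (Fin n × Fin n) (Fin n × Fin n) ℂ)) - 1 = 0 := by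
      rw [← h]
      simp only [sub_mul, mul_sub, mul_add, smul_mul_assoc, mul_smul_comm, one_mul, mul_one]
      match_scalars <;> field_simp; ring
    exact sub_eq_zero.1 this
  exact Matrix.isUnit_det_of_right_inverse h1

theorem isHeckeFamily_bond {q : ℂ} {R : Matrix (Fin n × Fin n) (Fin n × Fin n) ℂ} (hq : q ≠ 0)
    (hbr : bond 3 0 R * bond 3 1 R * bond 3 0 R = bond 3 1 R * bond 3 0 R * bond 3 1 R)
    (h : (R - q • (1 : Matrix (Fin n × Fin n) (Fin n × Fin n) ℂ)) *
      (R + q⁻¹ • (1 : Matrix (Fin n × Fin n) (Fin n × Fin n) ℂ)) = 0) (m : ℕ) :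
    IsHeckeFamily q (fun i => bond m i R) (m - 1) := by
  refine ⟨fun i hi => ?_, fun i hi => bond_braid hbr (by omega),
    fun i j hi hj => bond_far R R hi (by omega)⟩
  have h1 : R * R = 1 + (q - q⁻¹) • R := by
    refine sub_eq_zero.1 ?_
    rw [← h]
    simp only [sub_mul, mul_add, smul_mul_assoc, mul_smul_comm, one_mul, mul_one]
    match_scalars <;> field_simp; ring
  rw [← bond_mul (by omega), h1, bond_add, bond_smul, bond_one (by omega)]

theorem bond_last_mul_apply {m : ℕ} (X : Matrix (Fin n × Fin n) (Fin n × Fin n) ℂ)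
    (Z : Matrix (Fin (m + 2) → Fin n) (Fin (m + 2) → Fin n) A) (u : Fin m → Fin n)
    (w : Fin (m + 2) → Fin n) (a b : Fin n) :
    (bond (m + 2) m (scal A X) * Z)
      (Fin.snoc (α := fun _ => Fin n)
        (Fin.snoc (α := fun _ => Fin n) u a : Fin (m + 1) → Fin n) b) w =
    ∑ c, ∑ d, X (a, b) (c, d) • Z (Fin.snoc (α := fun _ => Fin n)
        (Fin.snoc (α := fun _ => Fin n) u c : Fin (m + 1) → Fin n) d) w := by
  simp only [Matrix.mul_apply, sum_snoc, bond_last, scal, Matrix.map_apply]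
  simp [Algebra.smul_def]

theorem mul_bond_last_apply {m : ℕ} (X : Matrix (Fin n × Fin n) (Fin n × Fin n) ℂ)
    (Z : Matrix (Fin (m + 2) → Fin n) (Fin (m + 2) → Fin n) A) (v : Fin m → Fin n)
    (w : Fin (m + 2) → Fin n) (a b : Fin n) :
    (Z * bond (m + 2) m (scal A X)) w
      (Fin.snoc (α := fun _ => Fin n)
        (Fin.snoc (α := fun _ => Fin n) v a : Fin (m + 1) → Fin n) b) =
    ∑ c, ∑ d, X (c, d) (a, b) • Z w (Fin.snoc (α := fun _ => Fin n)
        (Fin.snoc (α := fun _ => Fin n) v c : Fin (m + 1) → Fin n) d) := by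
  simp only [Matrix.mul_apply, sum_snoc, bond_last, scal, Matrix.map_apply]
  simp [Algebra.smul_def, Algebra.commutes]

/-! ### Quantum partial traces -/

/-- The partial trace `Tr_{(m+1)} (D_{m+1} Z)` over the last factor of `V^{⊗ (m+1)}`. -/
def rtr (D : Matrix (Fin n) (Fin n) ℂ) {m : ℕ}
    (Z : Matrix (Fin (m + 1) → Fin n) (Fin (m + 1) → Fin n) A) :
    Matrix (Fin m → Fin n) (Fin m → Fin n) A :=
  Matrix.of fun u v => ∑ a, ∑ b, D a b •
    Z (Fin.snoc (α := fun _ => Fin n) u b) (Fin.snoc (α := fun _ => Fin n) v a)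

section rtr

variable (D : Matrix (Fin n) (Fin n) ℂ) {m : ℕ}

theorem rtr_apply (Z : Matrix (Fin (m + 1) → Fin n) (Fin (m + 1) → Fin n) A)
    (u v : Fin m → Fin n) : rtr D Z u v = ∑ a, ∑ b, D a b •
    Z (Fin.snoc (α := fun _ => Fin n) u b) (Fin.snoc (α := fun _ => Fin n) v a) := rfl

theorem rtr_sub (X Y : Matrix (Fin (m + 1) → Fin n) (Fin (m + 1) → Fin n) A) :
    rtr D (X - Y) = rtr D X - rtr D Y := by
  ext u v
  simp [rtr_apply, smul_sub]

theorem rtr_smul (c : ℂ) (X : Matrix (Fin (m + 1) → Fin n) (Fin (m + 1) → Fin n) A) :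
    rtr D (c • X) = c • rtr D X := by
  ext u v
  simp only [rtr_apply, Matrix.smul_apply, Finset.smul_sum, smul_comm c]

theorem rtr_up_mul (X : Matrix (Fin m → Fin n) (Fin m → Fin n) A)
    (Z : Matrix (Fin (m + 1) → Fin n) (Fin (m + 1) → Fin n) A) :
    rtr D (up X * Z) = X * rtr D Z := by
  ext u v
  simp only [rtr_apply, Matrix.mul_apply, sum_snoc, up_snoc, ite_mul, zero_mul,
    Finset.sum_ite_eq, Finset.mem_univ, if_true, Finset.mul_sum, Finset.smul_sum, mul_smul_comm]
  exact (Finset.sum_congr rfl fun a _ => Finset.sum_comm).trans Finset.sum_comm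

theorem rtr_mul_up (X : Matrix (Fin m → Fin n) (Fin m → Fin n) A)
    (Z : Matrix (Fin (m + 1) → Fin n) (Fin (m + 1) → Fin n) A) :
    rtr D (Z * up X) = rtr D Z * X := by
  ext u v
  simp only [rtr_apply, Matrix.mul_apply, sum_snoc, up_snoc, mul_ite, mul_zero,
    Finset.sum_ite_eq', Finset.mem_univ, if_true, Finset.sum_mul, Finset.smul_sum, smul_mul_assoc]
  exact (Finset.sum_congr rfl fun a _ => Finset.sum_comm).trans Finset.sum_comm

variable {D}

theorem rtr_bond_last {R : Matrix (Fin n × Fin n) (Fin n × Fin n) ℂ}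
    (h : ∀ a c, ∑ b, ∑ b', D b b' * R (a, b') (c, b) = if a = c then 1 else 0) :
    rtr D (bond (m + 2) m (scal A R)) = 1 := by
  refine matrix_ext_snoc fun u v a c => ?_
  have h1 := congrArg (algebraMap ℂ A) (h a c)
  simp only [map_sum, map_mul] at h1
  simp only [rtr_apply, bond_last, Matrix.one_apply, snoc_inj_iff, scal, Matrix.map_apply]
  by_cases huv : u = v
  · simp only [huv, if_true, true_and, Algebra.smul_def, h1]
    split_ifs <;> simp
  · simp [huv]

/-- `Tr_{(2)} (D₂ X Z₁ Y) = Tr (D Z)` for matrices `X`, `Y` on `V ⊗ V` and all `Z`, in terms of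
matrix entries. -/
def TraceConj (D : Matrix (Fin n) (Fin n) ℂ) (X Y : Matrix (Fin n × Fin n) (Fin n × Fin n) ℂ) :
    Prop :=
  ∀ c c' x z, ∑ a, ∑ b, ∑ y, D a b * X (c, b) (x, y) * Y (z, y) (c', a) =
    if c = c' then D z x else 0

theorem rtr_conj_apply (X Y : Matrix (Fin n × Fin n) (Fin n × Fin n) ℂ)
    (Z : Matrix (Fin (m + 1) → Fin n) (Fin (m + 1) → Fin n) A) (u v : Fin m → Fin n)
    (c c' : Fin n) :
    rtr D (bond (m + 2) m (scal A X) * up Z * bond (m + 2) m (scal A Y))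
      (Fin.snoc (α := fun _ => Fin n) u c) (Fin.snoc (α := fun _ => Fin n) v c') =
    ∑ z, ∑ x, (∑ a, ∑ b, ∑ y, D a b * X (c, b) (x, y) * Y (z, y) (c', a)) •
      Z (Fin.snoc (α := fun _ => Fin n) u x) (Fin.snoc (α := fun _ => Fin n) v z) := by
  simp only [rtr_apply, mul_bond_last_apply, bond_last_mul_apply, up_snoc, smul_ite, smul_zero,
    Finset.sum_ite_eq', Finset.mem_univ, if_true, Finset.smul_sum, Finset.sum_smul]
  refine (Finset.sum_congr rfl fun a _ => Finset.sum_comm).trans (Finset.sum_comm.trans ?_)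
  refine Finset.sum_congr rfl fun z _ => ?_
  refine (Finset.sum_congr rfl fun a _ => (Finset.sum_congr rfl fun b _ =>
    Finset.sum_comm).trans Finset.sum_comm).trans (Finset.sum_comm.trans ?_)
  refine Finset.sum_congr rfl fun x _ => Finset.sum_congr rfl fun a _ =>
    Finset.sum_congr rfl fun b _ => Finset.sum_congr rfl fun y _ => ?_
  rw [smul_smul, smul_smul]
  congr 1
  ring

theorem TraceConj.rtr_conj {X Y : Matrix (Fin n × Fin n) (Fin n × Fin n) ℂ} (h : TraceConj D X Y)
    (Z : Matrix (Fin (m + 1) → Fin n) (Fin (m + 1) → Fin n) A) :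
    rtr D (bond (m + 2) m (scal A X) * up Z * bond (m + 2) m (scal A Y)) = up (rtr D Z) := by
  refine matrix_ext_snoc fun u v c c' => ?_
  rw [rtr_conj_apply, up_snoc, rtr_apply]
  by_cases hc : c = c' <;> simp [h _ _ _ _, hc]

/-- Cyclicity of the double trace for a matrix `R` commuting with `D ⊗ D`. -/
theorem rtr_rtr_comm {R : Matrix (Fin n × Fin n) (Fin n × Fin n) ℂ}
    (h : Matrix.kronecker D D * R = R * Matrix.kronecker D D)
    (Z : Matrix (Fin (m + 2) → Fin n) (Fin (m + 2) → Fin n) A) :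
    rtr D (rtr D (bond (m + 2) m (scal A R) * Z)) =
      rtr D (rtr D (Z * bond (m + 2) m (scal A R))) := by
  ext u v
  simp only [rtr_apply, mul_bond_last_apply, bond_last_mul_apply]
  trans ∑ a, ∑ b, ∑ c, ∑ d, (Matrix.kronecker D D * R) (a, b) (c, d) •
        Z (Fin.snoc (α := fun _ => Fin n)
            (Fin.snoc (α := fun _ => Fin n) u c : Fin (m + 1) → Fin n) d)
          (Fin.snoc (α := fun _ => Fin n)
            (Fin.snoc (α := fun _ => Fin n) v a : Fin (m + 1) → Fin n) b)
  · simp only [Matrix.mul_apply, Fintype.sum_prod_type, Matrix.kronecker,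
      Matrix.kroneckerMap_apply, Finset.smul_sum, Finset.sum_smul]
    refine Finset.sum_congr rfl fun a _ => Finset.sum_comm.trans ?_
    refine Finset.sum_congr rfl fun b _ => ?_
    -- the summation variables `e`, `f`, `c`, `d` are brought to the order `c`, `d`, `e`, `f`
    refine (Finset.sum_congr rfl fun e _ => Finset.sum_comm.trans (Finset.sum_congr rfl fun c _ =>
      Finset.sum_comm)).trans (Finset.sum_comm.trans (Finset.sum_congr rfl fun c _ =>
      Finset.sum_comm.trans ?_))
    refine Finset.sum_congr rfl fun d _ => Finset.sum_congr rfl fun e _ =>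
      Finset.sum_congr rfl fun f _ => ?_
    rw [smul_smul, smul_smul, mul_assoc]
  · rw [h]
    simp only [Matrix.mul_apply, Fintype.sum_prod_type, Matrix.kronecker,
      Matrix.kroneckerMap_apply, Finset.smul_sum, Finset.sum_smul]
    have front : ∀ G : Fin n → Fin n → Fin n → Fin n → Fin n → A,
        ∑ e, ∑ c, ∑ f, ∑ d, ∑ a, G e c f d a = ∑ a, ∑ e, ∑ c, ∑ f, ∑ d, G e c f d a := fun G =>
      (Finset.sum_congr rfl fun e _ => (Finset.sum_congr rfl fun c _ =>
        (Finset.sum_congr rfl fun f _ => Finset.sum_comm).trans Finset.sum_comm).trans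
          Finset.sum_comm).trans Finset.sum_comm
    conv_rhs => rw [front]
    refine Finset.sum_congr rfl fun a _ => ?_
    conv_rhs => rw [front]
    refine Finset.sum_congr rfl fun b _ => ?_
    refine Eq.trans ?_ (Finset.sum_comm.trans (Finset.sum_congr rfl fun c _ =>
      (Finset.sum_congr rfl fun e _ => Finset.sum_comm).trans Finset.sum_comm)).symm
    refine Finset.sum_congr rfl fun c _ => Finset.sum_congr rfl fun d _ =>
      Finset.sum_congr rfl fun e _ => Finset.sum_congr rfl fun f _ => ?_
    rw [smul_smul, smul_smul]
    congr 1
    ring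

end rtr

end Ring

end Tower

/-! ### Copies of a reflection equation matrix in a braid group representation -/

section Affine

variable {H : Type*} [Ring H]

/-- The elements `g 0, …, g (N - 1)`, with inverses `gi i`, satisfy the braid relations. -/
structure IsBraidFamily (g gi : ℕ → H) (N : ℕ) : Prop where
  mul_inv : ∀ i, i < N → g i * gi i = 1
  inv_mul : ∀ i, i < N → gi i * g i = 1
  braid : ∀ i, i + 1 < N → g i * g (i + 1) * g i = g (i + 1) * g i * g (i + 1)
  far : ∀ i j, i + 1 < j → j < N → Commute (g i) (g j)

/-- The element `g 0 * g 1 * ⋯ * g (k - 1)`. -/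
def chain (g : ℕ → H) : ℕ → H
  | 0 => 1
  | k + 1 => chain g k * g k

/-- The element `gi (k - 1) * ⋯ * gi 1 * gi 0`. -/
def chainInv (gi : ℕ → H) : ℕ → H
  | 0 => 1
  | k + 1 => gi k * chainInv gi k

/-- The copies `ℓ_0 = ℓ`, `ℓ_{i+1} = g_i ℓ_i g_i⁻¹`. -/
def copy (g gi : ℕ → H) (l : H) : ℕ → H
  | 0 => l
  | i + 1 => g i * copy g gi l i * gi i

variable {g gi : ℕ → H} {N : ℕ} {l : H}

theorem chain_congr {g' : ℕ → H} {k : ℕ} (h : ∀ i, i < k → g i = g' i) : chain g k = chain g' k := by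
  induction k with
  | zero => rfl
  | succ k ih => rw [chain, chain, ih fun i hi => h i (by omega), h k (by omega)]

theorem chainInv_congr {g' : ℕ → H} {k : ℕ} (h : ∀ i, i < k → g i = g' i) :
    chainInv g k = chainInv g' k := by
  induction k with
  | zero => rfl
  | succ k ih => rw [chainInv, chainInv, ih fun i hi => h i (by omega), h k (by omega)]

theorem map_chain {H' : Type*} [Ring H'] (f : H →+* H') (k : ℕ) :
    f (chain g k) = chain (fun i => f (g i)) k := by
  induction k with
  | zero => exact map_one f
  | succ k ih => rw [chain, chain, map_mul, ih]

theorem map_chainInv {H' : Type*} [Ring H'] (f : H →+* H') (k : ℕ) :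
    f (chainInv g k) = chainInv (fun i => f (g i)) k := by
  induction k with
  | zero => exact map_one f
  | succ k ih => rw [chainInv, chainInv, map_mul, ih]

theorem Commute.chain_right {x : H} {k : ℕ} (h : ∀ i, i < k → Commute x (g i)) :
    Commute x (chain g k) := by
  induction k with
  | zero => exact Commute.one_right x
  | succ k ih => exact (ih fun i hi => h i (by omega)).mul_right (h k (by omega))

theorem commute_of_mul_eq_one {x a b : H} (hab : a * b = 1) (hba : b * a = 1) (h : Commute x a) :
    Commute x b := by
  calc x * b = b * a * x * b := by rw [hba, one_mul]
    _ = b * (x * a) * b := by rw [mul_assoc b, ← h.eq]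
    _ = b * x := by rw [mul_assoc, mul_assoc x, hab, mul_one]

theorem IsBraidFamily.chain_mul_chainInv (h : IsBraidFamily g gi N) {k : ℕ} (hk : k ≤ N) :
    chain g k * chainInv gi k = 1 := by
  induction k with
  | zero => exact one_mul 1
  | succ k ih =>
    rw [chain, chainInv, mul_assoc, ← mul_assoc (g k), h.mul_inv k (by omega), one_mul,
      ih (by omega)]

theorem IsBraidFamily.chainInv_mul_chain (h : IsBraidFamily g gi N) {k : ℕ} (hk : k ≤ N) :
    chainInv gi k * chain g k = 1 := by
  induction k with
  | zero => exact one_mul 1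
  | succ k ih =>
    rw [chain, chainInv, mul_assoc, ← mul_assoc (chainInv gi k), ih (by omega), one_mul,
      h.inv_mul k (by omega)]

/-- Conjugation by `g₀ ⋯ g_{k-1}` moves the generators one step to the right. -/
theorem IsBraidFamily.chain_mul (h : IsBraidFamily g gi N) {i k : ℕ} (hi : i + 1 < k) (hk : k ≤ N) :
    chain g k * g i = g (i + 1) * chain g k := by
  induction k with
  | zero => omega
  | succ k ih =>
    rcases Nat.lt_or_ge (i + 1) k with h1 | h1
    · rw [chain, mul_assoc, ← (h.far i k h1 (by omega)).eq, ← mul_assoc, ih h1 (by omega),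
        mul_assoc]
    · obtain rfl : k = i + 1 := by omega
      have hc : Commute (g (i + 1)) (chain g i) :=
        Commute.chain_right fun j hj => (h.far j (i + 1) (by omega) (by omega)).symm
      calc chain g (i + 1 + 1) * g i = chain g i * (g i * g (i + 1) * g i) := by
            rw [chain, chain]; noncomm_ring
        _ = chain g i * g (i + 1) * (g i * g (i + 1)) := by
            rw [h.braid i (by omega)]; noncomm_ring
        _ = g (i + 1) * chain g (i + 1 + 1) := by
            rw [← hc.eq, chain, chain]; noncomm_ring

theorem IsBraidFamily.copy_commute_of_lt (h : IsBraidFamily g gi N)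
    (hl : ∀ i, 1 ≤ i → i < N → Commute l (g i)) {i j : ℕ} (hij : j < i) (hi : i < N) :
    Commute (copy g gi l j) (g i) := by
  induction j with
  | zero => exact hl i hij hi
  | succ j ih =>
    have h1 := h.far j i hij hi
    have h2 := (commute_of_mul_eq_one (h.mul_inv j (by omega)) (h.inv_mul j (by omega)) h1.symm).symm
    exact (h1.mul_left (ih (by omega))).mul_left h2

theorem IsBraidFamily.copy_commute_of_gt (h : IsBraidFamily g gi N)
    (hl : ∀ i, 1 ≤ i → i < N → Commute l (g i)) {i j : ℕ} (hij : i + 1 < j) (hj : j ≤ N) :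
    Commute (copy g gi l j) (g i) := by
  induction j with
  | zero => omega
  | succ j ih =>
    rcases Nat.lt_or_ge (i + 1) j with h1 | h1
    · have h2 := (h.far i j h1 (by omega)).symm
      have h3 := (commute_of_mul_eq_one (h.mul_inv j (by omega)) (h.inv_mul j (by omega))
        h2.symm).symm
      exact (h2.mul_left (ih h1 (by omega))).mul_left h3
    · obtain rfl : j = i + 1 := by omega
      have hc := h.copy_commute_of_lt hl (show i < i + 1 by omega) (by omega)
      have hb := h.braid i (by omega)
      have hbi : g i * gi (i + 1) * gi i = gi (i + 1) * gi i * g (i + 1) := by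
        have e1 := h.mul_inv i (by omega)
        have e2 := h.inv_mul (i + 1) (by omega)
        calc g i * gi (i + 1) * gi i = gi (i + 1) * g (i + 1) * g i * gi (i + 1) * gi i := by
              rw [e2, one_mul]
          _ = gi (i + 1) * gi i * (g i * g (i + 1) * g i) * gi (i + 1) * gi i := by
              have := h.inv_mul i (by omega)
              simp only [mul_assoc]
              rw [← mul_assoc (gi i) (g i), this, one_mul]
          _ = gi (i + 1) * gi i * g (i + 1) * (g i * (g (i + 1) * gi (i + 1)) * gi i) := by
              rw [hb]; noncomm_ring
          _ = gi (i + 1) * gi i * g (i + 1) := by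
              rw [h.mul_inv (i + 1) (by omega), mul_one, e1, mul_one]
      have hbi' : gi i * gi (i + 1) * g i = g (i + 1) * gi i * gi (i + 1) := by
        have e1 := h.mul_inv i (by omega)
        have e1' := h.inv_mul i (by omega)
        have e2 := h.mul_inv (i + 1) (by omega)
        have e2' := h.inv_mul (i + 1) (by omega)
        calc gi i * gi (i + 1) * g i
            = gi i * gi (i + 1) * (g i * g (i + 1) * g i) * gi i * gi (i + 1) := by
              simp only [mul_assoc]
              rw [← mul_assoc (g i) (gi i), e1, one_mul, e2, mul_one]
          _ = gi i * (gi (i + 1) * g (i + 1)) * g i * g (i + 1) * gi i * gi (i + 1) := by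
              rw [hb]; noncomm_ring
          _ = g (i + 1) * gi i * gi (i + 1) := by rw [e2', mul_one, e1', one_mul]
      show g (i + 1) * (g i * copy g gi l i * gi i) * gi (i + 1) * g i =
        g i * (g (i + 1) * (g i * copy g gi l i * gi i) * gi (i + 1))
      calc g (i + 1) * (g i * copy g gi l i * gi i) * gi (i + 1) * g i
          = g (i + 1) * g i * copy g gi l i * (gi i * gi (i + 1) * g i) := by noncomm_ring
        _ = g (i + 1) * g i * (copy g gi l i * g (i + 1)) * (gi i * gi (i + 1)) := by
            rw [hbi']; noncomm_ring
        _ = (g (i + 1) * g i * g (i + 1)) * copy g gi l i * (gi i * gi (i + 1)) := by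
            rw [hc.eq]; noncomm_ring
        _ = _ := by rw [← hb]; noncomm_ring

/-- Conjugation by `g₀ ⋯ g_{k-1}` moves the copies one step to the right. -/
theorem IsBraidFamily.chain_mul_copy (h : IsBraidFamily g gi N)
    (hl : ∀ i, 1 ≤ i → i < N → Commute l (g i)) {i k : ℕ} (hi : i < k) (hk : k ≤ N) :
    chain g k * copy g gi l i = copy g gi l (i + 1) * chain g k := by
  induction k with
  | zero => omega
  | succ k ih =>
    rcases Nat.lt_or_ge i k with h1 | h1
    · rw [chain, mul_assoc, ← (h.copy_commute_of_lt hl h1 (by omega)).eq, ← mul_assoc,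
        ih h1 (by omega), mul_assoc]
    · obtain rfl : k = i := by omega
      have hc : Commute (copy g gi l (k + 1)) (chain g k) :=
        Commute.chain_right fun j hj => h.copy_commute_of_gt hl (by omega) hk
      rw [chain, ← mul_assoc, hc.eq, mul_assoc, mul_assoc]
      congr 1
      rw [copy, mul_assoc, h.inv_mul k (by omega), mul_one]

theorem IsBraidFamily.copy_mul_copy (h : IsBraidFamily g gi N)
    (hl : ∀ i, 1 ≤ i → i < N → Commute l (g i)) (hre : g 0 * l * g 0 * l = l * g 0 * l * g 0)
    {i : ℕ} (hi : i < N) :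
    Commute (g i) (copy g gi l i * copy g gi l (i + 1)) := by
  induction i with
  | zero =>
    show g 0 * (l * (g 0 * l * gi 0)) = l * (g 0 * l * gi 0) * g 0
    calc g 0 * (l * (g 0 * l * gi 0)) = (g 0 * l * g 0 * l) * gi 0 := by noncomm_ring
      _ = l * g 0 * l * (g 0 * gi 0) := by rw [hre]; noncomm_ring
      _ = l * g 0 * l * (gi 0 * g 0) := by rw [h.mul_inv 0 hi, h.inv_mul 0 hi]
      _ = _ := by noncomm_ring
  | succ i ih =>
    -- conjugation by `g₀ ⋯ g_{i+1}` carries the relation for `i` to the one for `i + 1`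
    have ih := ih (by omega)
    have e1 := h.chain_mul (show i + 1 < i + 2 by omega) (show i + 2 ≤ N by omega)
    have e2 := h.chain_mul_copy hl (show i < i + 2 by omega) (show i + 2 ≤ N by omega)
    have e3 := h.chain_mul_copy hl (show i + 1 < i + 2 by omega) (show i + 2 ≤ N by omega)
    have e4 := h.chain_mul_chainInv (show i + 2 ≤ N by omega)
    set u := chain g (i + 2)
    have key : g (i + 1) * (copy g gi l (i + 1) * copy g gi l (i + 1 + 1)) * u =
        copy g gi l (i + 1) * copy g gi l (i + 1 + 1) * g (i + 1) * u := by
      calc _ = u * (g i * (copy g gi l i * copy g gi l (i + 1))) := by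
            rw [mul_assoc, mul_assoc, ← e3, ← mul_assoc (copy g gi l (i + 1)), ← e2, ← mul_assoc,
              ← mul_assoc, ← e1]
            noncomm_ring
        _ = _ := by
            rw [ih.eq, ← mul_assoc, ← mul_assoc, e2, mul_assoc _ u, e3, mul_assoc _ _ (g i),
              mul_assoc _ u, e1]
            noncomm_ring
    have := congrArg (· * chainInv gi (i + 2)) key
    simpa only [mul_assoc, e4, mul_one, Commute, SemiconjBy] using this

/-- The product of the first `k` copies commutes with the first `k - 1` generators. -/
theorem IsBraidFamily.commute_prod_copy (h : IsBraidFamily g gi N)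
    (hl : ∀ i, 1 ≤ i → i < N → Commute l (g i)) (hre : g 0 * l * g 0 * l = l * g 0 * l * g 0)
    {i k : ℕ} (hi : i + 1 < k) (hk : k ≤ N + 1) :
    Commute (g i) ((List.range k).map (copy g gi l)).prod := by
  induction k with
  | zero => omega
  | succ k ih =>
    rcases Nat.lt_or_ge (i + 1) k with h1 | h1
    · rw [List.prod_range_succ]
      exact (ih h1 (by omega)).mul_right (h.copy_commute_of_gt hl h1 (by omega)).symm
    · obtain rfl : k = i + 1 := by omega
      rw [List.prod_range_succ, List.prod_range_succ, mul_assoc]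
      refine Commute.mul_right ?_ (h.copy_mul_copy hl hre (by omega))
      have : ∀ j, j ≤ i → Commute (g i) ((List.range j).map (copy g gi l)).prod := by
        intro j
        induction j with
        | zero => intro; simp
        | succ j ihj =>
          intro hj
          rw [List.prod_range_succ]
          exact (ihj (by omega)).mul_right (h.copy_commute_of_lt hl (by omega) (by omega)).symm
      exact this i le_rfl

theorem IsBraidFamily.chain_mul_prod_copy (h : IsBraidFamily g gi N)
    (hl : ∀ i, 1 ≤ i → i < N → Commute l (g i)) {j k : ℕ} (hj : j ≤ k) (hk : k ≤ N) :
    chain g k * ((List.range j).map (copy g gi l)).prod =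
      ((List.range j).map fun i => copy g gi l (i + 1)).prod * chain g k := by
  induction j with
  | zero => simp
  | succ j ih =>
    rw [List.prod_range_succ, List.prod_range_succ, ← mul_assoc, ih (by omega), mul_assoc,
      h.chain_mul_copy hl (by omega) hk, mul_assoc]

theorem asym_conj_chain [Algebra ℂ H] (h : IsBraidFamily g gi N) (q : ℂ) {k : ℕ} (hk : k ≤ N)
    (j : ℕ) (hj : j ≤ k) :
    chain g k * asym q g j * chainInv gi k = asym q (fun i => g (i + 1)) j := by
  have e1 := h.chain_mul_chainInv hk
  have e2 := h.chainInv_mul_chain hk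
  let f : H ≃ₐ[ℂ] H := innerAut ⟨chain g k, chainInv gi k, e1, e2⟩
  have : ∀ x, f x = chain g k * x * chainInv gi k := fun x => rfl
  rw [← this]
  rw [show f (asym q g j) = asym q (fun i => f (g i)) j from map_asym (f : H →ₐ[ℂ] H) q g j]
  refine asym_congr fun i hi => ?_
  rw [this, h.chain_mul (by omega) hk, mul_assoc, e1, mul_one]

end Affine

/-! ### The quantum trace of a skew-invertible R-matrix -/

section QuantumTrace

variable {n : ℕ} {R Psi : Matrix (Fin n × Fin n) (Fin n × Fin n) ℂ}

/-- Skew invertibility solves linear equations whose coefficients are the entries of `R`. -/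
theorem skew_solve (hright : ∀ a d c e : Fin n,
      ∑ b, ∑ b', Psi (a, b) (c, b') * R (b', d) (b, e) = flipMat n (a, d) (c, e))
    {W rhs : Fin n → Fin n → ℂ} (h : ∀ c x, ∑ b, ∑ y, R (c, b) (x, y) * W y b = rhs c x)
    (p r : Fin n) : W p r = ∑ x, ∑ c, Psi (p, x) (r, c) * rhs c x := by
  calc W p r = ∑ b, ∑ y, flipMat n (p, b) (r, y) * W y b := by
        simp only [flipMat, Matrix.of_apply, Prod.swap_prod_mk, Prod.mk.injEq, ite_and, ite_mul,
          one_mul, zero_mul]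
        simp
    _ = ∑ b, ∑ y, ∑ x, ∑ c, Psi (p, x) (r, c) * (R (c, b) (x, y) * W y b) := by
        simp only [← hright, Finset.sum_mul, mul_assoc]
    _ = _ := by
        simp only [← h, Finset.mul_sum]
        -- the summation variables `b`, `y` are moved behind `x`, `c`
        refine (Finset.sum_congr rfl fun b _ => Finset.sum_comm.trans (Finset.sum_congr rfl
          fun x _ => Finset.sum_comm)).trans (Finset.sum_comm.trans (Finset.sum_congr rfl
          fun x _ => Finset.sum_comm))

theorem trace_one_of_skew (hleft : ∀ a d c e : Fin n,
      ∑ b, ∑ b', R (a, b) (c, b') * Psi (b', d) (b, e) = flipMat n (a, d) (c, e)) (a c : Fin n) :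
    ∑ b, ∑ b', ptr2 Psi b b' * R (a, b') (c, b) = if a = c then 1 else 0 := by
  calc ∑ b, ∑ b', ptr2 Psi b b' * R (a, b') (c, b)
      = ∑ d, ∑ b, ∑ b', R (a, b) (c, b') * Psi (b', d) (b, d) := by
        simp only [ptr2, Matrix.of_apply, Finset.sum_mul]
        refine Finset.sum_comm.trans ((Finset.sum_congr rfl fun b _ => Finset.sum_comm).trans
          (Finset.sum_comm.trans ?_))
        simp only [mul_comm]
    _ = ∑ d, flipMat n (a, d) (c, d) := by simp only [hleft]
    _ = _ := by
        simp only [flipMat, Matrix.of_apply, Prod.swap_prod_mk, Prod.mk.injEq, ite_and]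
        rw [Finset.sum_ite_eq]
        simp

/-- It suffices to check `TraceConj` on the partial matrices of `R`, that is, for the matrix `R` in
place of `Z`, because these span all matrices. -/
theorem traceConj_of_rtr (hright : ∀ a d c e : Fin n,
      ∑ b, ∑ b', Psi (a, b) (c, b') * R (b', d) (b, e) = flipMat n (a, d) (c, e))
    {X Y : Matrix (Fin n × Fin n) (Fin n × Fin n) ℂ}
    (h : rtr (ptr2 Psi) (bond 3 1 X * up (bond 2 0 R) * bond 3 1 Y) = 1) :
    TraceConj (ptr2 Psi) X Y := by
  intro c c' x z
  have hs : ∀ Z : Matrix (Fin n × Fin n) (Fin n × Fin n) ℂ, scal ℂ Z = Z := fun Z => by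
    ext; simp [scal]
  have e : ∀ p r, ∑ x, ∑ z, R (p, x) (r, z) * (∑ a, ∑ b, ∑ y,
      ptr2 Psi a b * X (c, b) (x, y) * Y (z, y) (c', a)) =
      if p = r then (if c = c' then 1 else 0) else 0 := by
    intro p r
    have h1 := congrFun (congrFun h (Fin.snoc (α := fun _ => Fin n)
      (Fin.snoc (α := fun _ => Fin n) default p : Fin 1 → Fin n) c))
      (Fin.snoc (α := fun _ => Fin n)
      (Fin.snoc (α := fun _ => Fin n) default r : Fin 1 → Fin n) c')
    rw [← hs X, ← hs Y, rtr_conj_apply, Matrix.one_apply] at h1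
    simp only [snoc_inj_iff, true_and, bond_last, if_true, smul_eq_mul] at h1
    rw [← ite_and, ← h1, Finset.sum_comm]
    simp only [mul_comm]
  have := skew_solve hright (W := fun z x => ∑ a, ∑ b, ∑ y,
      ptr2 Psi a b * X (c, b) (x, y) * Y (z, y) (c', a)) e z x
  refine this.trans ?_
  simp only [mul_ite, mul_zero, mul_one, Finset.sum_ite_eq', Finset.mem_univ, if_true]
  split_ifs <;> simp [ptr2]

theorem bond_mul_inv (hdet : IsUnit R.det) {m i : ℕ} (hi : i + 1 < m) :
    bond m i R * bond m i R⁻¹ = 1 := by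
  rw [← bond_mul hi, Matrix.mul_nonsing_inv R hdet, bond_one hi]

theorem bond_inv_mul (hdet : IsUnit R.det) {m i : ℕ} (hi : i + 1 < m) :
    bond m i R⁻¹ * bond m i R = 1 := by
  rw [← bond_mul hi, Matrix.nonsing_inv_mul R hdet, bond_one hi]

theorem rtr_bond_last_complex (hleft : ∀ a d c e : Fin n,
      ∑ b, ∑ b', R (a, b) (c, b') * Psi (b', d) (b, e) = flipMat n (a, d) (c, e)) :
    rtr (ptr2 Psi) (bond 3 1 R) = 1 := by
  have := rtr_bond_last (A := ℂ) (m := 1) (trace_one_of_skew hleft)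
  rwa [show scal ℂ R = R by ext; simp [scal]] at this

/-- The braid relation turns `R₂⁻¹ R₁ R₂` into `R₁ R₂ R₁⁻¹`, whose trace over the last factor is `1`
because that of `R₂` is. -/
theorem traceConj_inv_self (hdet : IsUnit R.det)
    (hbr : bond 3 0 R * bond 3 1 R * bond 3 0 R = bond 3 1 R * bond 3 0 R * bond 3 1 R)
    (hleft : ∀ a d c e : Fin n,
      ∑ b, ∑ b', R (a, b) (c, b') * Psi (b', d) (b, e) = flipMat n (a, d) (c, e))
    (hright : ∀ a d c e : Fin n,
      ∑ b, ∑ b', Psi (a, b) (c, b') * R (b', d) (b, e) = flipMat n (a, d) (c, e)) :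
    TraceConj (ptr2 Psi) R⁻¹ R := by
  refine traceConj_of_rtr hright ?_
  have e : bond 3 1 R⁻¹ * up (bond 2 0 R) * bond 3 1 R =
      up (bond 2 0 R) * bond 3 1 R * up (bond 2 0 R⁻¹) := by
    rw [up_bond (by omega), up_bond (by omega)]
    have h0 := bond_mul_inv hdet (show 0 + 1 < 3 by omega)
    have h1 := bond_inv_mul hdet (show 1 + 1 < 3 by omega)
    calc _ = bond 3 1 R⁻¹ * (bond 3 0 R * bond 3 1 R * bond 3 0 R) * bond 3 0 R⁻¹ := by
          simp only [mul_assoc, h0, mul_one]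
      _ = (bond 3 1 R⁻¹ * bond 3 1 R) * bond 3 0 R * bond 3 1 R * bond 3 0 R⁻¹ := by
          rw [hbr]; noncomm_ring
      _ = _ := by rw [h1, one_mul]
  rw [e, rtr_mul_up, rtr_up_mul, rtr_bond_last_complex hleft, mul_one, bond_mul_inv hdet (by omega)]

theorem traceConj_self_inv (hdet : IsUnit R.det)
    (hbr : bond 3 0 R * bond 3 1 R * bond 3 0 R = bond 3 1 R * bond 3 0 R * bond 3 1 R)
    (hleft : ∀ a d c e : Fin n,
      ∑ b, ∑ b', R (a, b) (c, b') * Psi (b', d) (b, e) = flipMat n (a, d) (c, e))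
    (hright : ∀ a d c e : Fin n,
      ∑ b, ∑ b', Psi (a, b) (c, b') * R (b', d) (b, e) = flipMat n (a, d) (c, e)) :
    TraceConj (ptr2 Psi) R R⁻¹ := by
  refine traceConj_of_rtr hright ?_
  have e : bond 3 1 R * up (bond 2 0 R) * bond 3 1 R⁻¹ =
      up (bond 2 0 R⁻¹) * bond 3 1 R * up (bond 2 0 R) := by
    rw [up_bond (by omega), up_bond (by omega)]
    have h0 := bond_inv_mul hdet (show 0 + 1 < 3 by omega)
    have h1 := bond_mul_inv hdet (show 1 + 1 < 3 by omega)
    calc _ = (bond 3 0 R⁻¹ * bond 3 0 R) * bond 3 1 R * bond 3 0 R * bond 3 1 R⁻¹ := by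
          rw [h0, one_mul]
      _ = bond 3 0 R⁻¹ * (bond 3 1 R * bond 3 0 R * bond 3 1 R) * bond 3 1 R⁻¹ := by
          rw [← hbr]; noncomm_ring
      _ = _ := by simp only [mul_assoc, h1, mul_one]
  rw [e, rtr_mul_up, rtr_up_mul, rtr_bond_last_complex hleft, mul_one, bond_inv_mul hdet (by omega)]

/-- `R` commutes with `D ⊗ D`: by `TraceConj` both `(D ⊗ D) R⁻¹` and `R⁻¹ (D ⊗ D)` have the entries
`∑ D Ψ D`. -/
theorem kronecker_commute (hdet : IsUnit R.det)
    (hbr : bond 3 0 R * bond 3 1 R * bond 3 0 R = bond 3 1 R * bond 3 0 R * bond 3 1 R)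
    (hleft : ∀ a d c e : Fin n,
      ∑ b, ∑ b', R (a, b) (c, b') * Psi (b', d) (b, e) = flipMat n (a, d) (c, e))
    (hright : ∀ a d c e : Fin n,
      ∑ b, ∑ b', Psi (a, b) (c, b') * R (b', d) (b, e) = flipMat n (a, d) (c, e)) :
    Matrix.kronecker (ptr2 Psi) (ptr2 Psi) * R = R * Matrix.kronecker (ptr2 Psi) (ptr2 Psi) := by
  have t1 := traceConj_inv_self hdet hbr hleft hright
  have t2 := traceConj_self_inv hdet hbr hleft hright
  set D := ptr2 Psi
  have v : ∀ p c x r, ∑ b, D p b * R⁻¹ (c, b) (x, r) = ∑ z, Psi (p, c) (r, z) * D z x := by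
    intro p c x r
    have := skew_solve hright (W := fun a y => ∑ b, D a b * R⁻¹ (c, b) (x, y))
      (rhs := fun z c' => if c = c' then D z x else 0) (fun z c' => by
        rw [← t1 c c' x z, Finset.sum_comm]
        refine Finset.sum_congr rfl fun a _ => ?_
        simp only [Finset.mul_sum]
        rw [Finset.sum_comm]
        refine Finset.sum_congr rfl fun b _ => Finset.sum_congr rfl fun y _ => ?_
        ring) p r
    refine this.trans ?_
    rw [Finset.sum_comm]
    simp
  have w : ∀ z p c' r, ∑ a, R⁻¹ (z, p) (c', a) * D a r = ∑ x, D z x * Psi (p, x) (r, c') := by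
    intro z p c' r
    have := skew_solve hright (W := fun y b => ∑ a, R⁻¹ (z, y) (c', a) * D a b)
      (rhs := fun c x => if c = c' then D z x else 0) (fun c x => by
        rw [← t2 c c' x z]
        simp only [Finset.mul_sum]
        refine Eq.trans ?_ (Finset.sum_comm.trans (Finset.sum_congr rfl fun b _ =>
          Finset.sum_comm)).symm
        refine Finset.sum_congr rfl fun b _ => Finset.sum_congr rfl fun y _ =>
          Finset.sum_congr rfl fun a _ => ?_
        ring) p r
    refine this.trans ?_
    simp [mul_comm]
  have key : Matrix.kronecker D D * R⁻¹ = R⁻¹ * Matrix.kronecker D D := by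
    ext ⟨s, p⟩ ⟨x, r⟩
    simp only [Matrix.mul_apply, Fintype.sum_prod_type, Matrix.kronecker, Matrix.kroneckerMap_apply]
    trans ∑ c, ∑ z, D s c * Psi (p, c) (r, z) * D z x
    · refine Finset.sum_congr rfl fun c _ => ?_
      simp only [mul_assoc, ← Finset.mul_sum, v]
    · rw [Finset.sum_comm]
      refine Finset.sum_congr rfl fun z _ => ?_
      rw [← Finset.sum_mul, ← w, Finset.sum_mul]
      refine Finset.sum_congr rfl fun a _ => ?_
      ring
  calc _ = (R * R⁻¹) * Matrix.kronecker D D * R := by rw [Matrix.mul_nonsing_inv R hdet, one_mul]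
    _ = R * Matrix.kronecker D D * (R⁻¹ * R) := by rw [mul_assoc R, ← key]; noncomm_ring
    _ = _ := by rw [Matrix.nonsing_inv_mul R hdet, mul_one]

end QuantumTrace

/-! ### R-matrices to which the Cayley–Hamilton theorem applies -/

section CharData

variable {n : ℕ}

/-- The properties of an R-matrix `R` and of the matrix `D` of its quantum trace on which the
Cayley–Hamilton theorem rests. In `gl_left` the antisymmetrizer acts in the last `n` factors of
`V^{⊗ (n+1)}`. -/
structure IsCharData (n : ℕ) (q : ℂ) (R : Matrix (Fin n × Fin n) (Fin n × Fin n) ℂ)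
    (D : Matrix (Fin n) (Fin n) ℂ) : Prop where
  q_ne_zero : q ≠ 0
  det : IsUnit R.det
  braid : bond 3 0 R * bond 3 1 R * bond 3 0 R = bond 3 1 R * bond 3 0 R * bond 3 1 R
  hecke : (R - q • (1 : Matrix (Fin n × Fin n) (Fin n × Fin n) ℂ)) *
    (R + q⁻¹ • (1 : Matrix (Fin n × Fin n) (Fin n × Fin n) ℂ)) = 0
  qnum_ne_zero : ∀ i : ℕ, 2 ≤ i → i ≤ n → qnum q i ≠ 0
  trace_one : ∀ a c, ∑ b, ∑ b', D b b' * R (a, b') (c, b) = if a = c then 1 else 0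
  conj : TraceConj D R R⁻¹
  comm : Matrix.kronecker D D * R = R * Matrix.kronecker D D
  gl_left : q ^ n • asym q (fun i => bond (n + 1) (i + 1) R) n -
    qnum q n • (asym q (fun i => bond (n + 1) (i + 1) R) n * bond (n + 1) 0 R *
      asym q (fun i => bond (n + 1) (i + 1) R) n) = 0

theorem isBraidFamily_bond {R : Matrix (Fin n × Fin n) (Fin n × Fin n) ℂ} (hdet : IsUnit R.det)
    (hbr : bond 3 0 R * bond 3 1 R * bond 3 0 R = bond 3 1 R * bond 3 0 R * bond 3 1 R) (m : ℕ) :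
    IsBraidFamily (fun i => bond m i R) (fun i => bond m i R⁻¹) (m - 1) :=
  ⟨fun i hi => bond_mul_inv hdet (by omega), fun i hi => bond_inv_mul hdet (by omega),
    fun i hi => bond_braid hbr (by omega), fun i j hi hj => bond_far R R hi (by omega)⟩

theorem eq_zero_of_idempotent_of_trace {ι : Type*} [Fintype ι] [DecidableEq ι] {X : Matrix ι ι ℂ}
    (h : X * X = X) (ht : X.trace = 0) : X = 0 := by
  have h1 : IsIdempotentElem (Matrix.toLin' X) := by
    show Matrix.toLin' X * Matrix.toLin' X = Matrix.toLin' X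
    rw [Module.End.mul_eq_comp, ← Matrix.toLin'_mul, h]
  have h2 : LinearMap.trace ℂ (ι → ℂ) (Matrix.toLin' X) = 0 := by
    rw [Matrix.trace_toLin'_eq, ht]
  have := (LinearMap.IsIdempotentElem.trace_eq_zero_iff h1).1 h2
  exact (LinearEquiv.map_eq_zero_iff Matrix.toLin').1 this

theorem gl_right_of_isSLType {q : ℂ} (hq : q ≠ 0) (hn : 1 ≤ n)
    {R Psi : Matrix (Fin n × Fin n) (Fin n × Fin n) ℂ} (h : IsSLType n q R Psi) :
    q ^ n • asym q (fun i => bond (n + 1) i R) n -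
      qnum q n • (asym q (fun i => bond (n + 1) i R) n * bond (n + 1) (n - 1) R *
        asym q (fun i => bond (n + 1) i R) n) = 0 := by
  have h1 := h.gl_cond
  have hg := isHeckeFamily_bond hq h.braid h.hecke (n + 1)
  have hid := asym_mul_self hq (k := n) (hg.mono (by omega)) h.qnum_ne_zero
  have hqn := qnum_ne_zero_of_le h.qnum_ne_zero hn le_rfl
  rw [antisymIn_eq_asym, mul_sub, sub_mul, mul_smul_comm, mul_one, smul_mul_assoc, hid] at h1
  have h2 := congrArg (qnum q n • ·) h1
  simpa only [smul_sub, smul_smul, mul_div_cancel₀ _ hqn, smul_zero] using h2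

/-- The height condition on the last `n` factors follows from the one on the first `n` factors:
otherwise the two antisymmetrizers `A`, `A'` would have different ranks. -/
theorem gl_left_of_isSLType {q : ℂ} (hq : q ≠ 0) (hn : 1 ≤ n)
    {R Psi : Matrix (Fin n × Fin n) (Fin n × Fin n) ℂ} (h : IsSLType n q R Psi) :
    q ^ n • asym q (fun i => bond (n + 1) (i + 1) R) n -
    qnum q n • (asym q (fun i => bond (n + 1) (i + 1) R) n * bond (n + 1) 0 R *
      asym q (fun i => bond (n + 1) (i + 1) R) n) = 0 := by
  have h1 := gl_right_of_isSLType hq hn h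
  have hne := h.qnum_ne_zero
  obtain _ | _ | k := n
  · omega
  · exact h1
  have hg : IsHeckeFamily q (fun i => bond (k + 2 + 1) i R) (k + 2) :=
    isHeckeFamily_bond hq h.braid h.hecke (k + 2 + 1)
  have hb := isBraidFamily_bond (isUnit_det_of_hecke hq h.hecke) h.braid (k + 2 + 1)
  have hr := asym_gl_right hq hg hne
  have hl := asym_gl_left hq hg hne
  have hid := asym_mul_self hq (k := k + 2) hg.shift hne
  have hconj := asym_conj_chain hb q (k := k + 2) le_rfl (k + 2) le_rfl
  have hinv := hb.chainInv_mul_chain (k := k + 2) le_rfl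
  rw [show k + 2 - 1 = k + 1 from rfl] at h1
  set A := asym q (fun i => bond (k + 2 + 1) i R) (k + 2)
  set A' := asym q (fun i => bond (k + 2 + 1) (i + 1) R) (k + 2)
  have htr : A'.trace = A.trace := by
    rw [← hconj, mul_assoc, Matrix.trace_mul_comm, mul_assoc, hinv, mul_one]
  rw [h1, smul_zero] at hr
  have hr := sub_eq_zero.1 hr.symm
  -- `E` is the part of the projection `A'` on which `A` acts invertibly
  set E := qnum q (k + 2) ^ 2 • (A' * A * A') with hE
  have e1 : E * E = E := by
    calc E * E = (qnum q (k + 2) ^ 2) • (A' * (qnum q (k + 2) ^ 2 • (A * (A' * A') * A)) * A') := by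
          rw [hE]
          simp only [smul_mul_assoc, mul_smul_comm, mul_assoc]
      _ = E := by rw [hid, hr]
  have e2 : E * A' = E := by rw [hE, smul_mul_assoc, mul_assoc _ A' A', hid]
  have e3 : A' * E = E := by
    rw [hE, mul_smul_comm, ← mul_assoc, ← mul_assoc, hid]
  have e4 : E.trace = A'.trace := by
    rw [hE, Matrix.trace_smul, Matrix.trace_mul_comm, ← mul_assoc, hid, htr]
    conv_rhs => rw [← hr]
    rw [Matrix.trace_smul, Matrix.trace_mul_comm (A * A'), ← mul_assoc,
      asym_mul_self hq (k := k + 2) (hg.mono (by omega)) hne, Matrix.trace_mul_comm]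
  have e5 : E - A' = 0 := by
    rw [← neg_sub, neg_eq_zero]
    refine eq_zero_of_idempotent_of_trace ?_ ?_
    · rw [mul_sub, sub_mul, sub_mul, e1, e2, e3, hid]
      abel
    · rw [Matrix.trace_sub, e4, sub_self]
  rw [e5] at hl
  exact (smul_eq_zero.1 hl).resolve_left (qnum_ne_zero_of_le hne (by omega) (by omega))

theorem isCharData_of_isSLType {q : ℂ} (hq : q ≠ 0) (hn : 1 ≤ n)
    {R Psi : Matrix (Fin n × Fin n) (Fin n × Fin n) ℂ} (h : IsSLType n q R Psi) :
    IsCharData n q R (ptr2 Psi) where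
  q_ne_zero := hq
  det := isUnit_det_of_hecke hq h.hecke
  braid := h.braid
  hecke := h.hecke
  qnum_ne_zero := h.qnum_ne_zero
  trace_one := trace_one_of_skew h.skew_left
  conj := traceConj_self_inv (isUnit_det_of_hecke hq h.hecke) h.braid h.skew_left h.skew_right
  comm := kronecker_commute (isUnit_det_of_hecke hq h.hecke) h.braid h.skew_left h.skew_right
  gl_left := gl_left_of_isSLType hq hn h

end CharData

/-! ### The Cayley–Hamilton theorem for reflection equation matrices -/

section CayleyHamilton

variable {n : ℕ} {A : Type*} [Ring A]

theorem up_site {m i : ℕ} (hi : i < m) (X : Matrix (Fin n) (Fin n) A) :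
    up (site m i X) = site (m + 1) i X := by
  refine matrix_ext_snoc fun u v a b => ?_
  rw [up_snoc]
  have key : (∀ j : Fin (m + 1), (j : ℕ) ≠ i →
      Fin.snoc (α := fun _ => Fin n) u a j = Fin.snoc (α := fun _ => Fin n) v b j) ↔
      a = b ∧ ∀ j : Fin m, (j : ℕ) ≠ i → u j = v j := by
    constructor
    · intro h
      refine ⟨by simpa using h (Fin.last m) (by simp; omega), fun j h1 => ?_⟩
      simpa using h j.castSucc (by simpa using h1)
    · rintro ⟨h, h'⟩ j
      refine Fin.lastCases ?_ (fun j => ?_) j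
      · intros; simpa using h
      · intro h1; simpa using h' j (by simpa using h1)
  have e : ∀ (w : Fin m → Fin n) (c : Fin n) (hj' : i < m + 1),
      Fin.snoc (α := fun _ => Fin n) w c ⟨i, hj'⟩ = w ⟨i, hi⟩ := by
    intro w c hj'
    exact Fin.snoc_castSucc (α := fun _ => Fin n) c w ⟨i, hi⟩
  simp only [site, Matrix.of_apply, dif_pos hi, dif_pos (show i < m + 1 by omega), key, e]
  by_cases h : a = b <;> simp [h]

theorem site_zero_eq_bond {m : ℕ} (hm : 1 < m) (X : Matrix (Fin n) (Fin n) A) :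
    site m 0 X = bond m 0 (leg1 X) := by
  ext u v
  simp only [site, bond, leg1, Matrix.of_apply, dif_pos (show 0 < m by omega),
    dif_pos (show 0 + 1 < m from hm), ← ite_and]
  congr 1
  rw [eq_iff_iff]
  constructor
  · intro h
    exact ⟨fun j h1 _ => h j h1, h ⟨0 + 1, hm⟩ (by simp)⟩
  · rintro ⟨h, h'⟩ j hj
    by_cases h1 : (j : ℕ) = 0 + 1
    · obtain rfl : j = ⟨0 + 1, hm⟩ := Fin.ext h1
      exact h'
    · exact h j hj h1

variable [Algebra ℂ A]

theorem site_zero_commute (X : Matrix (Fin n) (Fin n) A)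
    (Y : Matrix (Fin n × Fin n) (Fin n × Fin n) ℂ) {m i : ℕ} (hi : 1 ≤ i) (him : i + 1 < m) :
    Commute (site m 0 X) (bond m i (scal A Y)) := by
  induction m with
  | zero => omega
  | succ m ih =>
    rcases Nat.lt_or_ge (i + 1) m with h | h
    · have := congrArg up (ih h).eq
      rwa [up_mul, up_mul, up_bond h, up_site (by omega)] at this
    · obtain rfl : m = i + 1 := by omega
      have := commute_up_up_bond_last (site i 0 X) Y
      rwa [up_site (by omega), up_site (by omega)] at this

/-- `L` satisfies the reflection equation `R L₁ R L₁ = L₁ R L₁ R`. -/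
def ReflectionEq (R : Matrix (Fin n × Fin n) (Fin n × Fin n) ℂ) (L : Matrix (Fin n) (Fin n) A) :
    Prop :=
  scal A R * leg1 L * scal A R * leg1 L = leg1 L * scal A R * leg1 L * scal A R

theorem ReflectionEq.site {R : Matrix (Fin n × Fin n) (Fin n × Fin n) ℂ}
    {L : Matrix (Fin n) (Fin n) A} (h : ReflectionEq R L) {m : ℕ} (hm : 1 < m) :
    bond m 0 (scal A R) * site m 0 L * bond m 0 (scal A R) * site m 0 L =
      site m 0 L * bond m 0 (scal A R) * site m 0 L * bond m 0 (scal A R) := by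
  have := congrArg (bond m 0) h
  simpa only [bond_mul (show 0 + 1 < m from hm), site_zero_eq_bond hm] using this

variable {q : ℂ} {R : Matrix (Fin n × Fin n) (Fin n × Fin n) ℂ} {D : Matrix (Fin n) (Fin n) ℂ}

theorem IsCharData.braidFamily (h : IsCharData n q R D) (A : Type*) [Ring A] [Algebra ℂ A] (m : ℕ) :
    IsBraidFamily (fun i => bond m i (scal A R)) (fun i => bond m i (scal A R⁻¹)) (m - 1) := by
  have hb := isBraidFamily_bond h.det h.braid m
  simp only [← scal_bond]
  simp only [← scalHom_apply]
  exact ⟨fun i hi => by rw [← map_mul, hb.mul_inv i hi, map_one],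
    fun i hi => by rw [← map_mul, hb.inv_mul i hi, map_one],
    fun i hi => by simp only [← map_mul, hb.braid i hi],
    fun i j hi hj => (hb.far i j hi hj).map _⟩

theorem IsCharData.heckeFamily (h : IsCharData n q R D) (A : Type*) [Ring A] [Algebra ℂ A] (m : ℕ) :
    IsHeckeFamily q (fun i => bond m i (scal A R)) (m - 1) := by
  have hb := isHeckeFamily_bond h.q_ne_zero h.braid h.hecke m
  simp only [← scal_bond]
  simp only [← scalHom_apply]
  exact ⟨fun i hi => by rw [← map_mul, hb.hecke i hi, map_add, map_one, map_smul],
    fun i hi => by simp only [← map_mul, hb.braid i hi],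
    fun i j hi hj => (hb.far i j hi hj).map _⟩

/-- The quantum trace over all factors but the first one. -/
def trTo1 (D : Matrix (Fin n) (Fin n) ℂ) :
    (k : ℕ) → Matrix (Fin (k + 1) → Fin n) (Fin (k + 1) → Fin n) A →
      Matrix (Fin 1 → Fin n) (Fin 1 → Fin n) A
  | 0, Z => Z
  | k + 1, Z => trTo1 D k (rtr D Z)

/-- The quantum trace over all factors, as a matrix on `V^{⊗ 0}`. -/
def trAll (D : Matrix (Fin n) (Fin n) ℂ) :
    (k : ℕ) → Matrix (Fin k → Fin n) (Fin k → Fin n) A →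
      Matrix (Fin 0 → Fin n) (Fin 0 → Fin n) A
  | 0, Z => Z
  | k + 1, Z => trAll D k (rtr D Z)

theorem trM_eq_trAll (D : Matrix (Fin n) (Fin n) ℂ) {k : ℕ}
    (Z : Matrix (Fin k → Fin n) (Fin k → Fin n) A) : trM D Z = trAll D k Z default default := by
  induction k with
  | zero => simp [trM, trAll]
  | succ k ih =>
    rw [trAll, ← ih, trM, trM, sum_snoc]
    refine Finset.sum_congr rfl fun u _ => ?_
    simp only [sum_snoc, rtr_apply, Fin.prod_univ_castSucc, Fin.snoc_castSucc, Fin.snoc_last,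
      Finset.smul_sum, smul_smul]
    rw [Finset.sum_comm]

theorem trTo1_sub (k : ℕ) (X Y : Matrix (Fin (k + 1) → Fin n) (Fin (k + 1) → Fin n) A) :
    trTo1 D k (X - Y) = trTo1 D k X - trTo1 D k Y := by
  induction k with
  | zero => rfl
  | succ k ih => rw [trTo1, rtr_sub, ih]; rfl

theorem trTo1_smul (k : ℕ) (c : ℂ) (X : Matrix (Fin (k + 1) → Fin n) (Fin (k + 1) → Fin n) A) :
    trTo1 D k (c • X) = c • trTo1 D k X := by
  induction k with
  | zero => rfl
  | succ k ih => rw [trTo1, rtr_smul, ih]; rfl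

theorem trTo1_zero (k : ℕ) :
    trTo1 D k (0 : Matrix (Fin (k + 1) → Fin n) (Fin (k + 1) → Fin n) A) = 0 := by
  simpa using trTo1_smul (D := D) k 0 (0 : Matrix (Fin (k + 1) → Fin n) (Fin (k + 1) → Fin n) A)

theorem trTo1_site_mul (k : ℕ) (L : Matrix (Fin n) (Fin n) A)
    (X : Matrix (Fin (k + 1) → Fin n) (Fin (k + 1) → Fin n) A) :
    trTo1 D k (site (k + 1) 0 L * X) = site 1 0 L * trTo1 D k X := by
  induction k with
  | zero => rfl
  | succ k ih => rw [trTo1, ← up_site (by omega), rtr_up_mul, ih]; rfl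

/-- The trace over all factors but the first one is cyclic with respect to the braid generators that
do not act in the first factor. -/
theorem IsCharData.trTo1_bond_comm (h : IsCharData n q R D) {k i : ℕ} (hi : i + 2 < k + 1)
    (X : Matrix (Fin (k + 1) → Fin n) (Fin (k + 1) → Fin n) A) :
    trTo1 D k (bond (k + 1) (i + 1) (scal A R) * X) =
      trTo1 D k (X * bond (k + 1) (i + 1) (scal A R)) := by
  induction k with
  | zero => omega
  | succ k ih =>
    rcases Nat.lt_or_ge (i + 2) (k + 1) with h1 | h1
    · rw [trTo1, trTo1, ← up_bond (by omega), rtr_up_mul, rtr_mul_up, ih h1]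
    · obtain rfl : k = i + 1 := by omega
      simp only [trTo1]
      rw [rtr_rtr_comm h.comm]

theorem IsCharData.trTo1_asym_comm (h : IsCharData n q R D) (k j : ℕ) (hj : j ≤ k)
    (X : Matrix (Fin (k + 1) → Fin n) (Fin (k + 1) → Fin n) A) :
    trTo1 D k (asym q (fun i => bond (k + 1) (i + 1) (scal A R)) j * X) =
      trTo1 D k (X * asym q (fun i => bond (k + 1) (i + 1) (scal A R)) j) := by
  induction j generalizing X with
  | zero => rw [asym, one_mul, mul_one]
  | succ j ih =>
    cases j with
    | zero => rw [asym, one_mul, mul_one]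
    | succ j =>
      have ih := ih (by omega)
      have hb := fun X : Matrix (Fin (k + 1) → Fin n) (Fin (k + 1) → Fin n) A =>
        h.trTo1_bond_comm (k := k) (i := j) (by omega) X
      simp only [asym, mul_sub, sub_mul, smul_mul_assoc, mul_smul_comm, trTo1_sub, trTo1_smul,
        mul_one]
      congr 2
      · congr 1
        rw [mul_assoc, ih, mul_assoc, ih, mul_assoc]
      · simp only [mul_assoc]
        rw [ih]
        simp only [mul_assoc]
        rw [hb]
        simp only [mul_assoc]
        rw [ih]
        simp only [mul_assoc]

theorem up_chain_bond (m : ℕ) {k : ℕ} (hk : k < m) (X : Matrix (Fin n × Fin n) (Fin n × Fin n) A) :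
    up (chain (fun i => bond m i X) k) = chain (fun i => bond (m + 1) i X) k := by
  rw [← upHom_apply, ← RingHom.coe_coe, map_chain]
  exact chain_congr fun i hi => up_bond (by omega) X

theorem up_chainInv_bond (m : ℕ) {k : ℕ} (hk : k < m)
    (X : Matrix (Fin n × Fin n) (Fin n × Fin n) A) :
    up (chainInv (fun i => bond m i X) k) = chainInv (fun i => bond (m + 1) i X) k := by
  rw [← upHom_apply, ← RingHom.coe_coe, map_chainInv]
  exact chainInv_congr fun i hi => up_bond (by omega) X

/-- The quantum trace over the last `k` factors of a matrix acting in these factors. -/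
theorem IsCharData.trTo1_conj (h : IsCharData n q R D) (k : ℕ)
    (Y : Matrix (Fin k → Fin n) (Fin k → Fin n) A) :
    trTo1 D k (chain (fun i => bond (k + 1) i (scal A R)) k * up Y *
      chainInv (fun i => bond (k + 1) i (scal A R⁻¹)) k) = up (trAll D k Y) := by
  induction k with
  | zero => simp [chain, chainInv, trTo1, trAll]
  | succ k ih =>
    rw [chain, chainInv, ← up_chain_bond (k + 1) (by omega), ← up_chainInv_bond (k + 1) (by omega),
      trTo1, ← mul_assoc, rtr_mul_up, mul_assoc (up _), mul_assoc (up _), rtr_up_mul,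
      h.conj.rtr_conj, ih, trAll]

/-- Multiplication by the first braid generator reduces the number of traces by one. -/
theorem IsCharData.trTo1_conj_mul (h : IsCharData n q R D) (k : ℕ)
    (Y : Matrix (Fin (k + 1) → Fin n) (Fin (k + 1) → Fin n) A) :
    trTo1 D (k + 1) (chain (fun i => bond (k + 2) i (scal A R)) (k + 1) * up Y *
      chainInv (fun i => bond (k + 2) i (scal A R⁻¹)) (k + 1) * bond (k + 2) 0 (scal A R)) =
    trTo1 D k Y := by
  induction k with
  | zero =>
    have h1 := (h.braidFamily A 2).inv_mul 0 (by omega)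
    simp only [chain, chainInv, one_mul, mul_one, trTo1]
    rw [mul_assoc _ (bond 2 0 (scal A R⁻¹)), h1, mul_one, rtr_mul_up, rtr_bond_last h.trace_one,
      one_mul]
  | succ k ih =>
    rw [chain, chainInv, ← up_chain_bond (k + 2) (by omega), ← up_chainInv_bond (k + 2) (by omega),
      ← up_bond (i := 0) (m := k + 2) (by omega), trTo1, ← mul_assoc, rtr_mul_up, rtr_mul_up,
      mul_assoc (up _), mul_assoc (up _), rtr_up_mul, h.conj.rtr_conj, ih, trTo1]

/-- `A^{(m)} L_{\bar 1} ⋯ L_{\bar m}` on `V^{⊗ m}`. -/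
noncomputable def wedge (q : ℂ) (R : Matrix (Fin n × Fin n) (Fin n × Fin n) ℂ)
    (L : Matrix (Fin n) (Fin n) A) (m : ℕ) : Matrix (Fin m → Fin n) (Fin m → Fin n) A :=
  asym q (fun i => bond m i (scal A R)) m *
    ((List.range m).map (copy (fun i => bond m i (scal A R)) (fun i => bond m i (scal A R⁻¹))
      (site m 0 L))).prod

theorem up_copy {m i : ℕ} (hi : i < m) (L : Matrix (Fin n) (Fin n) A) :
    up (copy (fun i => bond m i (scal A R)) (fun i => bond m i (scal A R⁻¹)) (site m 0 L) i) =
      copy (fun i => bond (m + 1) i (scal A R)) (fun i => bond (m + 1) i (scal A R⁻¹))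
        (site (m + 1) 0 L) i := by
  induction i with
  | zero => exact up_site hi L
  | succ i ih => simp only [copy, up_mul, ih (by omega), up_bond hi]

theorem up_wedge (L : Matrix (Fin n) (Fin n) A) (m : ℕ) :
    up (wedge q R L m) = asym q (fun i => bond (m + 1) i (scal A R)) m *
      ((List.range m).map (copy (fun i => bond (m + 1) i (scal A R))
        (fun i => bond (m + 1) i (scal A R⁻¹)) (site (m + 1) 0 L))).prod := by
  rw [wedge, up_mul]
  congr 1
  · rw [← upHom_apply, map_asym]
    exact asym_congr fun i hi => up_bond (by omega) _
  · rw [← upHom_apply, map_list_prod, List.map_map]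
    congr 1
    refine List.map_congr_left fun i hi => ?_
    exact up_copy (List.mem_range.1 hi) L

/-- The key recursion: with `A'` the antisymmetrizer in the last `k + 1` of `k + 2` factors, the
partial trace of `(q^{k+1} A' - (k+1)_q A' R₁ A') L_{\bar 1} ⋯ L_{\overline{k+2}}`. -/
theorem IsCharData.trTo1_step (h : IsCharData n q R D) {L : Matrix (Fin n) (Fin n) A}
    (hL : ReflectionEq R L) (k : ℕ) (hk : k + 1 ≤ n) :
    trTo1 D (k + 1) ((q ^ (k + 1) • asym q (fun i => bond (k + 2) (i + 1) (scal A R)) (k + 1) -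
      qnum q (k + 1) • (asym q (fun i => bond (k + 2) (i + 1) (scal A R)) (k + 1) *
        bond (k + 2) 0 (scal A R) * asym q (fun i => bond (k + 2) (i + 1) (scal A R)) (k + 1))) *
      ((List.range (k + 2)).map (copy (fun i => bond (k + 2) i (scal A R))
        (fun i => bond (k + 2) i (scal A R⁻¹)) (site (k + 2) 0 L))).prod) =
    q ^ (k + 1) • (site 1 0 L * up (trAll D (k + 1) (wedge q R L (k + 1)))) -
      qnum q (k + 1) • (site 1 0 L * trTo1 D k (wedge q R L (k + 1))) := by
  have hb : IsBraidFamily (fun i => bond (k + 2) i (scal A R))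
    (fun i => bond (k + 2) i (scal A R⁻¹)) (k + 1) := h.braidFamily A (k + 2)
  have hg : IsHeckeFamily q (fun i => bond (k + 2) i (scal A R)) (k + 1) := h.heckeFamily A (k + 2)
  have hl : ∀ i, 1 ≤ i → i < k + 1 → Commute (site (k + 2) 0 L) (bond (k + 2) i (scal A R)) :=
    fun i h1 h2 => site_zero_commute L R h1 (by omega)
  have hre := hL.site (show 1 < k + 2 by omega)
  have hne : ∀ i, 2 ≤ i → i ≤ k + 1 → qnum q i ≠ 0 := fun i h2 hi => h.qnum_ne_zero i h2 (by omega)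
  have hcyc := h.trTo1_asym_comm (A := A) (k + 1) (k + 1) le_rfl
  have hid := asym_mul_self h.q_ne_zero (k := k + 1) hg.shift hne
  -- the product of the copies commutes with the generators, hence with `A'`
  have hprod := fun i (hi : i + 1 < k + 2) => hb.commute_prod_copy hl hre hi le_rfl
  have hA' := Commute.asym_right (q := q) (g := fun i => bond (k + 2) (i + 1) (scal A R))
    (k := k + 1) fun i hi => (hprod (i + 1) (by omega)).symm
  have hA'l := Commute.asym_right (q := q) (g := fun i => bond (k + 2) (i + 1) (scal A R))
    (k := k + 1) fun i hi => hl (i + 1) (by omega) (by omega)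
  have hsplit : ((List.range (k + 2)).map (copy (fun i => bond (k + 2) i (scal A R))
        (fun i => bond (k + 2) i (scal A R⁻¹)) (site (k + 2) 0 L))).prod =
      site (k + 2) 0 L * ((List.range (k + 1)).map fun i => copy (fun i => bond (k + 2) i (scal A R))
        (fun i => bond (k + 2) i (scal A R⁻¹)) (site (k + 2) 0 L) (i + 1)).prod :=
    List.prod_range_succ' _ _
  have hshift : chain (fun i => bond (k + 2) i (scal A R)) (k + 1) * up (wedge q R L (k + 1)) *
      chainInv (fun i => bond (k + 2) i (scal A R⁻¹)) (k + 1) =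
      asym q (fun i => bond (k + 2) (i + 1) (scal A R)) (k + 1) *
        ((List.range (k + 1)).map fun i => copy (fun i => bond (k + 2) i (scal A R))
        (fun i => bond (k + 2) i (scal A R⁻¹)) (site (k + 2) 0 L) (i + 1)).prod := by
    have e1 := hb.chainInv_mul_chain le_rfl
    have e1' := hb.chain_mul_chainInv le_rfl
    have e2 := asym_conj_chain hb q le_rfl (k + 1) le_rfl
    have e3 := hb.chain_mul_prod_copy hl (le_refl (k + 1)) le_rfl
    rw [up_wedge, ← e2]
    calc _ = chain (fun i => bond (k + 2) i (scal A R)) (k + 1) *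
          asym q (fun i => bond (k + 2) i (scal A R)) (k + 1) *
          (chainInv (fun i => bond (k + 2) i (scal A R⁻¹)) (k + 1) *
            chain (fun i => bond (k + 2) i (scal A R)) (k + 1)) *
          ((List.range (k + 1)).map (copy (fun i => bond (k + 2) i (scal A R))
            (fun i => bond (k + 2) i (scal A R⁻¹)) (site (k + 2) 0 L))).prod *
          chainInv (fun i => bond (k + 2) i (scal A R⁻¹)) (k + 1) := by
            rw [e1, mul_one]; simp only [mul_assoc]
      _ = _ := by
            simp only [mul_assoc]
            rw [← mul_assoc (chain _ _) (List.prod _), e3]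
            simp only [mul_assoc, e1', mul_one]
  have t1 := h.trTo1_conj (k + 1) (wedge q R L (k + 1))
  have t2 := h.trTo1_conj_mul k (wedge q R L (k + 1))
  rw [hshift] at t1 t2
  have hp0 := hprod 0 (by omega)
  rw [hsplit] at hA' hp0 ⊢
  set A' := asym q (fun i => bond (k + 2) (i + 1) (scal A R)) (k + 1)
  set l := site (k + 2) 0 L
  set P := ((List.range (k + 1)).map fun i => copy (fun i => bond (k + 2) i (scal A R))
        (fun i => bond (k + 2) i (scal A R⁻¹)) l (i + 1)).prod
  set g0 := bond (k + 2) 0 (scal A R)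
  rw [sub_mul, smul_mul_assoc, smul_mul_assoc, trTo1_sub, trTo1_smul, trTo1_smul]
  congr 2
  · rw [← mul_assoc, ← hA'l.eq, mul_assoc, trTo1_site_mul, t1]
  · calc trTo1 D (k + 1) (A' * g0 * A' * (l * P)) = trTo1 D (k + 1) ((A' * g0 * (l * P)) * A') := by
          rw [mul_assoc (A' * g0), ← hA'.eq, mul_assoc (A' * g0)]
      _ = trTo1 D (k + 1) ((A' * A') * (g0 * (l * P))) := by rw [← hcyc]; simp only [mul_assoc]
      _ = trTo1 D (k + 1) (l * (A' * P * g0)) := by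
          rw [hid, hp0.eq, ← mul_assoc, ← mul_assoc, ← hA'l.eq]; simp only [mul_assoc]
      _ = _ := by rw [trTo1_site_mul, t2]

/-- The recursion for the traces `M_k = Tr_{R(2..k)} (A^{(k)} L_{\bar 1} ⋯ L_{\bar k})`, where
`a_k = Tr_{R(1..k)} (A^{(k)} L_{\bar 1} ⋯ L_{\bar k})`:
`(k+2)_q M_{k+2} = q^{k+1} L a_{k+1} - (k+1)_q L M_{k+1}`. -/
theorem IsCharData.trTo1_wedge_succ (h : IsCharData n q R D) {L : Matrix (Fin n) (Fin n) A}
    (hL : ReflectionEq R L) (k : ℕ) (hk : k + 2 ≤ n) :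
    qnum q (k + 2) • trTo1 D (k + 1) (wedge q R L (k + 2)) =
    q ^ (k + 1) • (site 1 0 L * up (trAll D (k + 1) (wedge q R L (k + 1)))) -
      qnum q (k + 1) • (site 1 0 L * trTo1 D k (wedge q R L (k + 1))) := by
  rw [← h.trTo1_step hL k (by omega), ← trTo1_smul, wedge, ← smul_mul_assoc,
    asym_succ_left h.q_ne_zero (h.heckeFamily A (k + 2))
      fun i h2 hi => h.qnum_ne_zero i h2 (by omega)]

/-- The last step of the recursion, where the antisymmetrizer on `n + 1` strands vanishes. -/
theorem IsCharData.trTo1_wedge_last {k : ℕ}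
    {R : Matrix (Fin (k + 1) × Fin (k + 1)) (Fin (k + 1) × Fin (k + 1)) ℂ}
    {D : Matrix (Fin (k + 1)) (Fin (k + 1)) ℂ}
    (h : IsCharData (k + 1) q R D) {L : Matrix (Fin (k + 1)) (Fin (k + 1)) A}
    (hL : ReflectionEq R L) :
    q ^ (k + 1) • (site 1 0 L * up (trAll D (k + 1) (wedge q R L (k + 1)))) -
      qnum q (k + 1) • (site 1 0 L * trTo1 D k (wedge q R L (k + 1))) = 0 := by
  have hgl := congrArg (scalHom (Fin (k + 2) → Fin (k + 1)) A) h.gl_left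
  simp only [map_sub, map_smul, map_mul, map_asym, map_zero, scalHom_apply, scal_bond] at hgl
  rw [← h.trTo1_step hL k le_rfl, hgl, zero_mul, trTo1_zero]

end CayleyHamilton

/-! ### The characteristic identity -/

section CayleyHamilton

variable {n : ℕ} {A : Type*} [Ring A] [Algebra ℂ A]

/-- The solution of the recursion for `N k = k_q Tr_{R(2..k)} (A^{(k)} L_{\bar 1} ⋯ L_{\bar k})`. -/
theorem sum_eq_of_recursion {M : Type*} [Ring M] [Algebra ℂ M] (q : ℂ) (L : M) (a N : ℕ → M)
    (ha : a 0 = 1) (h1 : N 1 = L) {K : ℕ}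
    (h : ∀ k, k + 2 ≤ K → N (k + 2) = q ^ (k + 1) • (L * a (k + 1)) - L * N (k + 1)) (k : ℕ)
    (hk : k + 1 ≤ K) :
    N (k + 1) = ∑ i ∈ Finset.range (k + 1), ((-1) ^ (k + i) * q ^ i : ℂ) • (L ^ (k + 1 - i) * a i) := by
  induction k with
  | zero => simp [ha, h1]
  | succ k ih =>
    rw [h k hk, ih (by omega), Finset.sum_range_succ _ (k + 1), sub_eq_neg_add]
    congr 1
    · rw [Finset.mul_sum, ← Finset.sum_neg_distrib]
      refine Finset.sum_congr rfl fun i hi => ?_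
      have hi := Finset.mem_range.1 hi
      rw [mul_smul_comm, ← mul_assoc, ← pow_succ', ← neg_smul,
        show k + 1 + 1 - i = k + 1 - i + 1 by omega]
      congr 1
      ring
    · rw [show k + 1 + 1 - (k + 1) = 1 by omega, pow_one, ← two_mul, pow_mul]
      simp

/-- Matrices on `V^{⊗ 1}` are matrices on `V`. -/
def oneSite (n : ℕ) (A : Type*) [Ring A] [Algebra ℂ A] :
    Matrix (Fin 1 → Fin n) (Fin 1 → Fin n) A ≃ₐ[ℂ] Matrix (Fin n) (Fin n) A :=
  Matrix.reindexAlgEquiv ℂ A (Equiv.funUnique (Fin 1) (Fin n))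

theorem oneSite_apply (X : Matrix (Fin 1 → Fin n) (Fin 1 → Fin n) A) (i j : Fin n) :
    oneSite n A X i j = X (fun _ => i) (fun _ => j) := rfl

theorem oneSite_site (L : Matrix (Fin n) (Fin n) A) : oneSite n A (site 1 0 L) = L := by
  ext i j
  simp only [oneSite_apply, site, Matrix.of_apply, dif_pos (show 0 < 1 by omega)]
  rw [if_pos]
  intro j hj
  omega

theorem oneSite_up (X : Matrix (Fin 0 → Fin n) (Fin 0 → Fin n) A) :
    oneSite n A (up X) = Matrix.scalar (Fin n) (X default default) := by
  ext i j
  simp only [oneSite_apply, up, Matrix.of_apply, Matrix.scalar_apply, Matrix.diagonal_apply]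
  congr 1
  congr 1 <;> exact Subsingleton.elim _ _

/-- The Cayley–Hamilton theorem for an invertible matrix satisfying the reflection equation. -/
theorem IsCharData.cayleyHamilton {q : ℂ} {R : Matrix (Fin n × Fin n) (Fin n × Fin n) ℂ}
    {D : Matrix (Fin n) (Fin n) ℂ} (h : IsCharData n q R D) (hn : 1 ≤ n)
    {L Linv : Matrix (Fin n) (Fin n) A} (hL : ReflectionEq R L) (hinv : Linv * L = 1) :
    ∑ i ∈ Finset.range (n + 1), ((-1) ^ i * q ^ i : ℂ) •
      (L ^ (n - i) * Matrix.scalar (Fin n) (trM D (wedge q R L i))) = 0 := by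
  obtain _ | k := n
  · omega
  set a : ℕ → Matrix (Fin (k + 1)) (Fin (k + 1)) A := fun i =>
    Matrix.scalar (Fin (k + 1)) (trM D (wedge q R L i)) with ha
  set N : ℕ → Matrix (Fin (k + 1)) (Fin (k + 1)) A := fun j =>
    oneSite (k + 1) A (qnum q j • trTo1 D (j - 1) (match j with
      | 0 => 0
      | j + 1 => wedge q R L (j + 1))) with hN
  have haj : ∀ j, oneSite (k + 1) A (up (trAll D j (wedge q R L j))) = a j := fun j => by
    rw [oneSite_up, ← trM_eq_trAll]
  have ha0 : a 0 = 1 := by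
    have : trM D (wedge q R L 0) = 1 := by simp [trM, wedge, asym]
    rw [ha]
    simp only [this, map_one]
  have hN1 : N 1 = L := by
    have : wedge q R L 1 = site 1 0 L := by simp [wedge, asym, copy]
    simp only [hN, this, qnum_one, one_smul]
    exact oneSite_site L
  have hrec : ∀ j, j + 2 ≤ k + 1 → N (j + 2) = q ^ (j + 1) • (L * a (j + 1)) - L * N (j + 1) := by
    intro j hj
    have := congrArg (oneSite (k + 1) A) (h.trTo1_wedge_succ hL j hj)
    simp only [map_sub, map_smul, map_mul, oneSite_site, haj] at this
    simp only [hN, map_smul, mul_smul_comm]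
    exact this
  have hlast : q ^ (k + 1) • (L * a (k + 1)) - L * N (k + 1) = 0 := by
    have := congrArg (oneSite (k + 1) A) (h.trTo1_wedge_last hL)
    simp only [map_sub, map_smul, map_mul, oneSite_site, haj, map_zero] at this
    simp only [hN, map_smul, mul_smul_comm]
    exact this
  rw [sum_eq_of_recursion q L a N ha0 hN1 hrec k le_rfl] at hlast
  -- `hlast` is the identity multiplied by `L`
  have h2 := congrArg (fun Z => (-1 : ℂ) ^ (k + 1) • (Linv * Z)) hlast
  simp only [mul_sub, mul_smul_comm, ← mul_assoc, hinv, one_mul, mul_zero, smul_zero] at h2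
  rw [← h2, Finset.sum_range_succ, smul_sub, smul_smul, Finset.smul_sum, Nat.sub_self, pow_zero,
    one_mul, sub_eq_neg_add, ← Finset.sum_neg_distrib]
  congr 1
  refine Finset.sum_congr rfl fun i hi => ?_
  rw [smul_smul, ← neg_smul]
  congr 1
  have : (-1 : ℂ) ^ (k + 1) * (-1) ^ (k + i) = - (-1) ^ i := by
    rw [← pow_add, show k + 1 + (k + i) = 2 * k + (i + 1) by ring, pow_add, pow_mul]
    simp [pow_succ]
  rw [← mul_assoc, this]
  ring

end CayleyHamilton

/-! ### Spectral projections -/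

section Spectral

theorem esymm_eq_multiset {n : ℕ} {C : Type*} [CommRing C] (ξ : Fin n → C) (i : ℕ) :
    esymm ξ i = (((List.finRange n).map ξ : List C) : Multiset C).esymm i := by
  rw [Multiset.esymm, ← Multiset.map_coe, Multiset.powersetCard_map, Multiset.powersetCard_coe]
  simp [esymm, Function.comp_def]

/-- The product defining the spectral projections, in an arbitrary algebra. -/
noncomputable def lagrange {n : ℕ} {M : Type*} [Ring M] [Algebra ℂ M] (q : ℂ) (X : M)
    (ξ : Fin n → M) (δ : (α β : Fin n) → α ≠ β → M) (α : Fin n) : M :=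
  ((List.finRange n).map fun β =>
    if h : α = β then 1 else (q⁻¹ • δ α β h) * (X - q • ξ β)).prod

theorem map_lagrange {n : ℕ} {M M' : Type*} [Ring M] [Algebra ℂ M] [Ring M'] [Algebra ℂ M']
    (f : M →ₐ[ℂ] M') (q : ℂ) (X : M) (ξ : Fin n → M) (δ : (α β : Fin n) → α ≠ β → M) (α : Fin n) :
    f (lagrange q X ξ δ α) = lagrange q (f X) (fun β => f (ξ β)) (fun α β h => f (δ α β h)) α := by
  rw [lagrange, lagrange, map_list_prod, List.map_map]
  congr 1
  refine List.map_congr_left fun β _ => ?_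
  simp only [Function.comp_apply]
  split_ifs <;> simp

theorem map_esymm {n : ℕ} {M M' : Type*} [Ring M] [Ring M'] (f : M →+* M') (ξ : Fin n → M)
    (i : ℕ) : f (esymm ξ i) = esymm (fun β => f (ξ β)) i := by
  simp [esymm, map_list_sum, map_list_prod, Function.comp_def]

section Comm

variable {n : ℕ} {C : Type*} [CommRing C] [Algebra ℂ C] {q : ℂ} {X : C} {ξ : Fin n → C}
  {δ : (α β : Fin n) → α ≠ β → C}

theorem prod_sub_eq_zero (hch : ∑ i ∈ Finset.range (n + 1), ((-1) ^ i * q ^ i : ℂ) •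
      (X ^ (n - i) * esymm ξ i) = 0) : ∏ β, (X - q • ξ β) = 0 := by
  have h1 := Multiset.prod_X_sub_X_eq_sum_esymm
    (((List.finRange n).map fun β => q • ξ β : List C) : Multiset C)
  have h2 := congrArg (Polynomial.eval X) h1
  rw [Polynomial.eval_multiset_prod, Polynomial.eval_finsetSum] at h2
  simp only [Multiset.map_coe, List.map_map, Multiset.prod_coe, Multiset.coe_card, List.length_map,
    List.length_finRange, Polynomial.eval_mul, Polynomial.eval_pow, Polynomial.eval_neg,
    Polynomial.eval_one, Polynomial.eval_C, Polynomial.eval_X, ← esymm_eq_multiset] at h2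
  rw [Fin.prod_univ_def]
  simp only [Function.comp_def, Polynomial.eval_sub, Polynomial.eval_C, Polynomial.eval_X] at h2
  rw [h2, ← hch]
  refine Finset.sum_congr rfl fun i _ => ?_
  have : esymm (fun β => q • ξ β) i = q ^ i • esymm ξ i := by
    rw [esymm_eq_multiset, esymm_eq_multiset, Multiset.pow_smul_esymm, Multiset.map_coe,
      List.map_map]
    rfl
  rw [this]
  simp only [Algebra.smul_def, map_mul, map_pow, map_neg, map_one]
  ring

theorem lagrange_eq_prod (α : Fin n) : lagrange q X ξ δ α =
    ∏ β, if h : α = β then 1 else (q⁻¹ • δ α β h) * (X - q • ξ β) := by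
  rw [lagrange, Fin.prod_univ_def]

theorem sub_mul_lagrange (hX : ∏ β, (X - q • ξ β) = 0) (α : Fin n) :
    (X - q • ξ α) * lagrange q X ξ δ α = 0 := by
  have : (X - q • ξ α) * lagrange q X ξ δ α =
      (∏ β, if h : α = β then 1 else q⁻¹ • δ α β h) * ∏ β, (X - q • ξ β) := by
    rw [lagrange_eq_prod, ← Finset.prod_mul_distrib, ← Finset.mul_prod_erase _ _ (Finset.mem_univ α),
      ← Finset.mul_prod_erase _ (fun β => _ * _) (Finset.mem_univ α)]
    simp only [dif_pos, one_mul]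
    congr 1
    refine Finset.prod_congr rfl fun β hβ => ?_
    have : α ≠ β := (Finset.ne_of_mem_erase hβ).symm
    simp only [dif_neg this]
  rw [this, hX, mul_zero]

/-- Lagrange interpolation of the constant `1`: the difference of the two sides, as a polynomial in
`X`, vanishes at each `q ξ_α`, hence is divisible by `∏ (X - q ξ_α)`. -/
theorem sum_lagrange (hδ : ∀ α β (h : α ≠ β), (ξ α - ξ β) * δ α β h = 1) (hq : q ≠ 0)
    (hX : ∏ β, (X - q • ξ β) = 0) : ∑ α, lagrange q X ξ δ α = 1 := by
  set p : Polynomial C := ∑ α, lagrange q (Polynomial.X : Polynomial C)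
    (fun β => Polynomial.C (ξ β)) (fun α β h => Polynomial.C (δ α β h)) α - 1 with hp
  have hev : ∀ y : C, Polynomial.eval y p = ∑ α, lagrange q y ξ δ α - 1 := by
    intro y
    have hm := fun α => map_lagrange ((Polynomial.aeval (R := C) y).restrictScalars ℂ) q
      (Polynomial.X : Polynomial C) (fun β => Polynomial.C (ξ β))
      (fun α β h => Polynomial.C (δ α β h)) α
    simp only [AlgHom.restrictScalars_apply, Polynomial.aeval_X, Polynomial.aeval_C,
      Algebra.algebraMap_self, RingHom.id_apply, Polynomial.coe_aeval_eq_eval] at hm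
    rw [hp, Polynomial.eval_sub, Polynomial.eval_finsetSum, Polynomial.eval_one]
    simp only [hm]
  have hroot : ∀ γ, Polynomial.eval (q • ξ γ) p = 0 := by
    intro γ
    rw [hev, sub_eq_zero, Finset.sum_eq_single γ]
    · rw [lagrange_eq_prod]
      refine Finset.prod_eq_one fun β _ => ?_
      split_ifs with h
      · rfl
      · rw [← smul_sub, smul_mul_smul_comm, inv_mul_cancel₀ hq, one_smul, mul_comm, hδ]
    · intro α _ hα
      rw [lagrange_eq_prod]
      refine Finset.prod_eq_zero (Finset.mem_univ γ) ?_
      rw [dif_neg hα, sub_self, mul_zero]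
    · simp
  have hdvd : ∏ β, (Polynomial.X - Polynomial.C (q • ξ β)) ∣ p := by
    refine Finset.prod_dvd_of_coprime (fun α _ β _ hαβ => ?_)
      fun β _ => Polynomial.dvd_iff_isRoot.2 (hroot β)
    refine Polynomial.isCoprime_X_sub_C_of_isUnit_sub ?_
    refine IsUnit.of_mul_eq_one (q⁻¹ • δ α β hαβ) ?_
    rw [← smul_sub, smul_mul_smul_comm, mul_inv_cancel₀ hq, one_smul, hδ]
  obtain ⟨r, hr⟩ := hdvd
  have h := congrArg (Polynomial.eval X) hr
  rw [hev, Polynomial.eval_mul, Polynomial.eval_prod] at h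
  simp only [Polynomial.eval_sub, Polynomial.eval_X, Polynomial.eval_C] at h
  rw [hX, zero_mul] at h
  exact sub_eq_zero.1 h

end Comm

/-- The spectral decomposition of an element `X` annihilated by its characteristic polynomial, in an
algebra where `X` commutes with its eigenvalues `q ξ_α`. -/
theorem spectral_decomposition {n : ℕ} {M : Type*} [Ring M] [Algebra ℂ M] {q : ℂ} (hq : q ≠ 0)
    {X : M} {ξ : Fin n → M} {δ : (α β : Fin n) → α ≠ β → M} (hXξ : ∀ α, Commute X (ξ α))
    (hξ : ∀ α β, Commute (ξ α) (ξ β)) (hδ : ∀ α β (h : α ≠ β), (ξ α - ξ β) * δ α β h = 1)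
    (hδ' : ∀ α β (h : α ≠ β), δ α β h * (ξ α - ξ β) = 1)
    (hch : ∑ i ∈ Finset.range (n + 1), ((-1) ^ i * q ^ i : ℂ) • (X ^ (n - i) * esymm ξ i) = 0) :
    ∑ α, lagrange q X ξ δ α = 1 ∧
      ∀ α, X * lagrange q X ξ δ α = q • ξ α * lagrange q X ξ δ α ∧
        lagrange q X ξ δ α * X = lagrange q X ξ δ α * q • ξ α ∧
        Commute (ξ α) (lagrange q X ξ δ α) := by
  -- everything takes place in the double centralizer of `X` and the `ξ α`, which is commutative
  set s : Set M := insert X (Set.range ξ) with hs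
  have hcomm : ∀ x ∈ s, ∀ y ∈ s, x * y = y * x := by
    rintro x (rfl | ⟨α, rfl⟩) y (rfl | ⟨β, rfl⟩)
    · rfl
    · exact hXξ β
    · exact (hXξ α).symm
    · exact hξ α β
  have hs1 : s ⊆ Set.centralizer s := fun x hx y hy => hcomm y hy x hx
  set C : Subalgebra ℂ M := Subalgebra.centralizer ℂ (Set.centralizer s) with hC
  have hCs : ∀ x ∈ s, x ∈ C := fun x hx y hy => (hy x hx).symm
  have hCcomm : ∀ x y : C, x * y = y * x := fun x y =>
    Subtype.ext (y.2 x.1 fun z hz => x.2 z (hs1 hz))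
  let _ : CommRing C := { (inferInstance : Ring C) with mul_comm := hCcomm }
  have hXC : X ∈ C := hCs X (Set.mem_insert _ _)
  have hξC : ∀ α, ξ α ∈ C := fun α => hCs _ (Set.mem_insert_of_mem _ ⟨α, rfl⟩)
  have hδC : ∀ α β h, δ α β h ∈ C := fun α β h y hy =>
    commute_of_mul_eq_one (hδ α β h) (hδ' α β h)
      ((C.sub_mem (hξC α) (hξC β)) y hy)
  have hmap := fun α => map_lagrange C.val q (⟨X, hXC⟩ : C) (fun β => (⟨ξ β, hξC β⟩ : C))
    (fun α β h => (⟨δ α β h, hδC α β h⟩ : C)) α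
  simp only [Subalgebra.coe_val] at hmap
  have hch' : ∑ i ∈ Finset.range (n + 1), ((-1) ^ i * q ^ i : ℂ) •
      ((⟨X, hXC⟩ : C) ^ (n - i) * esymm (fun β => (⟨ξ β, hξC β⟩ : C)) i) = 0 := by
    refine Subtype.val_injective ?_
    have he := fun i => map_esymm (C.val : C →+* M) (fun β => (⟨ξ β, hξC β⟩ : C)) i
    simp only [RingHom.coe_coe, Subalgebra.coe_val] at he
    simpa [he] using hch
  have hprod := prod_sub_eq_zero hch'
  refine ⟨?_, fun α => ⟨?_, ?_, ?_⟩⟩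
  · have h1 := sum_lagrange (q := q) (X := (⟨X, hXC⟩ : C)) (ξ := fun β => (⟨ξ β, hξC β⟩ : C))
      (δ := fun α β h => (⟨δ α β h, hδC α β h⟩ : C))
      (fun α β h => Subtype.ext (hδ α β h)) hq hprod
    have h2 := congrArg C.val h1
    rw [map_sum, map_one] at h2
    simpa [hmap] using h2
  · have h1 := sub_mul_lagrange (q := q) (δ := fun α β h => (⟨δ α β h, hδC α β h⟩ : C)) hprod α
    have h2 := congrArg C.val h1
    rw [map_mul, map_sub, map_smul, map_zero, sub_mul] at h2
    simpa [hmap] using sub_eq_zero.1 h2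
  · have h1 := sub_mul_lagrange (q := q) (δ := fun α β h => (⟨δ α β h, hδC α β h⟩ : C)) hprod α
    rw [mul_comm] at h1
    have h2 := congrArg C.val h1
    rw [map_mul, map_sub, map_smul, map_zero, mul_sub] at h2
    simpa [hmap] using sub_eq_zero.1 h2
  · have h2 := congrArg C.val (hCcomm ⟨ξ α, hξC α⟩ (lagrange q (⟨X, hXC⟩ : C)
      (fun β => (⟨ξ β, hξC β⟩ : C)) (fun α β h => (⟨δ α β h, hδC α β h⟩ : C)) α))
    rw [map_mul, map_mul] at h2
    simpa [hmap, commute_iff_eq] using h2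

end Spectral

/-! ### Reversal of the tensor factors -/

section Reversal

variable {n : ℕ}

/-- Reversal of the order of the factors of `V^{⊗ m}`, on matrices. -/
def revHom (n m : ℕ) (A : Type*) [Ring A] [Algebra ℂ A] :
    Matrix (Fin m → Fin n) (Fin m → Fin n) A ≃ₐ[ℂ] Matrix (Fin m → Fin n) (Fin m → Fin n) A :=
  Matrix.reindexAlgEquiv ℂ A (Fin.revPerm.arrowCongr (Equiv.refl (Fin n)))

variable {A : Type*} [Ring A] [Algebra ℂ A]

theorem revHom_apply {m : ℕ} (X : Matrix (Fin m → Fin n) (Fin m → Fin n) A) (u v : Fin m → Fin n) :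
    revHom n m A X u v = X (fun j => u j.rev) (fun j => v j.rev) := rfl

theorem revHom_bond {m i : ℕ} (hi : i + 1 < m) (X : Matrix (Fin n × Fin n) (Fin n × Fin n) ℂ) :
    revHom n m ℂ (bond m i X) = bond m (m - 2 - i) (opMat X) := by
  ext u v
  have key : (∀ j : Fin m, (j : ℕ) ≠ i → (j : ℕ) ≠ i + 1 → u j.rev = v j.rev) ↔
      ∀ j : Fin m, (j : ℕ) ≠ m - 2 - i → (j : ℕ) ≠ m - 2 - i + 1 → u j = v j := by
    constructor
    · intro h j h1 h2
      simpa using h j.rev (by rw [Fin.val_rev]; omega) (by rw [Fin.val_rev]; omega)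
    · intro h j h1 h2
      exact h j.rev (by rw [Fin.val_rev]; omega) (by rw [Fin.val_rev]; omega)
  have e1 : (⟨i, by omega⟩ : Fin m).rev = ⟨m - 2 - i + 1, by omega⟩ :=
    Fin.ext (by rw [Fin.val_rev]; simp only; omega)
  have e2 : (⟨i + 1, hi⟩ : Fin m).rev = ⟨m - 2 - i, by omega⟩ :=
    Fin.ext (by rw [Fin.val_rev]; simp only; omega)
  simp only [revHom_apply, bond, Matrix.of_apply, dif_pos hi,
    dif_pos (show m - 2 - i + 1 < m by omega), key, opMat, Prod.swap_prod_mk, e1, e2]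

theorem revHom_site {m i : ℕ} (hi : i < m) (X : Matrix (Fin n) (Fin n) A) :
    revHom n m A (site m i X) = site m (m - 1 - i) X := by
  ext u v
  have key : (∀ j : Fin m, (j : ℕ) ≠ i → u j.rev = v j.rev) ↔
      ∀ j : Fin m, (j : ℕ) ≠ m - 1 - i → u j = v j := by
    constructor
    · intro h j h1
      simpa using h j.rev (by rw [Fin.val_rev]; omega)
    · intro h j h1
      exact h j.rev (by rw [Fin.val_rev]; omega)
  have e1 : (⟨i, hi⟩ : Fin m).rev = ⟨m - 1 - i, by omega⟩ :=
    Fin.ext (by rw [Fin.val_rev]; simp only; omega)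
  simp only [revHom_apply, site, Matrix.of_apply, dif_pos hi,
    dif_pos (show m - 1 - i < m by omega), key, e1]

theorem revHom_scal {m : ℕ} (X : Matrix (Fin m → Fin n) (Fin m → Fin n) ℂ) :
    revHom n m A (scal A X) = scal A (revHom n m ℂ X) := rfl

theorem trM_revHom {m : ℕ} (D : Matrix (Fin n) (Fin n) ℂ)
    (X : Matrix (Fin m → Fin n) (Fin m → Fin n) A) : trM D (revHom n m A X) = trM D X := by
  have e : ∀ f : (Fin m → Fin n) → A, ∑ u : Fin m → Fin n, f (fun j => u j.rev) = ∑ u, f u := fun f =>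
    (Fin.revPerm.arrowCongr (Equiv.refl (Fin n))).sum_comp f
  simp only [trM, revHom_apply]
  rw [← e fun u => ∑ v, (∏ j, D (u j) (v j)) • X v u]
  refine Finset.sum_congr rfl fun u _ => ?_
  rw [← e fun v => (∏ j, D (u j.rev) (v j)) • X v fun j => u j.rev]
  refine Finset.sum_congr rfl fun v _ => ?_
  congr 1
  exact (Equiv.prod_comp Fin.revPerm fun j => D (u j) (v j)).symm

/-- `opMat` as a homomorphism of algebras. -/
def opHom (n : ℕ) (A : Type*) [Ring A] [Algebra ℂ A] :
    Matrix (Fin n × Fin n) (Fin n × Fin n) A ≃ₐ[ℂ] Matrix (Fin n × Fin n) (Fin n × Fin n) A :=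
  Matrix.reindexAlgEquiv ℂ A (Equiv.prodComm (Fin n) (Fin n))

theorem opHom_complex (X : Matrix (Fin n × Fin n) (Fin n × Fin n) ℂ) : opHom n ℂ X = opMat X := rfl

theorem opHom_scal (X : Matrix (Fin n × Fin n) (Fin n × Fin n) ℂ) :
    opHom n A (scal A X) = scal A (opMat X) := rfl

theorem opHom_leg2 (X : Matrix (Fin n) (Fin n) A) : opHom n A (leg2 X) = leg1 X := rfl

theorem isUnit_det_opMat {R : Matrix (Fin n × Fin n) (Fin n × Fin n) ℂ} (h : IsUnit R.det) :
    IsUnit (opMat R).det := by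
  have h1 := congrArg (opHom n ℂ) (Matrix.mul_nonsing_inv R h)
  rw [map_mul, map_one, opHom_complex] at h1
  exact Matrix.isUnit_det_of_right_inverse h1

theorem opMat_inv {R : Matrix (Fin n × Fin n) (Fin n × Fin n) ℂ} (h : IsUnit R.det) :
    opMat R⁻¹ = (opMat R)⁻¹ := by
  have h1 := congrArg (opHom n ℂ) (Matrix.mul_nonsing_inv R h)
  rw [map_mul, map_one, opHom_complex, opHom_complex] at h1
  exact (Matrix.inv_eq_right_inv h1).symm

/-- The opposite of an R-matrix of `SL(n)` type satisfies the assumptions of the Cayley–Hamilton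
theorem; the height conditions on the first and on the last `n` factors are exchanged. -/
theorem isCharData_op_of_isSLType {q : ℂ} (hq : q ≠ 0) (hn : 1 ≤ n)
    {R Psi : Matrix (Fin n × Fin n) (Fin n × Fin n) ℂ} (h : IsSLType n q R Psi) :
    IsCharData n q (opMat R) (ptr2 (opMat Psi)) := by
  have hdet := isUnit_det_opMat (isUnit_det_of_hecke hq h.hecke)
  have hbr : bond 3 0 (opMat R) * bond 3 1 (opMat R) * bond 3 0 (opMat R) =
      bond 3 1 (opMat R) * bond 3 0 (opMat R) * bond 3 1 (opMat R) := by
    have := congrArg (revHom n 3 ℂ) h.braid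
    simp only [map_mul, revHom_bond (show 0 + 1 < 3 by omega),
      revHom_bond (show 1 + 1 < 3 by omega)] at this
    exact this.symm
  have hhecke : (opMat R - q • (1 : Matrix (Fin n × Fin n) (Fin n × Fin n) ℂ)) *
      (opMat R + q⁻¹ • (1 : Matrix (Fin n × Fin n) (Fin n × Fin n) ℂ)) = 0 := by
    have := congrArg (opHom n ℂ) h.hecke
    simpa only [map_mul, map_sub, map_add, map_smul, map_one, map_zero, opHom_complex] using this
  have hl : ∀ a d c e : Fin n, ∑ b, ∑ b', opMat R (a, b) (c, b') * opMat Psi (b', d) (b, e) =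
      flipMat n (a, d) (c, e) := by
    intro a d c e
    have h1 := h.skew_right d a e c
    rw [Finset.sum_comm] at h1
    simp only [opMat, Matrix.of_apply, Prod.swap_prod_mk]
    calc _ = ∑ b, ∑ b', Psi (d, b') (e, b) * R (b, a) (b', c) := by simp only [mul_comm]
      _ = _ := h1
      _ = _ := by
        simp only [flipMat, Matrix.of_apply, Prod.swap_prod_mk, Prod.mk.injEq]
        congr 1
        rw [eq_iff_iff]
        tauto
  have hr : ∀ a d c e : Fin n, ∑ b, ∑ b', opMat Psi (a, b) (c, b') * opMat R (b', d) (b, e) =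
      flipMat n (a, d) (c, e) := by
    intro a d c e
    have h1 := h.skew_left d a e c
    rw [Finset.sum_comm] at h1
    simp only [opMat, Matrix.of_apply, Prod.swap_prod_mk]
    calc _ = ∑ b, ∑ b', R (d, b') (e, b) * Psi (b, a) (b', c) := by simp only [mul_comm]
      _ = _ := h1
      _ = _ := by
        simp only [flipMat, Matrix.of_apply, Prod.swap_prod_mk, Prod.mk.injEq]
        congr 1
        rw [eq_iff_iff]
        tauto
  refine ⟨hq, hdet, hbr, hhecke, h.qnum_ne_zero, trace_one_of_skew hl,
    traceConj_self_inv hdet hbr hl hr, kronecker_commute hdet hbr hl hr, ?_⟩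
  have hg := (isHeckeFamily_bond hq hbr hhecke (n + 1))
  have h1 := congrArg (revHom n (n + 1) ℂ) (gl_right_of_isSLType hq hn h)
  have h2 : revHom n (n + 1) ℂ (asym q (fun i => bond (n + 1) i R) n) =
      asym q (fun i => bond (n + 1) (i + 1) (opMat R)) n := by
    have hg' : IsHeckeFamily q (fun i => bond (n + 1) (i + 1) (opMat R)) (n - 1) :=
      IsHeckeFamily.shift (by rwa [show n + 1 - 1 = n - 1 + 1 by omega] at hg)
    rw [← asym_reverse hq hg' h.qnum_ne_zero]
    rw [show revHom n (n + 1) ℂ (asym q (fun i => bond (n + 1) i R) n) =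
      asym q (fun i => revHom n (n + 1) ℂ (bond (n + 1) i R)) n from
      map_asym (revHom n (n + 1) ℂ).toAlgHom q _ n]
    refine asym_congr fun i hi => ?_
    rw [revHom_bond (by omega)]
    congr 1
    omega
  have h3 : revHom n (n + 1) ℂ (bond (n + 1) (n - 1) R) = bond (n + 1) 0 (opMat R) := by
    rw [revHom_bond (by omega)]
    congr 1
    omega
  simpa only [map_sub, map_smul, map_mul, map_zero, h2, h3] using h1

theorem copy_bond_eq_overCopy (S : RData n) (m : ℕ) (L : Matrix (Fin n) (Fin n) A) (i : ℕ) :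
    S.overCopy m L i = copy (fun i => bond m i (scal A S.R)) (fun i => bond m i (scal A S.R⁻¹))
      (site m 0 L) i := by
  induction i with
  | zero => rfl
  | succ i ih => rw [RData.overCopy, copy, ih, scal_bond, scal_bond]

theorem charCoeff_eq_trM_wedge (S : RData n) (L : Matrix (Fin n) (Fin n) A) (i : ℕ) :
    S.charCoeff L i = trM S.D (wedge S.q S.R L i) := by
  rw [RData.charCoeff, wedge, antisymIn_eq_asym, ← scalHom_apply, map_asym]
  simp only [scalHom_apply, scal_bond]
  congr 4
  funext j
  exact copy_bond_eq_overCopy S i L j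

theorem revHom_underCopy (S : RData n) (hdet : IsUnit S.R.det) {m j : ℕ} (hj : j < m)
    (K : Matrix (Fin n) (Fin n) A) : revHom n m A (S.underCopy m K j) =
      copy (fun i => bond m i (scal A (opMat S.R))) (fun i => bond m i (scal A (opMat S.R)⁻¹))
        (site m 0 K) j := by
  induction j with
  | zero =>
    rw [RData.underCopy, revHom_site (by omega), Nat.sub_self]
    rfl
  | succ j ih =>
    rw [RData.underCopy, copy, map_mul, map_mul, ih (by omega), revHom_scal, revHom_scal,
      revHom_bond (by omega), revHom_bond (by omega), opMat_inv hdet, scal_bond, scal_bond,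
      show m - 2 - (m - 2 - j) = j by omega]

/-- Reversing the order of the tensor factors identifies the coefficients `b_m` with those built
from `R_op` in the way the `a_m` are built from `R`. -/
theorem charCoeffOp_eq_trM_wedge (S : RData n) (h : IsCharData n S.q (opMat S.R) S.Dop)
    (hdet : IsUnit S.R.det) (K : Matrix (Fin n) (Fin n) A) {m : ℕ} (hm : m ≤ n) :
    S.charCoeffOp K m = trM S.Dop (wedge S.q (opMat S.R) K m) := by
  rw [RData.charCoeffOp, ← trM_revHom, map_mul, revHom_scal, antisymIn_eq_asym, wedge]
  congr 2
  · rw [show revHom n m ℂ (asym S.q (fun i => bond m i S.R) m) =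
      asym S.q (fun i => revHom n m ℂ (bond m i S.R)) m from
      map_asym (revHom n m ℂ).toAlgHom S.q _ m]
    rw [asym_congr (g' := fun i => bond m (m - 2 - i) (opMat S.R))
        fun i hi => revHom_bond (by omega) S.R,
      asym_reverse h.q_ne_zero (isHeckeFamily_bond h.q_ne_zero h.braid h.hecke m)
        fun i h2 hi => h.qnum_ne_zero i h2 (by omega), ← scalHom_apply, map_asym]
    simp only [scalHom_apply, scal_bond]
  · rw [map_list_prod, List.map_map]
    congr 1
    exact List.map_congr_left fun j hj => revHom_underCopy S hdet (List.mem_range.1 hj) K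

end Reversal

/-! ### The reflection equation for `F = L T K T⁻¹` -/

section Reflection

/-- The relations of `T`, `L`, `K` imply the reflection equation for `L₁ M`, where
`M = T₁ K₁ T₁⁻¹`: the element `M` commutes with `R L₁ R` and satisfies
`R M R⁻¹ M = M R⁻¹ M R`. -/
theorem reflection_of_relations {H : Type*} [Ring H] [Algebra ℂ H] {c : ℂ} (hc : c ≠ 0)
    {R Ri T₁ T₁i T₂ T₂i L₁ L₂ K₁ K₂ : H} (hRi : R * Ri = 1)
    (hT₁ : T₁ * T₁i = 1) (hT₁' : T₁i * T₁ = 1) (hT₂ : T₂ * T₂i = 1) (hT₂' : T₂i * T₂ = 1)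
    (hTT : R * T₁ * T₂ = T₁ * T₂ * R) (hLT : R * L₁ * R * T₁ = c • (T₁ * L₂))
    (hKT : T₂ * R * K₂ * R = c • (K₁ * T₂)) (hKL : K₁ * L₂ = L₂ * K₁)
    (hLL : R * L₁ * R * L₁ = L₁ * R * L₁ * R) (hKK : R * K₂ * R * K₂ = K₂ * R * K₂ * R) :
    R * (L₁ * T₁ * K₁ * T₁i) * R * (L₁ * T₁ * K₁ * T₁i) =
      (L₁ * T₁ * K₁ * T₁i) * R * (L₁ * T₁ * K₁ * T₁i) * R := by
  -- `M` equals `c⁻¹ R W R` where `W` is the conjugate of `K₂` by `T₁ T₂`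
  obtain ⟨M, hM⟩ : ∃ M, M = T₁ * K₁ * T₁i := ⟨_, rfl⟩
  obtain ⟨W, hW⟩ : ∃ W, W = T₁ * T₂ * K₂ * (T₂i * T₁i) := ⟨_, rfl⟩
  have hu : T₂i * T₁i * (T₁ * T₂) = 1 := by
    rw [mul_assoc, ← mul_assoc T₁i, hT₁', one_mul, hT₂']
  have hu' : T₁ * T₂ * (T₂i * T₁i) = 1 := by
    rw [mul_assoc, ← mul_assoc T₂, hT₂, one_mul, hT₁]
  have hRu : Commute R (T₁ * T₂) := by rw [commute_iff_eq, ← mul_assoc, hTT]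
  have hRui : R * (T₂i * T₁i) = T₂i * T₁i * R := (commute_of_mul_eq_one hu' hu hRu).eq
  have hMW : c • M = R * W * R := by
    calc c • M = T₁ * (c • (K₁ * T₂)) * (T₂i * T₁i) := by
          rw [hM, mul_smul_comm, smul_mul_assoc]
          congr 1
          calc T₁ * K₁ * T₁i = T₁ * K₁ * (T₂ * T₂i) * T₁i := by rw [hT₂, mul_one]
            _ = _ := by noncomm_ring
      _ = (T₁ * T₂ * R) * K₂ * (R * (T₂i * T₁i)) := by rw [← hKT]; noncomm_ring
      _ = R * W * R := by rw [← hTT, hRui, hW]; noncomm_ring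
  have hWW : R * W * R * W = W * R * W * R := by
    calc R * W * R * W = R * (T₁ * T₂) * K₂ * ((T₂i * T₁i) * R) * (T₁ * T₂) * K₂ * (T₂i * T₁i) := by
          rw [hW]; noncomm_ring
      _ = (R * (T₁ * T₂)) * K₂ * R * ((T₂i * T₁i) * (T₁ * T₂)) * K₂ * (T₂i * T₁i) := by
          rw [← hRui]; noncomm_ring
      _ = T₁ * T₂ * (R * K₂ * R * K₂) * (T₂i * T₁i) := by rw [hu, hRu.eq]; noncomm_ring
      _ = T₁ * T₂ * K₂ * R * ((T₂i * T₁i) * (T₁ * T₂)) * K₂ * (R * (T₂i * T₁i)) := by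
          rw [hKK, hu]; noncomm_ring
      _ = T₁ * T₂ * K₂ * (R * (T₂i * T₁i)) * (T₁ * T₂) * K₂ * (R * (T₂i * T₁i)) := by noncomm_ring
      _ = W * R * W * R := by rw [hRui, hW]; noncomm_ring
  have hMM : R * M * Ri * M = M * Ri * M * R := by
    have h1 : c • c • (R * M * Ri * M) = R * (R * W * R * W) * R := by
      calc c • c • (R * M * Ri * M) = R * (c • M) * Ri * (c • M) := by
            simp only [mul_smul_comm, smul_mul_assoc]
        _ = R * R * W * (R * Ri) * R * W * R := by rw [hMW]; noncomm_ring
        _ = _ := by rw [hRi]; noncomm_ring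
    have h2 : c • c • (M * Ri * M * R) = R * (W * R * W * R) * R := by
      calc c • c • (M * Ri * M * R) = (c • M) * Ri * (c • M) * R := by
            simp only [mul_smul_comm, smul_mul_assoc]
        _ = R * W * (R * Ri) * R * W * R * R := by rw [hMW]; noncomm_ring
        _ = _ := by rw [hRi]; noncomm_ring
    rw [← hWW, ← h1] at h2
    exact (smul_right_injective H hc (smul_right_injective H hc h2)).symm
  have hLM : M * (R * L₁ * R) = R * L₁ * R * M := by
    have h1 : R * L₁ * R = c • (T₁ * L₂ * T₁i) := by
      rw [← smul_mul_assoc, ← hLT, mul_assoc (R * L₁ * R), hT₁, mul_one]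
    rw [h1, mul_smul_comm, smul_mul_assoc, hM]
    congr 1
    calc T₁ * K₁ * T₁i * (T₁ * L₂ * T₁i) = T₁ * K₁ * (T₁i * T₁) * L₂ * T₁i := by noncomm_ring
      _ = T₁ * (L₂ * K₁) * T₁i := by rw [hT₁', ← hKL]; noncomm_ring
      _ = T₁ * L₂ * (T₁i * T₁) * K₁ * T₁i := by rw [hT₁']; noncomm_ring
      _ = _ := by noncomm_ring
  have hLM' : M * R * L₁ = R * L₁ * R * M * Ri := by
    calc M * R * L₁ = M * (R * L₁ * R) * Ri := by
          simp only [mul_assoc, hRi, mul_one]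
      _ = _ := by rw [hLM]
  rw [show L₁ * T₁ * K₁ * T₁i = L₁ * M by rw [hM]; noncomm_ring]
  calc R * (L₁ * M) * R * (L₁ * M) = R * L₁ * (M * R * L₁) * M := by noncomm_ring
    _ = (R * L₁ * R * L₁) * (R * M * Ri * M) := by rw [hLM']; noncomm_ring
    _ = L₁ * (R * L₁ * R * M * Ri) * M * R := by rw [hLL, hMM]; noncomm_ring
    _ = _ := by rw [← hLM']; noncomm_ring

theorem leg1_mul {n : ℕ} {A : Type*} [Ring A] (X Y : Matrix (Fin n) (Fin n) A) :
    leg1 (X * Y) = leg1 X * leg1 Y := by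
  ext ⟨a, b⟩ ⟨c, d⟩
  simp only [leg1, Matrix.of_apply, Matrix.mul_apply, Fintype.sum_prod_type]
  by_cases h : b = d <;> simp [h]

theorem leg2_mul {n : ℕ} {A : Type*} [Ring A] (X Y : Matrix (Fin n) (Fin n) A) :
    leg2 (X * Y) = leg2 X * leg2 Y := by
  ext ⟨a, b⟩ ⟨c, d⟩
  simp only [leg2, Matrix.of_apply, Matrix.mul_apply, Fintype.sum_prod_type]
  by_cases h : a = c <;> simp [h]

theorem leg1_one {n : ℕ} {A : Type*} [Ring A] : leg1 (1 : Matrix (Fin n) (Fin n) A) = 1 := by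
  ext ⟨a, b⟩ ⟨c, d⟩
  simp only [leg1, Matrix.of_apply, Matrix.one_apply, Prod.mk.injEq]
  by_cases h : b = d <;> simp [h]

theorem leg2_one {n : ℕ} {A : Type*} [Ring A] : leg2 (1 : Matrix (Fin n) (Fin n) A) = 1 := by
  ext ⟨a, b⟩ ⟨c, d⟩
  simp only [leg2, Matrix.of_apply, Matrix.one_apply, Prod.mk.injEq]
  by_cases h : a = c <;> simp [h]

end Reflection

/-! ### Shifts of Gaussian exponentials -/

section Gauss

variable {n : ℕ}

namespace Entire

theorem ext' {f g : Entire n} (h : ∀ x, (f : (Fin n → ℂ) → ℂ) x = (g : (Fin n → ℂ) → ℂ) x) : f = g :=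
  Subtype.ext (funext h)

/-- The function `x ↦ exp (a ∑ x_α)`. -/
noncomputable def expSum (n : ℕ) (a : ℂ) : Entire n :=
  ⟨fun x => Complex.exp (a * ∑ α, x α), by
    have h : ∀ α : Fin n, Differentiable ℂ fun x : Fin n → ℂ => x α :=
      fun α => differentiable_apply (𝕜 := ℂ) α
    exact ((Differentiable.fun_sum fun α _ => h α).const_mul a).cexp⟩

/-- `exp (a ∑ x_α) - 1` is divisible by `∑ x_α` in the algebra of entire functions. Hence the
relation `∑ x_α = 0` of the extended calculus entails `exp (a ∑ x_α) = 1`. -/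
theorem exists_expSum_eq (n : ℕ) (a : ℂ) :
    ∃ h : Entire n, expSum n a = 1 + (∑ α, coord α) * h := by
  have hd : Differentiable ℂ (dslope (fun w : ℂ => Complex.exp (a * w)) 0) := by
    rw [← differentiableOn_univ, Complex.differentiableOn_dslope Filter.univ_mem]
    exact (differentiable_id.const_mul a).cexp.differentiableOn
  have hs : Differentiable ℂ fun x : Fin n → ℂ => ∑ α, x α :=
    Differentiable.fun_sum fun α _ => differentiable_apply (𝕜 := ℂ) α
  refine ⟨⟨fun x => dslope (fun w : ℂ => Complex.exp (a * w)) 0 (∑ α, x α), hd.comp hs⟩, ?_⟩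
  refine ext' fun x => ?_
  have h1 : ((∑ α, coord α : Entire n) : (Fin n → ℂ) → ℂ) x = ∑ α, x α := by
    rw [AddSubmonoidClass.coe_finsetSum, Finset.sum_apply]
    rfl
  have h2 := sub_smul_dslope (fun w : ℂ => Complex.exp (a * w)) 0 (∑ α, x α)
  show Complex.exp (a * ∑ α, x α) = 1 + ((∑ α, coord α : Entire n) : (Fin n → ℂ) → ℂ) x *
    dslope (fun w : ℂ => Complex.exp (a * w)) 0 (∑ α, x α)
  rw [h1]
  rw [sub_zero, smul_eq_mul, mul_zero, Complex.exp_zero] at h2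
  rw [h2]
  ring

theorem gauss_zero : (gauss 0 : Entire n) = 1 := by
  refine ext' fun x => ?_
  show Complex.exp (0 * _) = 1
  simp

theorem gauss_neg_mul_gauss (c : ℂ) : (gauss (-c) : Entire n) * gauss c = 1 := by
  rw [mul_comm, gauss_mul_gauss_neg]

theorem shift_mul (v : Fin n → ℂ) (f g : Entire n) : shift v (f * g) = shift v f * shift v g := rfl

theorem shift_one (v : Fin n → ℂ) : shift v (1 : Entire n) = 1 := rfl

end Entire

open Entire

variable (S : RData n)

/-- The constant in the exponent of the Gaussian exponentials `φ_{(t₁,t₂,t₃)}`. -/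
noncomputable def RData.gaussConst : ℂ := -(Complex.I * Real.pi / (2 * S.tau))

/-- Up to a factor `exp (a ∑ x_α)`, which is `1` on the hyperplane `∑ x_α = 0`, the shift of a
Gaussian exponential by `2τ (e_β - n⁻¹ (1,…,1))` is multiplication by the eigenvalue `q μ_β`. -/
theorem gauss_mul_shiftT (hn : 1 ≤ n) (hτ : S.tau ≠ 0) (β : Fin n) :
    gauss S.gaussConst * shift (S.shiftT β) (gauss (-S.gaussConst)) =
      S.q • expCoord (S.qpow (-(1 / (n : ℂ)))) β *
        expSum n (-(2 * Real.pi * Complex.I / n)) := by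
  have hn0 : (n : ℂ) ≠ 0 := by exact_mod_cast (by omega : n ≠ 0)
  refine ext' fun x => ?_
  have hsum : ∑ α, (x α + S.shiftT β α) ^ 2 = ∑ α, x α ^ 2 + 4 * S.tau * x β -
      4 * S.tau / n * ∑ α, x α + 4 * S.tau ^ 2 * (1 - 1 / n) := by
    have e : ∀ α, (x α + S.shiftT β α) ^ 2 = x α ^ 2 + (if α = β then 4 * S.tau * x α else 0) -
        4 * S.tau / n * x α + (if α = β then 4 * S.tau ^ 2 * (1 - 2 / n) else 0) +
        4 * S.tau ^ 2 / n ^ 2 := by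
      intro α
      simp only [RData.shiftT]
      split_ifs <;> field_simp <;> ring
    simp only [e, Finset.sum_add_distrib, Finset.sum_sub_distrib, ← Finset.mul_sum,
      Finset.sum_ite_eq', Finset.mem_univ, if_true, Finset.sum_const, Finset.card_univ,
      Fintype.card_fin, nsmul_eq_mul]
    field_simp
    ring
  show Complex.exp (S.gaussConst * ∑ α, x α ^ 2) *
      Complex.exp (-S.gaussConst * ∑ α, (x α + S.shiftT β α) ^ 2) =
    S.q * (S.qpow (-(1 / (n : ℂ))) * Complex.exp (2 * Real.pi * Complex.I * x β)) *
      Complex.exp (-(2 * Real.pi * Complex.I / n) * ∑ α, x α)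
  rw [hsum, RData.q, RData.qpow, RData.qpow, ← Complex.exp_add, ← Complex.exp_add,
    ← Complex.exp_add, ← Complex.exp_add, RData.gaussConst]
  congr 1
  field_simp
  ring

/-- The shift of a Gaussian exponential by `2τ (e_β - e_σ)` is multiplication by the ratio of the
eigenvalues with numbers `β` and `σ`, the latter being shifted, too. -/
theorem gauss_mul_shiftX (hτ : S.tau ≠ 0) (c : ℂ) (β σ : Fin n) :
    gauss S.gaussConst * shift (S.shiftX β σ) (gauss (-S.gaussConst) * expCoord c σ) =
      expCoord c β := by
  refine ext' fun x => ?_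
  show Complex.exp (S.gaussConst * ∑ α, x α ^ 2) *
      (Complex.exp (-S.gaussConst * ∑ α, (x α + S.shiftX β σ α) ^ 2) *
        (c * Complex.exp (2 * Real.pi * Complex.I * (x σ + S.shiftX β σ σ)))) =
    c * Complex.exp (2 * Real.pi * Complex.I * x β)
  rw [mul_left_comm _ c, mul_left_comm _ c, ← Complex.exp_add, ← Complex.exp_add]
  congr 2
  by_cases h : β = σ
  · subst h
    simp [RData.shiftX]
  · have hsum : ∑ α, (x α + S.shiftX β σ α) ^ 2 = ∑ α, x α ^ 2 + 4 * S.tau * (x β - x σ) +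
        8 * S.tau ^ 2 := by
      have e : ∀ α, (x α + S.shiftX β σ α) ^ 2 = x α ^ 2 +
          (if α = β then 4 * S.tau * x α + 4 * S.tau ^ 2 else 0) +
          (if α = σ then - 4 * S.tau * x α + 4 * S.tau ^ 2 else 0) := by
        intro α
        simp only [RData.shiftX]
        by_cases h1 : α = β
        · subst h1
          simp only [if_true, if_neg h]
          ring
        · simp only [if_neg h1]
          split_ifs <;> ring
      simp only [e, Finset.sum_add_distrib, Finset.sum_ite_eq', Finset.mem_univ, if_true]
      ring
    rw [hsum, RData.gaussConst, RData.shiftX, if_neg (Ne.symm h), if_pos rfl]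
    field_simp
    ring

/-- The form of `gauss_mul_shiftX` for the inverse Gaussian exponentials. -/
theorem gauss_neg_mul_shiftX (hτ : S.tau ≠ 0) (c : ℂ) (β σ : Fin n) :
    gauss (-S.gaussConst) * expCoord c β * shift (S.shiftX β σ) (gauss S.gaussConst) =
      shift (S.shiftX β σ) (expCoord c σ) := by
  have h1 : gauss (-S.gaussConst) * gauss S.gaussConst = (1 : Entire n) := gauss_neg_mul_gauss _
  have h2 : shift (S.shiftX β σ) (gauss (-S.gaussConst)) *
      shift (S.shiftX β σ) (gauss S.gaussConst) = 1 := by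
    rw [← shift_mul, h1, shift_one]
  rw [← gauss_mul_shiftX S hτ c β σ, shift_mul, ← mul_assoc, h1, one_mul, mul_right_comm, h2,
    one_mul]

end Gauss

/-! ### Relations in the extended calculus -/

section Relations

variable {n : ℕ}

theorem map_scalar {A B : Type*} [Ring A] [Ring B] [Algebra ℂ A] [Algebra ℂ B] (f : A →ₐ[ℂ] B)
    (x : A) : (Matrix.scalar (Fin n) x).map f = Matrix.scalar (Fin n) (f x) := by
  ext i j
  simp only [Matrix.map_apply, Matrix.scalar_apply, Matrix.diagonal_apply]
  split_ifs <;> simp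

theorem specProj_eq_lagrange {A : Type*} [Ring A] [Algebra ℂ A] (q : ℂ)
    (X : Matrix (Fin n) (Fin n) A) (ξ : Fin n → A) (δ : (α β : Fin n) → α ≠ β → A) (α : Fin n) :
    specProj q X ξ δ α = lagrange q X (fun β => Matrix.scalar (Fin n) (ξ β))
      (fun α β h => Matrix.scalar (Fin n) (δ α β h)) α := by
  rw [specProj, lagrange]
  congr 1
  refine List.map_congr_left fun β _ => ?_
  split_ifs with h
  · rfl
  · ext i j
    simp only [Matrix.smul_apply, Matrix.sub_apply, Matrix.scalar_apply, Matrix.smul_eq_diagonal_mul,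
      Matrix.diagonal_mul, smul_mul_assoc, smul_eq_mul, Matrix.one_apply, Matrix.diagonal_apply]
    split_ifs <;> simp

theorem specProj_map {A B : Type*} [Ring A] [Ring B] [Algebra ℂ A] [Algebra ℂ B] (f : A →ₐ[ℂ] B)
    (q : ℂ) (X : Matrix (Fin n) (Fin n) A) (ξ : Fin n → A) (δ : (α β : Fin n) → α ≠ β → A)
    (α : Fin n) : (specProj q X ξ δ α).map f =
      specProj q (X.map f) (fun β => f (ξ β)) (fun α β h => f (δ α β h)) α := by
  rw [specProj_eq_lagrange, specProj_eq_lagrange]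
  have := map_lagrange f.mapMatrix q X (fun β => Matrix.scalar (Fin n) (ξ β))
    (fun α β h => Matrix.scalar (Fin n) (δ α β h)) α
  simpa only [AlgHom.mapMatrix_apply, map_scalar] using this

theorem map_one_matrix {A B : Type*} [Ring A] [Ring B] [Algebra ℂ A] [Algebra ℂ B] (f : A →ₐ[ℂ] B) :
    (1 : Matrix (Fin n) (Fin n) A).map f = 1 :=
  Matrix.map_one f (map_zero f) (map_one f)

/-- The invertibility relations among the defining relations of the calculus. -/
structure CalcData.IsInvertible {A : Type*} [Ring A] [Algebra ℂ A] (S : RData n)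
    (d : CalcData n A) : Prop where
  T_Tinv : d.T * d.Tinv = 1
  Tinv_T : d.Tinv * d.T = 1
  L_Linv : d.L * d.Linv = 1
  Linv_L : d.Linv * d.L = 1
  K_Kinv : d.K * d.Kinv = 1
  Kinv_K : d.Kinv * d.K = 1
  detT_inv : S.detT d.T * d.detTinv = 1
  inv_detT : d.detTinv * S.detT d.T = 1
  detL_inv : S.charCoeff d.L n * d.detLinv = 1
  inv_detL : d.detLinv * S.charCoeff d.L n = 1
  detK_inv : S.charCoeffOp d.K n * d.detKinv = 1
  inv_detK : d.detKinv * S.charCoeffOp d.K n = 1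

theorem CalcData.isInvertible_map {A B : Type*} [Ring A] [Ring B] [Algebra ℂ A] [Algebra ℂ B]
    {S : RData n} {k : Kind} {d : CalcData n A} (f : A →ₐ[ℂ] B)
    (h : ∀ a b, CalcRel S k d a b → f a = f b) : (d.map f).IsInvertible S := by
  have h1 : ∀ M N, CalcRel1 d M N → M.map f = N.map f := fun M N hMN => by
    ext i j
    exact h _ _ (CalcRel.inv hMN i j)
  constructor
  · simpa only [CalcData.map, matrix_mul_map, map_one_matrix] using h1 _ _ CalcRel1.T_Tinv
  · simpa only [CalcData.map, matrix_mul_map, map_one_matrix] using h1 _ _ CalcRel1.Tinv_T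
  · simpa only [CalcData.map, matrix_mul_map, map_one_matrix] using h1 _ _ CalcRel1.L_Linv
  · simpa only [CalcData.map, matrix_mul_map, map_one_matrix] using h1 _ _ CalcRel1.Linv_L
  · simpa only [CalcData.map, matrix_mul_map, map_one_matrix] using h1 _ _ CalcRel1.K_Kinv
  · simpa only [CalcData.map, matrix_mul_map, map_one_matrix] using h1 _ _ CalcRel1.Kinv_K
  · simpa only [CalcData.map, map_mul, map_one, detT_map] using h _ _ CalcRel.detT_inv
  · simpa only [CalcData.map, map_mul, map_one, detT_map] using h _ _ CalcRel.inv_detT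
  · simpa only [CalcData.map, map_mul, map_one, charCoeff_map] using h _ _ CalcRel.detL_inv
  · simpa only [CalcData.map, map_mul, map_one, charCoeff_map] using h _ _ CalcRel.inv_detL
  · simpa only [CalcData.map, map_mul, map_one, charCoeffOp_map] using h _ _ CalcRel.detK_inv
  · simpa only [CalcData.map, map_mul, map_one, charCoeffOp_map] using h _ _ CalcRel.inv_detK

/-- A homomorphism of the calculus is determined by its values on `T`, `Ω`, `L` and `K`. -/
theorem CalcData.IsInvertible.map_eq {A B : Type*} [Ring A] [Ring B] [Algebra ℂ A] [Algebra ℂ B]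
    {S : RData n} {d : CalcData n A} (h : d.IsInvertible S) {f g : A →ₐ[ℂ] B}
    (hT : d.T.map f = d.T.map g) (hO : d.Omega.map f = d.Omega.map g)
    (hL : d.L.map f = d.L.map g) (hK : d.K.map f = d.K.map g) : d.map f = d.map g := by
  have key : ∀ X Xi : Matrix (Fin n) (Fin n) A, X * Xi = 1 → Xi * X = 1 → X.map f = X.map g →
      Xi.map f = Xi.map g := by
    intro X Xi h1 h2 h3
    have e1 : Xi.map f * X.map f = 1 := by rw [← matrix_mul_map, h2, map_one_matrix]
    have e2 : X.map f * Xi.map g = 1 := by rw [h3, ← matrix_mul_map, h1, map_one_matrix]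
    exact left_inv_eq_right_inv e1 e2
  have key' : ∀ x y : A, x * y = 1 → y * x = 1 → f x = g x → f y = g y := by
    intro x y h1 h2 h3
    have e1 : f y * f x = 1 := by rw [← map_mul, h2, map_one]
    have e2 : f x * g y = 1 := by rw [h3, ← map_mul, h1, map_one]
    exact left_inv_eq_right_inv e1 e2
  simp only [CalcData.map, CalcData.mk.injEq]
  refine ⟨hT, key _ _ h.T_Tinv h.Tinv_T hT, hO, hL, key _ _ h.L_Linv h.Linv_L hL, hK,
    key _ _ h.K_Kinv h.Kinv_K hK, key' _ _ h.detT_inv h.inv_detT ?_,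
    key' _ _ h.detL_inv h.inv_detL ?_, key' _ _ h.detK_inv h.inv_detK ?_⟩
  · rw [detT_map, detT_map, hT]
  · rw [charCoeff_map, charCoeff_map, hL]
  · rw [charCoeffOp_map, charCoeffOp_map, hK]

theorem CalcData.F_map {A B : Type*} [Ring A] [Ring B] [Algebra ℂ A] [Algebra ℂ B]
    (d : CalcData n A) (f : A →ₐ[ℂ] B) : (d.map f).F = d.F.map f := by
  simp only [CalcData.F, CalcData.map, matrix_mul_map]

theorem CalcData.Finv_map {A B : Type*} [Ring A] [Ring B] [Algebra ℂ A] [Algebra ℂ B]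
    (d : CalcData n A) (f : A →ₐ[ℂ] B) : (d.map f).Finv = d.Finv.map f := by
  simp only [CalcData.Finv, CalcData.map, matrix_mul_map]

theorem CalcData.Theta_map {A B : Type*} [Ring A] [Ring B] [Algebra ℂ A] [Algebra ℂ B]
    (d : CalcData n A) (f : A →ₐ[ℂ] B) : (d.map f).Theta = d.Theta.map f := by
  simp only [CalcData.Theta, CalcData.map, matrix_mul_map]

theorem CalcData.IsInvertible.F_Finv {A : Type*} [Ring A] [Algebra ℂ A] {S : RData n}
    {d : CalcData n A} (h : d.IsInvertible S) : d.F * d.Finv = 1 := by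
  calc d.F * d.Finv = d.L * d.T * d.K * (d.Tinv * d.T) * d.Kinv * d.Tinv * d.Linv := by
        simp only [CalcData.F, CalcData.Finv, mul_assoc]
    _ = d.L * d.T * (d.K * d.Kinv) * d.Tinv * d.Linv := by
        rw [h.Tinv_T]; simp only [mul_assoc, one_mul]
    _ = d.L * (d.T * d.Tinv) * d.Linv := by rw [h.K_Kinv]; simp only [mul_assoc, one_mul]
    _ = 1 := by rw [h.T_Tinv, mul_one, h.L_Linv]

theorem CalcData.IsInvertible.Finv_F {A : Type*} [Ring A] [Algebra ℂ A] {S : RData n}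
    {d : CalcData n A} (h : d.IsInvertible S) : d.Finv * d.F = 1 := by
  calc d.Finv * d.F = d.T * d.Kinv * d.Tinv * (d.Linv * d.L) * d.T * d.K * d.Tinv := by
        simp only [CalcData.F, CalcData.Finv, mul_assoc]
    _ = d.T * d.Kinv * (d.Tinv * d.T) * d.K * d.Tinv := by
        rw [h.Linv_L]; simp only [mul_assoc, one_mul]
    _ = d.T * (d.Kinv * d.K) * d.Tinv := by rw [h.Tinv_T]; simp only [mul_assoc, one_mul]
    _ = 1 := by rw [h.Kinv_K, mul_one, h.T_Tinv]

end Relations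

/-! ### Models of the extended calculus -/

section Model

variable {n : ℕ}

/-- The matrix `f(ξ) · 1`, where `f` is a power series in the variables of the family `s`. -/
def LogData.fnMat {A : Type*} [Ring A] (d : LogData n A) (s : Fin 3) (f : Entire n) :
    Matrix (Fin n) (Fin n) A :=
  Matrix.scalar (Fin n) (d.fn s f)

/-- Those relations of the extended calculus which determine the action of the automorphisms,
written in terms of matrices. -/
structure LogData.IsModel {A : Type*} [Ring A] [Algebra ℂ A] (S : RData n) (d : LogData n A) :
    Prop where
  isInvertible : d.toCalcData.IsInvertible S
  RTT : scal A S.R * leg1 d.T * leg2 d.T = leg1 d.T * leg2 d.T * scal A S.R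
  LL : ReflectionEq S.R d.L
  LT : scal A S.R * leg1 d.L * scal A S.R * leg1 d.T = S.gamma ^ 2 • (leg1 d.T * leg2 d.L)
  KK : scal A S.R * leg2 d.K * scal A S.R * leg2 d.K = leg2 d.K * scal A S.R * leg2 d.K * scal A S.R
  KT : leg2 d.T * scal A S.R * leg2 d.K * scal A S.R = S.gamma ^ 2 • (leg1 d.K * leg2 d.T)
  KL : leg1 d.K * leg2 d.L = leg2 d.L * leg1 d.K
  mul_inv (s : Fin 3) (α : Fin n) : d.xi s α * d.xiInv s α = 1
  inv_mul (s : Fin 3) (α : Fin n) : d.xiInv s α * d.xi s α = 1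
  mul_diffInv (s : Fin 3) (α β : Fin n) (h : α ≠ β) :
    (d.xi s α - d.xi s β) * d.xiDiffInv s α β h = 1
  diffInv_mul (s : Fin 3) (α β : Fin n) (h : α ≠ β) :
    d.xiDiffInv s α β h * (d.xi s α - d.xi s β) = 1
  param_L (i : ℕ) (hi : i ≤ n) : S.charCoeff d.L i = esymm (d.xi 0) i
  param_K (i : ℕ) (hi : i ≤ n) : S.charCoeffOp d.K i = esymm (d.xi 1) i
  param_F (i : ℕ) (hi : i ≤ n) : S.charCoeff d.F i = esymm (d.xi 2) i
  const (s : Fin 3) (c : ℂ) : d.fn s (algebraMap ℂ (Entire n) c) = algebraMap ℂ A c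
  add (s : Fin 3) (f g : Entire n) : d.fn s (f + g) = d.fn s f + d.fn s g
  mul (s : Fin 3) (f g : Entire n) : d.fn s (f * g) = d.fn s f * d.fn s g
  comm (s t : Fin 3) (f g : Entire n) : d.fn s f * d.fn t g = d.fn t g * d.fn s f
  sum_coord (s : Fin 3) : ∑ α, d.fn s (Entire.coord α) = 0
  xi_eq (s : Fin 3) (α : Fin n) : d.xi s α = d.fn s (Entire.expCoord (S.logNorm s) α)
  x_comm (X : Matrix (Fin n) (Fin n) A) (hX : X ∈ [d.L, d.K, d.Theta]) (f : Entire n) :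
    d.fnMat 0 f * X = X * d.fnMat 0 f
  y_comm (X : Matrix (Fin n) (Fin n) A) (hX : X ∈ [d.L, d.K, d.Omega, d.F]) (f : Entire n) :
    d.fnMat 1 f * X = X * d.fnMat 1 f
  z_comm (X : Matrix (Fin n) (Fin n) A) (hX : X ∈ [d.T, d.L, d.K, d.F]) (f : Entire n) :
    d.fnMat 2 f * X = X * d.fnMat 2 f
  T_x (f : Entire n) (β : Fin n) :
    d.P S.q β * d.T * d.fnMat 0 f = d.fnMat 0 (Entire.shift (S.shiftT β) f) * (d.P S.q β * d.T)
  T_y (f : Entire n) (β : Fin n) :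
    d.fnMat 1 f * (d.T * d.Q S.q β) = d.T * d.Q S.q β * d.fnMat 1 (Entire.shift (S.shiftT β) f)
  X_x (X : Matrix (Fin n) (Fin n) A) (hX : X ∈ [d.Omega, d.F]) (f : Entire n) (β σ : Fin n) :
    d.P S.q β * X * d.P S.q σ * d.fnMat 0 f =
      d.fnMat 0 (Entire.shift (S.shiftX β σ) f) * (d.P S.q β * X * d.P S.q σ)
  Theta_y (f : Entire n) (β σ : Fin n) :
    d.Q S.q β * d.Theta * d.Q S.q σ * d.fnMat 1 f =
      d.fnMat 1 (Entire.shift (S.shiftX β σ) f) * (d.Q S.q β * d.Theta * d.Q S.q σ)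
  Omega_z (f : Entire n) (β σ : Fin n) :
    d.S S.q β * d.Omega * d.S S.q σ * d.fnMat 2 f =
      d.fnMat 2 (Entire.shift (S.shiftX β σ) f) * (d.S S.q β * d.Omega * d.S S.q σ)

theorem LogData.fnMat_mul_apply {A : Type*} [Ring A] (d : LogData n A) (s : Fin 3) (f : Entire n)
    (X : Matrix (Fin n) (Fin n) A) (i j : Fin n) : (d.fnMat s f * X) i j = d.fn s f * X i j := by
  simp [LogData.fnMat]

theorem LogData.mul_fnMat_apply {A : Type*} [Ring A] (d : LogData n A) (s : Fin 3) (f : Entire n)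
    (X : Matrix (Fin n) (Fin n) A) (i j : Fin n) : (X * d.fnMat s f) i j = X i j * d.fn s f := by
  simp [LogData.fnMat]

theorem SpecData.P_map {A B : Type*} [Ring A] [Ring B] [Algebra ℂ A] [Algebra ℂ B]
    (d : LogData n A) (f : A →ₐ[ℂ] B) (q : ℂ) (α : Fin n) :
    (d.map f).P q α = (d.P q α).map f :=
  (specProj_map f q d.L (d.xi 0) (d.xiDiffInv 0) α).symm

theorem SpecData.Q_map {A B : Type*} [Ring A] [Ring B] [Algebra ℂ A] [Algebra ℂ B]
    (d : LogData n A) (f : A →ₐ[ℂ] B) (q : ℂ) (α : Fin n) :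
    (d.map f).Q q α = (d.Q q α).map f :=
  (specProj_map f q d.K (d.xi 1) (d.xiDiffInv 1) α).symm

theorem SpecData.S_map {A B : Type*} [Ring A] [Ring B] [Algebra ℂ A] [Algebra ℂ B]
    (d : LogData n A) (f : A →ₐ[ℂ] B) (q : ℂ) (α : Fin n) :
    (d.map f).S q α = (d.S q α).map f := by
  rw [SpecData.S, SpecData.S, specProj_map, ← CalcData.F_map]
  rfl

theorem LogData.isModel_map {A B : Type*} [Ring A] [Ring B] [Algebra ℂ A] [Algebra ℂ B]
    {S : RData n} {k : Kind} {d : LogData n A} (f : A →ₐ[ℂ] B)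
    (h : ∀ a b, ExtRel S k d a b → f a = f b) : (d.map f).IsModel S := by
  have h2 : ∀ M N, CalcRel2 S k d.toCalcData M N → M.map f = N.map f := fun M N hMN => by
    ext u v
    exact h _ _ (.calc (CalcRel.perm hMN u v))
  have hs : ∀ {a b}, SpecRel S d.toSpecData a b → f a = f b := fun hab => h _ _ (.spec hab)
  have hl : ∀ {a b}, LogRel S d a b → f a = f b := fun hab => h _ _ (.log hab)
  have hsmul : ∀ (c : ℂ) (M : Matrix (Fin n × Fin n) (Fin n × Fin n) A),
      (c • M).map f = c • M.map f := by
    intro c M; ext; simp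
  have hesymm : ∀ (ξ : Fin n → A) (i : ℕ), f (esymm ξ i) = esymm (fun β => f (ξ β)) i :=
    fun ξ i => map_esymm (f : A →+* B) ξ i
  have hfnl : ∀ s g (X : Matrix (Fin n) (Fin n) A) i j,
      ((d.map f).fnMat s g * X.map f) i j = f (d.fn s g * X i j) := fun s g X i j => by
    rw [fnMat_mul_apply, map_mul]; rfl
  have hfnr : ∀ s g (X : Matrix (Fin n) (Fin n) A) i j,
      (X.map f * (d.map f).fnMat s g) i j = f (X i j * d.fn s g) := fun s g X i j => by
    rw [mul_fnMat_apply, map_mul]; rfl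
  have hmem : ∀ (l : List (Matrix (Fin n) (Fin n) A)) (X : Matrix (Fin n) (Fin n) B),
      X ∈ l.map (fun M => M.map f) → ∃ X₀ ∈ l, X = X₀.map f := by
    intro l X hX
    obtain ⟨X₀, h1, h2⟩ := List.mem_map.1 hX
    exact ⟨X₀, h1, h2.symm⟩
  have hF : (d.map f).F = d.F.map f := CalcData.F_map d.toCalcData f
  have hTh : (d.map f).Theta = d.Theta.map f := CalcData.Theta_map d.toCalcData f
  constructor
  · exact CalcData.isInvertible_map (d := d.toCalcData) f fun a b hab => h a b (.calc hab)
  · have e := h2 _ _ CalcRel2.RTT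
    simp only [matrix_mul_map, scal_map, leg1_map, leg2_map] at e
    exact e
  · have e := h2 _ _ CalcRel2.LL
    simp only [matrix_mul_map, scal_map, leg1_map] at e
    exact e
  · have e := h2 _ _ CalcRel2.LT
    simp only [matrix_mul_map, scal_map, leg1_map, leg2_map, hsmul] at e
    exact e
  · have e := h2 _ _ CalcRel2.KK
    simp only [matrix_mul_map, scal_map, leg2_map] at e
    exact e
  · have e := h2 _ _ CalcRel2.KT
    simp only [matrix_mul_map, scal_map, leg1_map, leg2_map, hsmul] at e
    exact e
  · have e := h2 _ _ CalcRel2.KL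
    simp only [matrix_mul_map, leg1_map, leg2_map] at e
    exact e
  · intro s α
    have e := hs (.mul_inv s α)
    simp only [map_mul, map_one] at e
    exact e
  · intro s α
    have e := hs (.inv_mul s α)
    simp only [map_mul, map_one] at e
    exact e
  · intro s α β hαβ
    have e := hs (.mul_diffInv s α β hαβ)
    simp only [map_mul, map_one, map_sub] at e
    exact e
  · intro s α β hαβ
    have e := hs (.diffInv_mul s α β hαβ)
    simp only [map_mul, map_one, map_sub] at e
    exact e
  · intro i hi
    have e := hs (.param_L i hi)
    simp only [charCoeff_map, hesymm] at e
    exact e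
  · intro i hi
    have e := hs (.param_K i hi)
    simp only [charCoeffOp_map, hesymm] at e
    exact e
  · intro i hi
    rw [hF]
    have e := hs (.param_F i hi)
    simp only [charCoeff_map, hesymm] at e
    exact e
  · intro s c
    have e := hl (.const s c)
    simp only [AlgHom.commutes] at e
    exact e
  · intro s g₁ g₂
    have e := hl (.add s g₁ g₂)
    simp only [map_add] at e
    exact e
  · intro s g₁ g₂
    have e := hl (.mul s g₁ g₂)
    simp only [map_mul] at e
    exact e
  · intro s t g₁ g₂
    have e := hl (.comm s t g₁ g₂)
    simp only [map_mul] at e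
    exact e
  · intro s
    have e := hl (.sum_coord s)
    simp only [map_sum, map_zero] at e
    exact e
  · exact fun s α => hl (.xi_eq s α)
  · intro X hX g
    obtain ⟨X₀, h1, rfl⟩ := hmem [d.L, d.K, d.Theta] X (by rw [hTh] at hX; exact hX)
    ext i j
    rw [hfnl, hfnr]
    refine hl (.x_comm X₀ ?_ g i j)
    simp only [List.mem_cons, List.not_mem_nil, or_false] at h1 ⊢
    tauto
  · intro X hX g
    obtain ⟨X₀, h1, rfl⟩ := hmem [d.L, d.K, d.Omega, d.F] X (by rw [hF] at hX; exact hX)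
    ext i j
    rw [hfnl, hfnr]
    exact hl (.y_comm X₀ h1 g i j)
  · intro X hX g
    obtain ⟨X₀, h1, rfl⟩ := hmem [d.T, d.L, d.K, d.F] X (by rw [hF] at hX; exact hX)
    ext i j
    rw [hfnl, hfnr]
    refine hl (.z_comm X₀ ?_ g i j)
    simp only [List.mem_cons, List.not_mem_nil, or_false] at h1 ⊢
    tauto
  · intro g β
    have e : (d.map f).P S.q β * (d.map f).T = (d.P S.q β * d.T).map f := by
      rw [SpecData.P_map, matrix_mul_map]; rfl
    rw [e]
    ext i j
    rw [hfnl, hfnr]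
    exact hl (.T_x g β i j)
  · intro g β
    have e : (d.map f).T * (d.map f).Q S.q β = (d.T * d.Q S.q β).map f := by
      rw [SpecData.Q_map, matrix_mul_map]; rfl
    rw [e]
    ext i j
    rw [hfnl, hfnr]
    exact hl (.T_y g β i j)
  · intro X hX g β σ
    obtain ⟨X₀, h1, rfl⟩ := hmem [d.Omega, d.F] X (by rw [hF] at hX; exact hX)
    rw [SpecData.P_map, SpecData.P_map, ← matrix_mul_map, ← matrix_mul_map]
    ext i j
    rw [hfnl, hfnr]
    exact hl (.X_x X₀ h1 g β σ i j)
  · intro g β σ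
    rw [SpecData.Q_map, SpecData.Q_map, hTh, ← matrix_mul_map, ← matrix_mul_map]
    ext i j
    rw [hfnl, hfnr]
    exact hl (.Y_y d.Theta (by simp) g β σ i j)
  · intro g β σ
    have e : (d.map f).S S.q β * (d.map f).Omega * (d.map f).S S.q σ =
        (d.S S.q β * d.Omega * d.S S.q σ).map f := by
      rw [SpecData.S_map, SpecData.S_map, matrix_mul_map, matrix_mul_map]; rfl
    rw [e]
    ext i j
    rw [hfnl, hfnr]
    exact hl (.Omega_z g β σ i j)

end Model

/-! ### Spectral decompositions of `L`, `K` and `F` -/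

section Spectral

variable {n : ℕ} {A : Type*} [Ring A] [Algebra ℂ A] {S : RData n} {d : LogData n A}

theorem RData.qpow_ne_zero (S : RData n) (c : ℂ) : S.qpow c ≠ 0 := Complex.exp_ne_zero _

theorem RData.q_ne_zero (S : RData n) : S.q ≠ 0 := S.qpow_ne_zero _

/-- The eigenvalue `q ξ_α` as a function of the logarithmic variables. -/
noncomputable def RData.eigenvalue (S : RData n) (s : Fin 3) (α : Fin n) : Entire n :=
  Entire.expCoord (S.q * S.logNorm s) α

theorem RData.eigenvalue_eq_smul (S : RData n) (s : Fin 3) (α : Fin n) :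
    S.eigenvalue s α = S.q • Entire.expCoord (S.logNorm s) α := by
  refine Entire.ext' fun x => ?_
  show S.q * S.logNorm s * _ = S.q * (S.logNorm s * _)
  exact mul_assoc _ _ _

namespace LogData.IsModel

theorem fnMat_mul (h : d.IsModel S) (s : Fin 3) (f g : Entire n) :
    d.fnMat s (f * g) = d.fnMat s f * d.fnMat s g := by
  rw [LogData.fnMat, h.mul, map_mul]; rfl

theorem fn_one (h : d.IsModel S) (s : Fin 3) : d.fn s 1 = 1 := by
  have := h.const s 1
  rwa [map_one, map_one] at this

theorem fnMat_one (h : d.IsModel S) (s : Fin 3) : d.fnMat s 1 = 1 := by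
  rw [LogData.fnMat, h.fn_one, map_one]

theorem fn_smul (h : d.IsModel S) (s : Fin 3) (c : ℂ) (f : Entire n) :
    d.fn s (c • f) = c • d.fn s f := by
  rw [Algebra.smul_def, h.mul, h.const, ← Algebra.smul_def]

theorem fnMat_eigenvalue (h : d.IsModel S) (s : Fin 3) (α : Fin n) :
    d.fnMat s (S.eigenvalue s α) = S.q • Matrix.scalar (Fin n) (d.xi s α) := by
  rw [LogData.fnMat, S.eigenvalue_eq_smul, h.fn_smul, ← h.xi_eq]
  ext i j
  simp only [Matrix.scalar_apply, Matrix.diagonal_apply, Matrix.smul_apply]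
  split_ifs <;> simp

theorem fnMat_expSum (h : d.IsModel S) (s : Fin 3) (a : ℂ) : d.fnMat s (Entire.expSum n a) = 1 := by
  obtain ⟨g, hg⟩ := Entire.exists_expSum_eq n a
  have h0 : d.fn s 0 = 0 := by
    have := h.const s 0
    rwa [map_zero, map_zero] at this
  have hsum : d.fn s (∑ α, Entire.coord α) = ∑ α, d.fn s (Entire.coord α) :=
    map_sum (⟨⟨d.fn s, h0⟩, h.add s⟩ : Entire n →+ A) _ _
  rw [LogData.fnMat, hg, h.add, h.fn_one, h.mul, hsum, h.sum_coord, zero_mul, add_zero, map_one]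

/-- The Lagrange idempotents of a matrix `X` with the characteristic identity `∏ (X - q ξ_α) = 0`
sum up to the unit, and `X` acts on them as its eigenvalues. -/
theorem spectral (h : d.IsModel S) (s : Fin 3) {X : Matrix (Fin n) (Fin n) A}
    (hX : ∀ f, d.fnMat s f * X = X * d.fnMat s f) {a : ℕ → A}
    (ha : ∀ i ≤ n, a i = esymm (d.xi s) i)
    (hch : ∑ i ∈ Finset.range (n + 1), ((-1) ^ i * S.q ^ i : ℂ) •
      (X ^ (n - i) * Matrix.scalar (Fin n) (a i)) = 0) :
    ∑ α, specProj S.q X (d.xi s) (d.xiDiffInv s) α = 1 ∧ ∀ α,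
      X * specProj S.q X (d.xi s) (d.xiDiffInv s) α =
        d.fnMat s (S.eigenvalue s α) * specProj S.q X (d.xi s) (d.xiDiffInv s) α ∧
      specProj S.q X (d.xi s) (d.xiDiffInv s) α * X =
        specProj S.q X (d.xi s) (d.xiDiffInv s) α * d.fnMat s (S.eigenvalue s α) := by
  have h1 := spectral_decomposition S.q_ne_zero (X := X)
    (ξ := fun β => Matrix.scalar (Fin n) (d.xi s β))
    (δ := fun α β hαβ => Matrix.scalar (Fin n) (d.xiDiffInv s α β hαβ))
    (fun α => by rw [h.xi_eq]; exact (hX _).symm)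
    (fun α β => by
      rw [commute_iff_eq, ← map_mul, ← map_mul, h.xi_eq, h.xi_eq, h.comm])
    (fun α β hαβ => by rw [← map_sub, ← map_mul, h.mul_diffInv, map_one])
    (fun α β hαβ => by rw [← map_sub, ← map_mul, h.diffInv_mul, map_one])
    (by
      rw [← hch]
      refine Finset.sum_congr rfl fun i hi => ?_
      rw [ha i (by simpa [Nat.lt_succ_iff] using hi), map_esymm])
  simp only [← specProj_eq_lagrange, ← h.fnMat_eigenvalue] at h1
  exact ⟨h1.1, fun α => ⟨(h1.2 α).1, (h1.2 α).2.1⟩⟩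

theorem spectral_L (hn : 1 ≤ n) (hR : IsSLType n S.q S.R S.Psi) (h : d.IsModel S) :
    ∑ α, d.P S.q α = 1 ∧ ∀ α, d.L * d.P S.q α = d.fnMat 0 (S.eigenvalue 0 α) * d.P S.q α ∧
      d.P S.q α * d.L = d.P S.q α * d.fnMat 0 (S.eigenvalue 0 α) := by
  have hc := isCharData_of_isSLType S.q_ne_zero hn hR
  refine h.spectral 0 (h.x_comm _ (by simp)) (a := S.charCoeff d.L) h.param_L ?_
  simp only [charCoeff_eq_trM_wedge]
  exact hc.cayleyHamilton hn h.LL h.isInvertible.Linv_L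

theorem spectral_K (hn : 1 ≤ n) (hR : IsSLType n S.q S.R S.Psi) (h : d.IsModel S) :
    ∑ α, d.Q S.q α = 1 ∧ ∀ α, d.K * d.Q S.q α = d.fnMat 1 (S.eigenvalue 1 α) * d.Q S.q α ∧
      d.Q S.q α * d.K = d.Q S.q α * d.fnMat 1 (S.eigenvalue 1 α) := by
  have hc := isCharData_op_of_isSLType S.q_ne_zero hn hR
  have hdet := (isCharData_of_isSLType S.q_ne_zero hn hR).det
  refine h.spectral 1 (h.y_comm _ (by simp)) (a := S.charCoeffOp d.K) h.param_K ?_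
  have hK : ReflectionEq (opMat S.R) d.K := by
    have := congrArg (opHom n A) h.KK
    simp only [map_mul, opHom_scal, opHom_leg2] at this
    exact this
  have := hc.cayleyHamilton hn hK h.isInvertible.Kinv_K
  rw [← this]
  refine Finset.sum_congr rfl fun i hi => ?_
  rw [charCoeffOp_eq_trM_wedge S hc hdet d.K (by simpa [Nat.lt_succ_iff] using hi)]
  rfl

theorem reflectionEq_F (hn : 1 ≤ n) (hR : IsSLType n S.q S.R S.Psi) (h : d.IsModel S) :
    ReflectionEq S.R d.F := by
  have hdet := (isCharData_of_isSLType S.q_ne_zero hn hR).det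
  have hi := h.isInvertible
  have hγ : S.gamma ^ 2 ≠ 0 := pow_ne_zero _ (S.qpow_ne_zero _)
  have := reflection_of_relations hγ (R := scal A S.R) (Ri := scal A S.R⁻¹) (T₁ := leg1 d.T)
    (T₁i := leg1 d.Tinv) (T₂ := leg2 d.T) (T₂i := leg2 d.Tinv)
    (by rw [← scalHom_apply, ← scalHom_apply, ← map_mul, Matrix.mul_nonsing_inv _ hdet, map_one])
    (by rw [← leg1_mul, hi.T_Tinv, leg1_one]) (by rw [← leg1_mul, hi.Tinv_T, leg1_one])
    (by rw [← leg2_mul, hi.T_Tinv, leg2_one]) (by rw [← leg2_mul, hi.Tinv_T, leg2_one])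
    h.RTT h.LT h.KT h.KL h.LL h.KK
  simpa only [ReflectionEq, CalcData.F, leg1_mul] using this

theorem spectral_F (hn : 1 ≤ n) (hR : IsSLType n S.q S.R S.Psi) (h : d.IsModel S) :
    ∑ α, d.S S.q α = 1 ∧ ∀ α, d.F * d.S S.q α = d.fnMat 2 (S.eigenvalue 2 α) * d.S S.q α ∧
      d.S S.q α * d.F = d.S S.q α * d.fnMat 2 (S.eigenvalue 2 α) := by
  have hc := isCharData_of_isSLType S.q_ne_zero hn hR
  refine h.spectral 2 (h.z_comm _ (by simp)) (a := S.charCoeff d.F) h.param_F ?_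
  simp only [charCoeff_eq_trM_wedge]
  exact hc.cayleyHamilton hn (h.reflectionEq_F hn hR) h.isInvertible.Finv_F

end LogData.IsModel

end Spectral

/-! ### Conjugation by Gaussian exponentials -/

section Conjugation

open Entire

variable {n : ℕ} {A : Type*} [Ring A] [Algebra ℂ A] {S : RData n} {d : LogData n A}

namespace LogData.IsModel

theorem sum_conj {M ι : Type*} [Ring M] [Fintype ι] {P : ι → M} (hP : ∑ α, P α = 1) (X : M) :
    ∑ β, ∑ σ, P β * X * P σ = X := by
  simp only [← Finset.mul_sum, hP, mul_one, ← Finset.sum_mul, one_mul]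

/-- If the components `P^β X P^σ` shift the variables by `2τ (e_β - e_σ)`, then conjugation by the
Gaussian exponential acts on `X` as conjugation by the matrix `Y` with spectral idempotents `P^β`:
it multiplies each component by the ratio of its two eigenvalues. -/
theorem gauss_conj (h : d.IsModel S) (hτ : S.tau ≠ 0) {s : Fin 3}
    {X Y : Matrix (Fin n) (Fin n) A} {P : Fin n → Matrix (Fin n) (Fin n) A}
    (hP : ∑ α, P α = 1 ∧ ∀ α, Y * P α = d.fnMat s (S.eigenvalue s α) * P α ∧
      P α * Y = P α * d.fnMat s (S.eigenvalue s α))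
    (hY : ∀ f, d.fnMat s f * Y = Y * d.fnMat s f)
    (hX : ∀ f β σ, P β * X * P σ * d.fnMat s f =
      d.fnMat s (shift (S.shiftX β σ) f) * (P β * X * P σ)) :
    d.fnMat s (gauss S.gaussConst) * X * d.fnMat s (gauss (-S.gaussConst)) * Y = Y * X := by
  rw [mul_assoc _ _ Y, hY, ← sum_conj hP.1 X]
  simp only [Finset.mul_sum, Finset.sum_mul]
  refine Finset.sum_congr rfl fun β _ => Finset.sum_congr rfl fun σ _ => ?_
  have e1 : P β * X * P σ * Y = P β * X * P σ * d.fnMat s (S.eigenvalue s σ) := by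
    rw [mul_assoc, (hP.2 σ).2, ← mul_assoc]
  calc d.fnMat s (gauss S.gaussConst) * (P β * X * P σ) *
        (Y * d.fnMat s (gauss (-S.gaussConst)))
      = d.fnMat s (gauss S.gaussConst) * (P β * X * P σ * Y *
          d.fnMat s (gauss (-S.gaussConst))) := by simp only [mul_assoc]
    _ = d.fnMat s (gauss S.gaussConst) *
          (P β * X * P σ * d.fnMat s (gauss (-S.gaussConst) * S.eigenvalue s σ)) := by
        rw [e1, mul_assoc (P β * X * P σ), ← h.fnMat_mul, mul_comm (S.eigenvalue s σ)]
    _ = d.fnMat s (S.eigenvalue s β) * (P β * X * P σ) := by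
        rw [hX, ← mul_assoc, ← h.fnMat_mul, RData.eigenvalue, gauss_mul_shiftX S hτ]; rfl
    _ = Y * (P β * X * P σ) := by
        rw [mul_assoc (P β), ← mul_assoc, ← (hP.2 β).1, mul_assoc]

/-- The form of `gauss_conj` for the inverse Gaussian exponential. -/
theorem gauss_neg_conj (h : d.IsModel S) (hτ : S.tau ≠ 0) {s : Fin 3}
    {X Y : Matrix (Fin n) (Fin n) A} {P : Fin n → Matrix (Fin n) (Fin n) A}
    (hP : ∑ α, P α = 1 ∧ ∀ α, Y * P α = d.fnMat s (S.eigenvalue s α) * P α ∧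
      P α * Y = P α * d.fnMat s (S.eigenvalue s α))
    (hY : ∀ f, d.fnMat s f * Y = Y * d.fnMat s f)
    (hX : ∀ f β σ, P β * X * P σ * d.fnMat s f =
      d.fnMat s (shift (S.shiftX β σ) f) * (P β * X * P σ)) :
    Y * (d.fnMat s (gauss (-S.gaussConst)) * X * d.fnMat s (gauss S.gaussConst)) = X * Y := by
  rw [mul_assoc (d.fnMat s _), ← mul_assoc, ← hY, ← sum_conj hP.1 X]
  simp only [Finset.mul_sum, Finset.sum_mul]
  refine Finset.sum_congr rfl fun β _ => Finset.sum_congr rfl fun σ _ => ?_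
  have e1 : Y * (P β * X * P σ) = d.fnMat s (S.eigenvalue s β) * (P β * X * P σ) := by
    rw [mul_assoc (P β), ← mul_assoc, (hP.2 β).1, mul_assoc]
  calc d.fnMat s (gauss (-S.gaussConst)) * Y *
        (P β * X * P σ * d.fnMat s (gauss S.gaussConst))
      = d.fnMat s (gauss (-S.gaussConst)) * (Y * (P β * X * P σ)) *
          d.fnMat s (gauss S.gaussConst) := by simp only [mul_assoc]
    _ = d.fnMat s (gauss (-S.gaussConst) * S.eigenvalue s β) *
          (P β * X * P σ * d.fnMat s (gauss S.gaussConst)) := by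
        rw [e1, h.fnMat_mul]; simp only [mul_assoc]
    _ = P β * X * P σ * d.fnMat s (S.eigenvalue s σ) := by
        rw [hX, ← mul_assoc, ← h.fnMat_mul, RData.eigenvalue, gauss_neg_mul_shiftX S hτ, ← hX]; rfl
    _ = P β * X * P σ * Y := by rw [mul_assoc _ (P σ), ← (hP.2 σ).2, ← mul_assoc]

theorem fnMat_gauss_mul_shiftT (h : d.IsModel S) (hn : 1 ≤ n) (hτ : S.tau ≠ 0) {s : Fin 3}
    (hs : S.logNorm s = S.qpow (-(1 / (n : ℂ)))) (β : Fin n) :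
    d.fnMat s (gauss S.gaussConst * shift (S.shiftT β) (gauss (-S.gaussConst))) =
      d.fnMat s (S.eigenvalue s β) := by
  rw [gauss_mul_shiftT S hn hτ, h.fnMat_mul, h.fnMat_expSum, mul_one, S.eigenvalue_eq_smul, hs]

/-- Conjugation by the Gaussian exponential in `x` takes `T` to `L T`. -/
theorem conj_x_T (h : d.IsModel S) (hn : 1 ≤ n) (hτ : S.tau ≠ 0)
    (hR : IsSLType n S.q S.R S.Psi) :
    d.fnMat 0 (gauss S.gaussConst) * d.T * d.fnMat 0 (gauss (-S.gaussConst)) = d.L * d.T := by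
  have hP := h.spectral_L hn hR
  have e : ∑ β, d.P S.q β * d.T = d.T := by rw [← Finset.sum_mul, hP.1, one_mul]
  rw [← e]
  simp only [Finset.mul_sum, Finset.sum_mul]
  refine Finset.sum_congr rfl fun β _ => ?_
  rw [mul_assoc, h.T_x, ← mul_assoc, ← h.fnMat_mul, h.fnMat_gauss_mul_shiftT hn hτ rfl,
    ← mul_assoc, ← mul_assoc, (hP.2 β).1]

/-- Conjugation by the inverse Gaussian exponential in `y` takes `T` to `T K`. -/
theorem conj_y_T (h : d.IsModel S) (hn : 1 ≤ n) (hτ : S.tau ≠ 0)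
    (hR : IsSLType n S.q S.R S.Psi) :
    d.fnMat 1 (gauss (-S.gaussConst)) * d.T * d.fnMat 1 (gauss S.gaussConst) = d.T * d.K := by
  have hP := h.spectral_K hn hR
  have e : ∑ β, d.T * d.Q S.q β = d.T := by rw [← Finset.mul_sum, hP.1, mul_one]
  rw [← e]
  simp only [Finset.mul_sum, Finset.sum_mul]
  refine Finset.sum_congr rfl fun β _ => ?_
  rw [h.T_y, mul_assoc, ← h.fnMat_mul, mul_comm (shift _ _), h.fnMat_gauss_mul_shiftT hn hτ rfl,
    mul_assoc, mul_assoc, (hP.2 β).2]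

theorem conj_of_comm (h : d.IsModel S) {s : Fin 3} {X : Matrix (Fin n) (Fin n) A}
    (hX : ∀ f, d.fnMat s f * X = X * d.fnMat s f) {f g : Entire n} (hfg : f * g = 1) :
    d.fnMat s f * X * d.fnMat s g = X := by
  rw [hX, mul_assoc, ← h.fnMat_mul, hfg, h.fnMat_one, mul_one]

/-- Conjugation by the Gaussian exponential in `x` takes `Ω` and `F` to their conjugates by `L`. -/
theorem conj_x (h : d.IsModel S) (hn : 1 ≤ n) (hτ : S.tau ≠ 0)
    (hR : IsSLType n S.q S.R S.Psi) {X : Matrix (Fin n) (Fin n) A} (hX : X ∈ [d.Omega, d.F]) :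
    d.fnMat 0 (gauss S.gaussConst) * X * d.fnMat 0 (gauss (-S.gaussConst)) =
      d.L * X * d.Linv := by
  rw [← h.gauss_conj hτ (h.spectral_L hn hR) (h.x_comm _ (by simp)) fun f β σ => h.X_x X hX f β σ,
    mul_assoc _ d.L, h.isInvertible.L_Linv, mul_one]

theorem conj_y_Theta (h : d.IsModel S) (hn : 1 ≤ n) (hτ : S.tau ≠ 0)
    (hR : IsSLType n S.q S.R S.Psi) :
    d.fnMat 1 (gauss (-S.gaussConst)) * d.Theta * d.fnMat 1 (gauss S.gaussConst) =
      d.Kinv * d.Theta * d.K := by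
  rw [mul_assoc d.Kinv, ← h.gauss_neg_conj hτ (h.spectral_K hn hR) (h.y_comm _ (by simp)) h.Theta_y,
    ← mul_assoc, h.isInvertible.Kinv_K, one_mul]

theorem conj_z_Omega (h : d.IsModel S) (hn : 1 ≤ n) (hτ : S.tau ≠ 0)
    (hR : IsSLType n S.q S.R S.Psi) :
    d.fnMat 2 (gauss S.gaussConst) * d.Omega * d.fnMat 2 (gauss (-S.gaussConst)) =
      d.F * d.Omega * d.Finv := by
  rw [← h.gauss_conj hτ (h.spectral_F hn hR) (h.z_comm _ (by simp)) h.Omega_z,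
    mul_assoc _ d.F, h.isInvertible.F_Finv, mul_one]

end LogData.IsModel

end Conjugation

/-! ### The automorphisms of the extended calculus -/

namespace ExtCalculus

open Entire

variable {n : ℕ} (S : RData n) (k : Kind)

theorem isModel_data : (data S k).IsModel S :=
  LogData.isModel_map (k := k) (mk S k) fun _ _ h => RingQuot.mkAlgHom_rel ℂ h

/-- Endomorphisms of the extended calculus that act in the same way on `T`, `Ω`, `L`, `K` and fix
the variables and the series are equal. -/
theorem hom_ext {f g : ExtCalculus S k →ₐ[ℂ] ExtCalculus S k}
    (hT : (data S k).T.map f = (data S k).T.map g)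
    (hO : (data S k).Omega.map f = (data S k).Omega.map g)
    (hL : (data S k).L.map f = (data S k).L.map g)
    (hK : (data S k).K.map f = (data S k).K.map g)
    (hf : FixesSpectrum (data S k) f) (hg : FixesSpectrum (data S k) g) : f = g := by
  have hm := isModel_data S k
  have hc : (data S k).toCalcData.map f = (data S k).toCalcData.map g :=
    hm.isInvertible.map_eq hT hO hL hK
  have hinv : ∀ x y : ExtCalculus S k, x * y = 1 → y * x = 1 → f x = g x → f y = g y := by
    intro x y h1 h2 h3
    have e1 : f y * f x = 1 := by rw [← map_mul, h2, map_one]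
    have e2 : f x * g y = 1 := by rw [h3, ← map_mul, h1, map_one]
    exact left_inv_eq_right_inv e1 e2
  have hxi : ∀ s α, f ((data S k).xi s α) = g ((data S k).xi s α) := fun s α =>
    (hf.xi s α).trans (hg.xi s α).symm
  refine RingQuot.ringQuot_ext' ℂ f g (FreeAlgebra.hom_ext (funext fun x => ?_))
  rcases x with c | ⟨s, α⟩ | ⟨s, α⟩ | ⟨s, α, β, h⟩ | ⟨s, p⟩
  · cases c with
    | T i j => exact congrFun (congrFun (congrArg CalcData.T hc) i) j
    | Tinv i j => exact congrFun (congrFun (congrArg CalcData.Tinv hc) i) j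
    | Omega i j => exact congrFun (congrFun (congrArg CalcData.Omega hc) i) j
    | L i j => exact congrFun (congrFun (congrArg CalcData.L hc) i) j
    | Linv i j => exact congrFun (congrFun (congrArg CalcData.Linv hc) i) j
    | K i j => exact congrFun (congrFun (congrArg CalcData.K hc) i) j
    | Kinv i j => exact congrFun (congrFun (congrArg CalcData.Kinv hc) i) j
    | detTinv => exact congrArg CalcData.detTinv hc
    | detLinv => exact congrArg CalcData.detLinv hc
    | detKinv => exact congrArg CalcData.detKinv hc
  · exact hxi s α
  · exact hinv _ _ (hm.mul_inv s α) (hm.inv_mul s α) (hxi s α)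
  · refine hinv _ _ (hm.mul_diffInv s α β h) (hm.diffInv_mul s α β h) ?_
    rw [map_sub, map_sub, hxi, hxi]
  · exact (hf.fn s p).trans (hg.fn s p).symm

theorem fn_gauss_zero (s : Fin 3) : (data S k).fn s (gauss 0) = 1 := by
  rw [gauss_zero, (isModel_data S k).fn_one]

theorem phi_apply (t₁ t₂ t₃ : ℂ) (u : ExtCalculus S k) :
    phi S k t₁ t₂ t₃ u = gauss3 S k (S.gaussConst * t₁) (S.gaussConst * -t₂) (S.gaussConst * t₃) *
      u * gauss3 S k (-(S.gaussConst * t₁)) (-(S.gaussConst * -t₂)) (-(S.gaussConst * t₃)) := rfl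

theorem phi_x (u : ExtCalculus S k) : phi S k 1 0 0 u =
    (data S k).fn 0 (gauss S.gaussConst) * u * (data S k).fn 0 (gauss (-S.gaussConst)) := by
  rw [phi_apply, gauss3, gauss3]
  simp only [mul_one, neg_zero, mul_zero, fn_gauss_zero]

theorem phi_y (u : ExtCalculus S k) : phi S k 0 1 0 u =
    (data S k).fn 1 (gauss (-S.gaussConst)) * u * (data S k).fn 1 (gauss S.gaussConst) := by
  rw [phi_apply, gauss3, gauss3]
  simp only [mul_one, one_mul, neg_zero, mul_zero, fn_gauss_zero, mul_neg, neg_neg]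

theorem phi_z (u : ExtCalculus S k) : phi S k 0 0 1 u =
    (data S k).fn 2 (gauss S.gaussConst) * u * (data S k).fn 2 (gauss (-S.gaussConst)) := by
  rw [phi_apply, gauss3, gauss3]
  simp only [mul_one, one_mul, neg_zero, mul_zero, fn_gauss_zero]

theorem map_eq_fnMat_conj {s : Fin 3} {f g : Entire n}
    {ψ : ExtCalculus S k →ₐ[ℂ] ExtCalculus S k}
    (h : ∀ u, ψ u = (data S k).fn s f * u * (data S k).fn s g)
    (X : Matrix (Fin n) (Fin n) (ExtCalculus S k)) :
    X.map ψ = (data S k).fnMat s f * X * (data S k).fnMat s g := by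
  ext i j
  rw [LogData.mul_fnMat_apply, LogData.fnMat_mul_apply, ← h, Matrix.map_apply]

theorem fixesSpectrum_of_conj {s : Fin 3} {f g : Entire n} (hfg : f * g = 1)
    {ψ : ExtCalculus S k →ₐ[ℂ] ExtCalculus S k}
    (h : ∀ u, ψ u = (data S k).fn s f * u * (data S k).fn s g) : FixesSpectrum (data S k) ψ := by
  have hm := isModel_data S k
  have h1 : ∀ t p, ψ ((data S k).fn t p) = (data S k).fn t p := fun t p => by
    rw [h, hm.comm, mul_assoc, ← hm.mul, hfg, hm.fn_one, mul_one]
  exact ⟨fun t α => by rw [hm.xi_eq, h1], h1⟩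

theorem isPhiL_phi (hn : 1 ≤ n) (hτ : S.tau ≠ 0) (hR : IsSLType n S.q S.R S.Psi) :
    IsPhiL (data S k).toCalcData (phi S k 1 0 0 : ExtCalculus S k →ₐ[ℂ] ExtCalculus S k) ∧
      FixesSpectrum (data S k) (phi S k 1 0 0 : ExtCalculus S k →ₐ[ℂ] ExtCalculus S k) := by
  have hm := isModel_data S k
  have hmap := map_eq_fnMat_conj S k
    (ψ := (phi S k 1 0 0 : ExtCalculus S k →ₐ[ℂ] ExtCalculus S k)) (phi_x S k)
  refine ⟨⟨?_, ?_, ?_, ?_, ?_, ?_⟩, fixesSpectrum_of_conj S k (gauss_mul_gauss_neg _) (phi_x S k)⟩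
  · rw [hmap, hm.conj_x_T hn hτ hR]
  · rw [hmap, hm.conj_x hn hτ hR (by simp)]
  · rw [hmap, hm.conj_x hn hτ hR (by simp)]
  all_goals rw [hmap, hm.conj_of_comm (hm.x_comm _ (by simp)) (gauss_mul_gauss_neg _)]

theorem isPhiK_phi (hn : 1 ≤ n) (hτ : S.tau ≠ 0) (hR : IsSLType n S.q S.R S.Psi) :
    IsPhiK (data S k).toCalcData (phi S k 0 1 0 : ExtCalculus S k →ₐ[ℂ] ExtCalculus S k) ∧
      FixesSpectrum (data S k) (phi S k 0 1 0 : ExtCalculus S k →ₐ[ℂ] ExtCalculus S k) := by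
  have hm := isModel_data S k
  have hmap := map_eq_fnMat_conj S k
    (ψ := (phi S k 0 1 0 : ExtCalculus S k →ₐ[ℂ] ExtCalculus S k)) (phi_y S k)
  refine ⟨⟨?_, ?_, ?_, ?_, ?_, ?_⟩, fixesSpectrum_of_conj S k (gauss_neg_mul_gauss _) (phi_y S k)⟩
  · rw [hmap, hm.conj_y_T hn hτ hR]
  · rw [hmap, hm.conj_y_Theta hn hτ hR]
  all_goals rw [hmap, hm.conj_of_comm (hm.y_comm _ (by simp)) (gauss_neg_mul_gauss _)]

theorem isPhiF_phi (hn : 1 ≤ n) (hτ : S.tau ≠ 0) (hR : IsSLType n S.q S.R S.Psi) :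
    IsPhiF (data S k).toCalcData (phi S k 0 0 1 : ExtCalculus S k →ₐ[ℂ] ExtCalculus S k) ∧
      FixesSpectrum (data S k) (phi S k 0 0 1 : ExtCalculus S k →ₐ[ℂ] ExtCalculus S k) := by
  have hm := isModel_data S k
  have hmap := map_eq_fnMat_conj S k
    (ψ := (phi S k 0 0 1 : ExtCalculus S k →ₐ[ℂ] ExtCalculus S k)) (phi_z S k)
  refine ⟨⟨?_, ?_, ?_, ?_, ?_⟩, fixesSpectrum_of_conj S k (gauss_mul_gauss_neg _) (phi_z S k)⟩
  · rw [hmap, hm.conj_of_comm (hm.z_comm _ (by simp)) (gauss_mul_gauss_neg _)]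
  · rw [hmap, hm.conj_z_Omega hn hτ hR]
  all_goals rw [hmap, hm.conj_of_comm (hm.z_comm _ (by simp)) (gauss_mul_gauss_neg _)]

end ExtCalculus

/-! ### Comparison with endomorphisms of the calculus -/

namespace Calculus

variable {n : ℕ} (S : RData n) (k : Kind)

theorem isInvertible_data : (data S k).IsInvertible S :=
  CalcData.isInvertible_map (k := k) (mk S k) fun _ _ h => RingQuot.mkAlgHom_rel ℂ h

theorem hom_ext {B : Type*} [Ring B] [Algebra ℂ B] {f g : Calculus S k →ₐ[ℂ] B}
    (hT : (data S k).T.map f = (data S k).T.map g)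
    (hO : (data S k).Omega.map f = (data S k).Omega.map g)
    (hL : (data S k).L.map f = (data S k).L.map g)
    (hK : (data S k).K.map f = (data S k).K.map g) : f = g := by
  have hc := (isInvertible_data S k).map_eq hT hO hL hK
  refine RingQuot.ringQuot_ext' ℂ f g (FreeAlgebra.hom_ext (funext fun x => ?_))
  cases x with
  | T i j => exact congrFun (congrFun (congrArg CalcData.T hc) i) j
  | Tinv i j => exact congrFun (congrFun (congrArg CalcData.Tinv hc) i) j
  | Omega i j => exact congrFun (congrFun (congrArg CalcData.Omega hc) i) j
  | L i j => exact congrFun (congrFun (congrArg CalcData.L hc) i) j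
  | Linv i j => exact congrFun (congrFun (congrArg CalcData.Linv hc) i) j
  | K i j => exact congrFun (congrFun (congrArg CalcData.K hc) i) j
  | Kinv i j => exact congrFun (congrFun (congrArg CalcData.Kinv hc) i) j
  | detTinv => exact congrArg CalcData.detTinv hc
  | detLinv => exact congrArg CalcData.detLinv hc
  | detKinv => exact congrArg CalcData.detKinv hc

theorem toExt_mk_ι (x : CalcGen n) :
    toExt S k (mk S k (FreeAlgebra.ι ℂ x)) = ExtCalculus.mk S k (FreeAlgebra.ι ℂ (LogGen.calc x)) := by
  refine (RingQuot.liftAlgHom_mkAlgHom_apply ℂ _ _ _).trans ?_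
  rw [AlgHom.comp_apply, FreeAlgebra.lift_ι_apply]

theorem map_toExt : (data S k).map (toExt S k) = (ExtCalculus.data S k).toCalcData := by
  simp only [data, CalcData.map, CalcData.ofGen, ExtCalculus.data, LogData.map, LogData.ofGen,
    CalcData.mk.injEq]
  refine ⟨?_, ?_, ?_, ?_, ?_, ?_, ?_, ?_, ?_, ?_⟩
  all_goals first
    | exact toExt_mk_ι S k _
    | (ext i j; exact toExt_mk_ι S k _)

/-- It suffices to compare an endomorphism of the calculus with one of its extension on `T`, `Ω`,
`L` and `K`. -/
theorem toExt_comp {ψ : Calculus S k →ₐ[ℂ] Calculus S k}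
    {χ : ExtCalculus S k →ₐ[ℂ] ExtCalculus S k}
    (hT : (ExtCalculus.data S k).T.map χ = ((data S k).T.map ψ).map (toExt S k))
    (hO : (ExtCalculus.data S k).Omega.map χ = ((data S k).Omega.map ψ).map (toExt S k))
    (hL : (ExtCalculus.data S k).L.map χ = ((data S k).L.map ψ).map (toExt S k))
    (hK : (ExtCalculus.data S k).K.map χ = ((data S k).K.map ψ).map (toExt S k))
    (u : Calculus S k) : χ (toExt S k u) = toExt S k (ψ u) := by
  have hm := map_toExt S k
  have h : χ.comp (toExt S k) = (toExt S k).comp ψ := by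
    refine hom_ext S k ?_ ?_ ?_ ?_
    · rw [← congrArg CalcData.T hm] at hT
      exact hT
    · rw [← congrArg CalcData.Omega hm] at hO
      exact hO
    · rw [← congrArg CalcData.L hm] at hL
      exact hL
    · rw [← congrArg CalcData.K hm] at hK
      exact hK
  exact DFunLike.congr_fun h u

end Calculus

end QCalc

theorem theorem3p6 (n : ℕ) (hn : 1 ≤ n) (S : QCalc.RData n) (hτ : S.tau ≠ 0)
    (hR : QCalc.IsSLType n S.q S.R S.Psi) (k : QCalc.Kind)
    (hκ : k = QCalc.Kind.sl → S.kappaDen ≠ 0) :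
    -- a three-parameter family of inner automorphisms
    (∀ (t₁ t₂ t₃ : ℂ) (u : QCalc.ExtCalculus S k),
      QCalc.ExtCalculus.phi S k t₁ t₂ t₃ u =
        (QCalc.ExtCalculus.varphi S k t₁ t₂ t₃ : QCalc.ExtCalculus S k) * u *
          ((QCalc.ExtCalculus.varphi S k t₁ t₂ t₃)⁻¹ : (QCalc.ExtCalculus S k)ˣ)) ∧
    -- `φ_{(1,0,0)}` is the endomorphism given on generators as `φ_L`
    (∀ ψ : QCalc.ExtCalculus S k →ₐ[ℂ] QCalc.ExtCalculus S k,
      (QCalc.IsPhiL (QCalc.ExtCalculus.data S k).toCalcData ψ ∧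
        QCalc.FixesSpectrum (QCalc.ExtCalculus.data S k) ψ) ↔
      ψ = (QCalc.ExtCalculus.phi S k 1 0 0 :
        QCalc.ExtCalculus S k →ₐ[ℂ] QCalc.ExtCalculus S k)) ∧
    -- `φ_{(0,1,0)}` is the endomorphism given on generators as `φ_K`
    (∀ ψ : QCalc.ExtCalculus S k →ₐ[ℂ] QCalc.ExtCalculus S k,
      (QCalc.IsPhiK (QCalc.ExtCalculus.data S k).toCalcData ψ ∧
        QCalc.FixesSpectrum (QCalc.ExtCalculus.data S k) ψ) ↔
      ψ = (QCalc.ExtCalculus.phi S k 0 1 0 :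
        QCalc.ExtCalculus S k →ₐ[ℂ] QCalc.ExtCalculus S k)) ∧
    -- `φ_{(0,0,1)}` is the endomorphism given on generators as `φ_F`
    (∀ ψ : QCalc.ExtCalculus S k →ₐ[ℂ] QCalc.ExtCalculus S k,
      (QCalc.IsPhiF (QCalc.ExtCalculus.data S k).toCalcData ψ ∧
        QCalc.FixesSpectrum (QCalc.ExtCalculus.data S k) ψ) ↔
      ψ = (QCalc.ExtCalculus.phi S k 0 0 1 :
        QCalc.ExtCalculus S k →ₐ[ℂ] QCalc.ExtCalculus S k)) ∧
    -- on the calculus itself the three automorphisms are restrictions of members of the family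
    (∀ ψ : QCalc.Calculus S k →ₐ[ℂ] QCalc.Calculus S k,
      (QCalc.IsPhiL (QCalc.Calculus.data S k) ψ → ∀ u,
        QCalc.ExtCalculus.phi S k 1 0 0 (QCalc.Calculus.toExt S k u) =
          QCalc.Calculus.toExt S k (ψ u)) ∧
      (QCalc.IsPhiK (QCalc.Calculus.data S k) ψ → ∀ u,
        QCalc.ExtCalculus.phi S k 0 1 0 (QCalc.Calculus.toExt S k u) =
          QCalc.Calculus.toExt S k (ψ u)) ∧
      (QCalc.IsPhiF (QCalc.Calculus.data S k) ψ → ∀ u,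
        QCalc.ExtCalculus.phi S k 0 0 1 (QCalc.Calculus.toExt S k u) =
          QCalc.Calculus.toExt S k (ψ u))) := by
  have hL := QCalc.ExtCalculus.isPhiL_phi S k hn hτ hR
  have hK := QCalc.ExtCalculus.isPhiK_phi S k hn hτ hR
  have hF := QCalc.ExtCalculus.isPhiF_phi S k hn hτ hR
  have hm := QCalc.Calculus.map_toExt S k
  have mT := congrArg QCalc.CalcData.T hm
  have mO := congrArg QCalc.CalcData.Omega hm
  have mL := congrArg QCalc.CalcData.L hm
  have mLi := congrArg QCalc.CalcData.Linv hm
  have mK := congrArg QCalc.CalcData.K hm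
  have mF := (QCalc.CalcData.F_map _ _).symm.trans (congrArg QCalc.CalcData.F hm)
  have mFi := (QCalc.CalcData.Finv_map _ _).symm.trans (congrArg QCalc.CalcData.Finv hm)
  simp only [QCalc.CalcData.map] at mT mO mL mLi mK
  refine ⟨fun _ _ _ _ => rfl, fun ψ => ⟨fun h => ?_, fun h => h ▸ hL⟩,
    fun ψ => ⟨fun h => ?_, fun h => h ▸ hK⟩, fun ψ => ⟨fun h => ?_, fun h => h ▸ hF⟩,
    fun ψ => ⟨fun h => ?_, fun h => ?_, fun h => ?_⟩⟩
  · exact QCalc.ExtCalculus.hom_ext S k (h.1.T.trans hL.1.T.symm)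
      (h.1.Omega.trans hL.1.Omega.symm) (h.1.L.trans hL.1.L.symm) (h.1.K.trans hL.1.K.symm) h.2 hL.2
  · exact QCalc.ExtCalculus.hom_ext S k (h.1.T.trans hK.1.T.symm)
      (h.1.Omega.trans hK.1.Omega.symm) (h.1.L.trans hK.1.L.symm) (h.1.K.trans hK.1.K.symm) h.2 hK.2
  · exact QCalc.ExtCalculus.hom_ext S k (h.1.T.trans hF.1.T.symm)
      (h.1.Omega.trans hF.1.Omega.symm) (h.1.L.trans hF.1.L.symm) (h.1.K.trans hF.1.K.symm) h.2 hF.2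
  · refine QCalc.Calculus.toExt_comp S k (χ := QCalc.ExtCalculus.phi S k 1 0 0)
      (hL.1.T.trans ?_) (hL.1.Omega.trans ?_) (hL.1.L.trans ?_) (hL.1.K.trans ?_)
    · rw [h.T, QCalc.matrix_mul_map, mL, mT]
    · rw [h.Omega, QCalc.matrix_mul_map, QCalc.matrix_mul_map, mL, mO, mLi]
    · rw [h.L, mL]
    · rw [h.K, mK]
  · refine QCalc.Calculus.toExt_comp S k (χ := QCalc.ExtCalculus.phi S k 0 1 0)
      (hK.1.T.trans ?_) (hK.1.Omega.trans ?_) (hK.1.L.trans ?_) (hK.1.K.trans ?_)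
    · rw [h.T, QCalc.matrix_mul_map, mK, mT]
    · rw [h.Omega, mO]
    · rw [h.L, mL]
    · rw [h.K, mK]
  · refine QCalc.Calculus.toExt_comp S k (χ := QCalc.ExtCalculus.phi S k 0 0 1)
      (hF.1.T.trans ?_) (hF.1.Omega.trans ?_) (hF.1.L.trans ?_) (hF.1.K.trans ?_)
    · rw [h.T, mT]
    · rw [h.Omega, QCalc.matrix_mul_map, QCalc.matrix_mul_map, mF, mO, mFi]
    · rw [h.L, mL]
    · rw [h.K, mK]
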